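/- Let $(M,g)$ be a connected Hausdorff smooth four-dimensional manifold with a smooth Lorentzian metric of signature $(+,-,-,-)$, and let $\mathrm{Iso}$ be its isometry group with the compact-open topology. Let $\xi=(\xi_1,\xi_2)$ be a Killing pair: two pointwise linearly independent, spacelike, complete Killing fields with commuting flows $\varphi_{\xi_1},\varphi_{\xi_2}$. Put $\varphi_{\xi,s}=\varphi_{\xi_1,s_1}\circ\varphi_{\xi_2,s_2}\in\mathrm{Iso}$ for $s=(s_1,s_2)\in\mathbb R^2$. Let $\mathfrak F\subset\mathcal B(\mathcal H)$ be a concrete $C^*$-algebra on a complex Hilbert space $\mathcal H$. Let $U$ be a strongly continuous unitary representation of $\mathrm{Iso}$ on $\mathcal H$ such that $\alpha_h(F)=U(h)FU(h)^{-1}$ maps $\mathfrak F$ into itself and $h\mapsto\alpha_h(F)$ is norm continuous for all $F\in\mathfrak F$. Let $V=V^*=V^{-1}\in\mathcal B(\mathcal H)$ be such that $\gamma(A)=VAV$ maps $\mathfrak F$ into itself and $\gamma\circ\alpha_h=\alpha_h\circ\gamma$ on $\mathcal B(\mathcal H)$ for all $h\in\mathrm{Iso}$. Put $$Z=\tfrac1{\sqrt2}(1-iV),\qquad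 U_\xi(s)=U(\varphi_{\xi,s}),\qquad \tau_{\xi,s}(F)=\alpha_{\varphi_{\xi,s}}(F)=U_\xi(s)FU_\xi(s)^{-1}.$$ An operator $F\in\mathfrak F$ is called $\xi$-smooth if $\mathbb R^2\ni s\mapsto\tau_{\xi,s}(F)$ is smooth in the operator norm. For $\lambda\in\mathbb R$ and $\xi$-smooth $F\in\mathfrak F$, the warped convolution $F_{\xi,\lambda}$ is the bounded operator on $\mathcal H$ with $$F_{\xi,\lambda}\Psi=\frac1{4\pi^2}\lim_{\varepsilon\downarrow0}\int_{\mathbb R^2\times\mathbb R^2}ds\,ds'\,e^{-i s\cdot s'}\,\chi(\varepsilon s,\varepsilon s')\,U_\xi(\lambda Qs)\,F\,U_\xi(s'-\lambda Qs)\Psi,\qquad Q=\begin{pmatrix}0&1\\-1&0\end{pmatrix},$$ for all vectors $\Psi\in\mathcal H$ for which $s\mapsto U_\xi(s)\Psi$ is smooth and all $\chi\in C_0^\infty(\mathbb R^2\times\mathbb R^2)$ with $\chi(0,0)=1$. Let $\lambda\in\mathbb R$, and let $F,G\in\mathfrak F$ be $\xi$-smooth with $[Z\tau_{\xi,s}(F)Z^*,\,G]=0$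 for all $s\in\mathbb R^2$. Then the bounded operators $F_{\xi,\lambda}$ and $G_{\xi,-\lambda}$ exist and are uniquely determined by the above property, and $$[Z\,F_{\xi,\lambda}\,Z^*,\;G_{\xi,-\lambda}]=0.$$ -/

import Mathlib

open scoped Manifold ContDiff Topology

noncomputable section

/-! ### Lorentzian spacetimes, isometries and Killing pairs -/

/-- A smooth Lorentzian metric of signature `(+,-,-,-)` on a four-dimensional manifold: a smooth
field of symmetric bilinear forms on the tangent spaces, each of which has a basis in which it is
`diag(1,-1,-1,-1)`. -/
structure LorentzianMetric (M : Type*) [TopologicalSpace M]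
    [ChartedSpace (EuclideanSpace ℝ (Fin 4)) M] [IsManifold (𝓡 4) ∞ M] where
  form : ∀ p : M, TangentSpace (𝓡 4) p →L[ℝ] TangentSpace (𝓡 4) p →L[ℝ] ℝ
  symm : ∀ (p : M) (v w : TangentSpace (𝓡 4) p), form p v w = form p w v
  signature : ∀ p : M, ∃ b : Module.Basis (Fin 4) ℝ (TangentSpace (𝓡 4) p),
    ∀ i j, form p (b i) (b j) = if i = j then (if i = 0 then 1 else -1) else 0
  contMDiff : ContMDiff (𝓡 4)
    ((𝓡 4).prod 𝓘(ℝ, EuclideanSpace ℝ (Fin 4) →L[ℝ] EuclideanSpace ℝ (Fin 4) →L[ℝ] ℝ)) ∞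
    (fun p ↦ Bundle.TotalSpace.mk'
      (EuclideanSpace ℝ (Fin 4) →L[ℝ] EuclideanSpace ℝ (Fin 4) →L[ℝ] ℝ)
      (E := fun p : M ↦ TangentSpace (𝓡 4) p →L[ℝ] TangentSpace (𝓡 4) p →L[ℝ] ℝ) p (form p))

section Geometry

variable {M : Type*} [TopologicalSpace M]
  [ChartedSpace (EuclideanSpace ℝ (Fin 4)) M] [IsManifold (𝓡 4) ∞ M]

/-- A self-map `h` of `M` preserves the metric. -/
def PreservesMetric (g : LorentzianMetric M) (h : M → M) : Prop :=
  ∀ (p : M) (v w : TangentSpace (𝓡 4) p),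
    g.form (h p) (mfderiv (𝓡 4) (𝓡 4) h p v) (mfderiv (𝓡 4) (𝓡 4) h p w) = g.form p v w

theorem PreservesMetric.comp {g : LorentzianMetric M} {h k : M → M}
    (hh : PreservesMetric g h) (hk : PreservesMetric g k)
    (sh : ContMDiff (𝓡 4) (𝓡 4) ∞ h) (sk : ContMDiff (𝓡 4) (𝓡 4) ∞ k) :
    PreservesMetric g (h ∘ k) := by
  intro p v w
  have e : mfderiv (𝓡 4) (𝓡 4) (h ∘ k) p =
      (mfderiv (𝓡 4) (𝓡 4) h (k p)).comp (mfderiv (𝓡 4) (𝓡 4) k p) :=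
    mfderiv_comp p (sh.mdifferentiableAt (by simp)) (sk.mdifferentiableAt (by simp))
  rw [e]
  exact (hh (k p) _ _).trans (hk p v w)

theorem PreservesMetric.of_inverse {g : LorentzianMetric M} {h k : M → M}
    (hh : PreservesMetric g h) (sh : ContMDiff (𝓡 4) (𝓡 4) ∞ h)
    (sk : ContMDiff (𝓡 4) (𝓡 4) ∞ k) (hk : h ∘ k = id) :
    PreservesMetric g k := by
  intro p v w
  have e : (mfderiv (𝓡 4) (𝓡 4) h (k p)).comp (mfderiv (𝓡 4) (𝓡 4) k p) =
      mfderiv (𝓡 4) (𝓡 4) (id : M → M) p := by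
    rw [← hk]
    exact (mfderiv_comp p (sh.mdifferentiableAt (by simp)) (sk.mdifferentiableAt (by simp))).symm
  have e' : ∀ u : TangentSpace (𝓡 4) p,
      mfderiv (𝓡 4) (𝓡 4) h (k p) (mfderiv (𝓡 4) (𝓡 4) k p u) = u := by
    intro u
    have e2 := e.trans mfderiv_id
    exact congrArg (fun L : EuclideanSpace ℝ (Fin 4) →L[ℝ] EuclideanSpace ℝ (Fin 4) ↦ L u) e2
  have hp : h (k p) = p := congrFun hk p
  have h1 := hh (k p) (mfderiv (𝓡 4) (𝓡 4) k p v) (mfderiv (𝓡 4) (𝓡 4) k p w)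
  rw [← h1]
  have key : ∀ q : M, q = p → ∀ a b : EuclideanSpace ℝ (Fin 4),
      (g.form q : EuclideanSpace ℝ (Fin 4) →L[ℝ] EuclideanSpace ℝ (Fin 4) →L[ℝ] ℝ) a b =
      (g.form p : EuclideanSpace ℝ (Fin 4) →L[ℝ] EuclideanSpace ℝ (Fin 4) →L[ℝ] ℝ) a b := by
    rintro q rfl a b; rfl
  have h2 := key (h (k p)) hp (mfderiv (𝓡 4) (𝓡 4) h (k p) (mfderiv (𝓡 4) (𝓡 4) k p v))
    (mfderiv (𝓡 4) (𝓡 4) h (k p) (mfderiv (𝓡 4) (𝓡 4) k p w))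
  refine h2.trans ?_
  exact congrArg₂ (fun a b ↦ g.form p a b) (e' v) (e' w)

/-- The isometry group `Iso(M,g)`: the diffeomorphisms of `M` that preserve the metric. -/
def isometryGroup (g : LorentzianMetric M) : Subgroup (M ≃ₜ M) where
  carrier := {h | ContMDiff (𝓡 4) (𝓡 4) ∞ h ∧ ContMDiff (𝓡 4) (𝓡 4) ∞ h.symm ∧
    PreservesMetric g h}
  one_mem' := by
    refine ⟨contMDiff_id, contMDiff_id, ?_⟩
    intro p v w
    have e : mfderiv (𝓡 4) (𝓡 4) (⇑(1 : M ≃ₜ M)) p = ContinuousLinearMap.id ℝ _ := mfderiv_id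
    rw [e]
    rfl
  mul_mem' := by
    rintro h k ⟨h1, h2, h3⟩ ⟨k1, k2, k3⟩
    exact ⟨h1.comp k1, k2.comp h2, h3.comp k3 h1 k1⟩
  inv_mem' := by
    rintro h ⟨h1, h2, h3⟩
    exact ⟨h2, h1, h3.of_inverse h1 h2 (funext fun p ↦ h.apply_symm_apply p)⟩

/-- The isometry group carries the compact-open topology (which is its Lie group topology). -/
instance isometryGroupTopology (g : LorentzianMetric M) : TopologicalSpace (isometryGroup g) :=
  TopologicalSpace.induced
    (fun h ↦ (⟨(h : M ≃ₜ M), (h : M ≃ₜ M).continuous⟩ : C(M, M))) inferInstance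

/-- A complete Killing field: a vector field with a global smooth flow that consists of
isometries. -/
structure CompleteKillingField (g : LorentzianMetric M) where
  field : ∀ p : M, TangentSpace (𝓡 4) p
  flow : ℝ → isometryGroup g
  flow_zero : flow 0 = 1
  flow_add : ∀ s t, flow (s + t) = flow s * flow t
  flow_smooth : ContMDiff (𝓘(ℝ, ℝ).prod (𝓡 4)) (𝓡 4) ∞
    (fun x : ℝ × M ↦ (flow x.1 : M ≃ₜ M) x.2)
  flow_integral : ∀ p : M, IsMIntegralCurve (fun t ↦ (flow t : M ≃ₜ M) p) field

/-- A Killing pair `ξ = (ξ₁, ξ₂)`: two pointwise linearly independent, spacelike, complete Killing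
fields that commute (that is, whose flows commute). -/
structure KillingPair (g : LorentzianMetric M) where
  fst : CompleteKillingField g
  snd : CompleteKillingField g
  comm : ∀ s t, fst.flow s * snd.flow t = snd.flow t * fst.flow s
  spacelike_fst : ∀ p, g.form p (fst.field p) (fst.field p) < 0
  spacelike_snd : ∀ p, g.form p (snd.field p) (snd.field p) < 0
  linearIndependent : ∀ p, LinearIndependent ℝ ![fst.field p, snd.field p]

/-- The flow `φ_{ξ,s} = φ_{ξ₁,s₁} ∘ φ_{ξ₂,s₂}` of a Killing pair. -/
def KillingPair.flow {g : LorentzianMetric M} (ξ : KillingPair g) (s : EuclideanSpace ℝ (Fin 2)) :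
    isometryGroup g :=
  ξ.fst.flow (s 0) * ξ.snd.flow (s 1)

end Geometry

/-! ### Field algebras -/

/-- The setting of a quantum field theory on `(M,g)` on the Hilbert space `H`. -/
structure QuantumFieldTheory {M : Type*} [TopologicalSpace M]
    [ChartedSpace (EuclideanSpace ℝ (Fin 4)) M] [IsManifold (𝓡 4) ∞ M] (g : LorentzianMetric M)
    (H : Type*) [NormedAddCommGroup H] [InnerProductSpace ℂ H] [CompleteSpace H] where
  /-- the field algebra, a concrete `C*`-algebra on `H` (not necessarily unital) -/
  algebra : NonUnitalStarSubalgebra ℂ (H →L[ℂ] H)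
  isClosed_algebra : IsClosed (algebra : Set (H →L[ℂ] H))
  /-- the strongly continuous unitary representation of the isometry group -/
  U : isometryGroup g →* unitary (H →L[ℂ] H)
  continuous_U : ∀ Ψ : H, Continuous fun h ↦ (U h : H →L[ℂ] H) Ψ
  /-- `α_h = ad U(h)` is an action on the field algebra, -/
  α_mem : ∀ h, ∀ F ∈ algebra, (U h : H →L[ℂ] H) * F * star (U h : H →L[ℂ] H) ∈ algebra
  /-- which is strongly continuous. -/
  continuous_α : ∀ F ∈ algebra,
    Continuous fun h ↦ (U h : H →L[ℂ] H) * F * star (U h : H →L[ℂ] H)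
  /-- the selfadjoint unitary that implements the Bose/Fermi automorphism `γ(F) = V F V` -/
  V : H →L[ℂ] H
  star_V : star V = V
  V_mul_V : V * V = 1
  γ_mem : ∀ F ∈ algebra, V * F * V ∈ algebra
  /-- `γ` commutes with `α`, both being continued to all bounded operators on `H`. -/
  γ_comm_α : ∀ h, ∀ A : H →L[ℂ] H,
    V * ((U h : H →L[ℂ] H) * A * star (U h : H →L[ℂ] H)) * V =
      (U h : H →L[ℂ] H) * (V * A * V) * star (U h : H →L[ℂ] H)

namespace QuantumFieldTheory

variable {M : Type*} [TopologicalSpace M]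
  [ChartedSpace (EuclideanSpace ℝ (Fin 4)) M] [IsManifold (𝓡 4) ∞ M] {g : LorentzianMetric M}
  {H : Type*} [NormedAddCommGroup H] [InnerProductSpace ℂ H] [CompleteSpace H]

/-- The action `α_h = ad U(h)` of an isometry `h`. -/
def α (T : QuantumFieldTheory g H) (h : isometryGroup g) (F : H →L[ℂ] H) : H →L[ℂ] H :=
  (T.U h : H →L[ℂ] H) * F * star (T.U h : H →L[ℂ] H)

/-- The unitary twist operator `Z = (1 - iV)/√2`. -/
def Z (T : QuantumFieldTheory g H) : H →L[ℂ] H :=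
  (((1 / √2 : ℝ) : ℂ)) • (1 - Complex.I • T.V)

/-- `U_ξ(s) = U(φ_{ξ,s})`. -/
def Uξ (T : QuantumFieldTheory g H) (ξ : KillingPair g) (s : EuclideanSpace ℝ (Fin 2)) :
    H →L[ℂ] H :=
  (T.U (ξ.flow s) : H →L[ℂ] H)

/-- `τ_{ξ,s} = α_{φ_{ξ,s}}`. -/
def τ (T : QuantumFieldTheory g H) (ξ : KillingPair g) (s : EuclideanSpace ℝ (Fin 2))
    (F : H →L[ℂ] H) : H →L[ℂ] H :=
  T.α (ξ.flow s) F

/-- `F` is `ξ`-smooth: `s ↦ τ_{ξ,s}(F)` is smooth in the operator norm. -/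
def IsSmooth (T : QuantumFieldTheory g H) (ξ : KillingPair g) (F : H →L[ℂ] H) : Prop :=
  ContDiff ℝ ∞ fun s ↦ T.τ ξ s F

end QuantumFieldTheory

/-! ### Warped convolution -/

/-- The standard antisymmetric matrix `Q`, as a linear map of the Euclidean plane. -/
def warpQ : EuclideanSpace ℝ (Fin 2) →ₗ[ℝ] EuclideanSpace ℝ (Fin 2) :=
  Matrix.toEuclideanLin !![0, 1; -1, 0]

/-- The admissible cutoff functions: smooth, compactly supported, with value `1` at the origin. -/
structure IsCutoff (χ : EuclideanSpace ℝ (Fin 2) × EuclideanSpace ℝ (Fin 2) → ℂ) : Prop where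
  contDiff : ContDiff ℝ ∞ χ
  hasCompactSupport : HasCompactSupport χ
  map_zero : χ (0, 0) = 1

section Warping

variable {H : Type*} [NormedAddCommGroup H] [InnerProductSpace ℂ H] [CompleteSpace H]

/-- The regularized integral
`(4π²)⁻¹ ∫ ds ds' e^{-iss'} χ(εs,εs') u(λQs) F u(s'-λQs) Ψ`. -/
def warpedIntegral (u : EuclideanSpace ℝ (Fin 2) → H →L[ℂ] H) (lam : ℝ) (F : H →L[ℂ] H)
    (χ : EuclideanSpace ℝ (Fin 2) × EuclideanSpace ℝ (Fin 2) → ℂ) (ε : ℝ) (Ψ : H) : H :=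
  (1 / (4 * (Real.pi : ℂ) ^ 2)) •
    ∫ x : EuclideanSpace ℝ (Fin 2) × EuclideanSpace ℝ (Fin 2),
      (Complex.exp (-Complex.I * (inner ℝ x.1 x.2 : ℝ)) * χ (ε • x.1, ε • x.2)) •
        u (lam • warpQ x.1) (F (u (x.2 - lam • warpQ x.1) Ψ))

/-- The bounded operator `A` is the warped convolution of `F` with parameter `lam` with respect to
`u`: for all smooth vectors `Ψ` and all cutoff functions, the regularized integrals converge to
`A Ψ` as `ε → 0`. -/
def IsWarpedConvolution (u : EuclideanSpace ℝ (Fin 2) → H →L[ℂ] H) (lam : ℝ)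
    (F A : H →L[ℂ] H) : Prop :=
  ∀ Ψ : H, ContDiff ℝ ∞ (fun s ↦ u s Ψ) → ∀ χ, IsCutoff χ →
    Filter.Tendsto (fun ε : ℝ ↦ warpedIntegral u lam F χ ε Ψ) (𝓝[>] 0) (𝓝 (A Ψ))

open Classical in
/-- The warped convolution as an operator (`0` if there is none). -/
def warpedConvolution (u : EuclideanSpace ℝ (Fin 2) → H →L[ℂ] H) (lam : ℝ)
    (F : H →L[ℂ] H) : H →L[ℂ] H :=
  if h : ∃ A, IsWarpedConvolution u lam F A then h.choose else 0

end Warping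

/-- The deformed operator `F_{ξ,λ}`. -/
def QuantumFieldTheory.deformed {M : Type*} [TopologicalSpace M]
    [ChartedSpace (EuclideanSpace ℝ (Fin 4)) M] [IsManifold (𝓡 4) ∞ M] {g : LorentzianMetric M}
    {H : Type*} [NormedAddCommGroup H] [InnerProductSpace ℂ H] [CompleteSpace H]
    (T : QuantumFieldTheory g H) (ξ : KillingPair g) (lam : ℝ) (F : H →L[ℂ] H) : H →L[ℂ] H :=
  warpedConvolution (T.Uξ ξ) lam F

end

set_option linter.unusedSectionVars false

/-! Write `u` for the unitary representation `U_ξ` of the plane and τ for its adjoint action. By the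
group law the warped integrand is e^{-is·s'} τ_{λQs}(F) u(s')Ψ. For smooth F and Ψ the symbol
τ_{λQs}(F) u(s')Ψ and all its derivatives are bounded. Repeated integration by parts against the
phase gains an integrable weight, so the regularized integrals converge to a limit independent of
the cutoff (`tendsto_oscillatory`). Smooth vectors are dense (`dense_smoothVectors`), which gives
uniqueness.

Existence requires a bound by a multiple of ‖Ψ‖ and is an L² argument of Calderón–Vaillancourt type.
Undoing half of the integrations by parts turns the limit into ∫ τ_{λQx}(F₀) K_xΨ dx up to a
constant, where F₀ is F modified by derivations and K_xΨ = ∫ e^{-ix·y} k(y) u(y)Ψ dy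
(`warpLimit_eq`). By Plancherel, x ↦ K_xΨ is square integrable with norm a multiple of ‖Ψ‖
(`sq_planeSmear`). To obtain a square integrable factor from the other side, a resolvent in each
coordinate direction is inserted and moved onto Φ in ⟨Φ, τ_{λQx}(F₀) K_xΨ⟩. The inverse of the
resolvent is absorbed by derivations of F₀ and derivatives of k, without derivatives of Ψ
(`planeAd_planeSmear_eq`). The two resolvents applied to Φ are again a smearing, so Plancherel
applies once more (`damp_damp`). This bounds the form by P‖Φ‖² + C‖Ψ‖², and rescaling Φ gives
boundedness (`warpLimit_bound`).

For commutativity, the product of the regularized integrals of A at λ and B at -λ is one oscillatory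
integral over four copies of the plane. For λ ≠ 0, since Q is antisymmetric with Q² = -1, exchanging
the factors and shearing by -λ⁻¹Q preserves measure and phase. If A and B commute along the orbits,
it also carries the symbol of the product to that of the product in the opposite order
(`doubleSymbol_shearSwap`). Only the cutoff changes, and the limit does not see it. For λ = 0
warping does nothing, by Fourier inversion (`warpLimit_zero`). Passing to the limit in both factors
at once uses convergence of the adjoint integrals (`tendsto_adjWarpedIntegral`).

Finally, `V`, hence `Z`, commutes with `u` (`commute_V_Uξ`), so conjugation by `Z` commutes with
warping and the result applies to A = ZFZ* and B = G. -/

noncomputable section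

/-! ### Symbol classes -/

section Symbol

variable {Θ Z Z' G G₁ G₂ : Type*} [NormedAddCommGroup Z] [NormedSpace ℝ Z]
  [NormedAddCommGroup Z'] [NormedSpace ℝ Z']
  [NormedAddCommGroup G] [NormedSpace ℝ G] [NormedAddCommGroup G₁] [NormedSpace ℝ G₁]
  [NormedAddCommGroup G₂] [NormedSpace ℝ G₂]

/-- A family of smooth functions all of whose derivatives are bounded by multiples of the weight
`w`, uniformly in the parameter. -/
def SymbolBound (w : Z → ℝ) (F : Θ → Z → G) : Prop :=
  (∀ θ, ContDiff ℝ ∞ (F θ)) ∧ ∀ n : ℕ, ∃ C : ℝ, ∀ θ z, ‖iteratedFDeriv ℝ n (F θ) z‖ ≤ C * w z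

namespace SymbolBound

variable {w w₁ w₂ : Z → ℝ}

theorem norm_le {F : Θ → Z → G} (h : SymbolBound w F) : ∃ C : ℝ, ∀ θ z, ‖F θ z‖ ≤ C * w z := by
  obtain ⟨C, hC⟩ := h.2 0
  exact ⟨C, fun θ z ↦ by simpa using hC θ z⟩

theorem reindex {Θ' : Type*} {F : Θ → Z → G} (h : SymbolBound w F) (r : Θ' → Θ) :
    SymbolBound w fun θ ↦ F (r θ) :=
  ⟨fun _ ↦ h.1 _, fun n ↦ (h.2 n).imp fun _ hC _ z ↦ hC _ z⟩

theorem add {F₁ F₂ : Θ → Z → G} (h₁ : SymbolBound w F₁) (h₂ : SymbolBound w F₂) :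
    SymbolBound w fun θ z ↦ F₁ θ z + F₂ θ z := by
  refine ⟨fun θ ↦ (h₁.1 θ).add (h₂.1 θ), fun n ↦ ?_⟩
  obtain ⟨C₁, hC₁⟩ := h₁.2 n
  obtain ⟨C₂, hC₂⟩ := h₂.2 n
  refine ⟨C₁ + C₂, fun θ z ↦ ?_⟩
  have e : iteratedFDeriv ℝ n (fun z ↦ F₁ θ z + F₂ θ z) z =
      iteratedFDeriv ℝ n (F₁ θ) z + iteratedFDeriv ℝ n (F₂ θ) z :=
    iteratedFDeriv_add_apply ((h₁.1 θ).of_le (mod_cast le_top)).contDiffAt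
      ((h₂.1 θ).of_le (mod_cast le_top)).contDiffAt
  rw [e, add_mul]
  exact (norm_add_le _ _).trans (add_le_add (hC₁ θ z) (hC₂ θ z))

theorem bilinear (B : G₁ →L[ℝ] G₂ →L[ℝ] G) {F₁ : Θ → Z → G₁} {F₂ : Θ → Z → G₂}
    (h₁ : SymbolBound w₁ F₁) (h₂ : SymbolBound w₂ F₂) :
    SymbolBound (fun z ↦ w₁ z * w₂ z) fun θ z ↦ B (F₁ θ z) (F₂ θ z) := by
  refine ⟨fun θ ↦ (B.contDiff.comp (h₁.1 θ)).clm_apply (h₂.1 θ), fun n ↦ ?_⟩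
  choose C₁ hC₁ using h₁.2
  choose C₂ hC₂ using h₂.2
  refine ⟨‖B‖ * ∑ i ∈ Finset.range (n + 1), (n.choose i : ℝ) * (C₁ i * C₂ (n - i)),
    fun θ z ↦ ?_⟩
  refine (B.norm_iteratedFDeriv_le_of_bilinear (h₁.1 θ) (h₂.1 θ) z (n := n)
    (mod_cast le_top)).trans ?_
  rw [mul_assoc, Finset.sum_mul]
  refine mul_le_mul_of_nonneg_left (Finset.sum_le_sum fun i _ ↦ ?_) (norm_nonneg B)
  rw [mul_assoc, mul_assoc]
  refine mul_le_mul_of_nonneg_left ?_ (Nat.cast_nonneg _)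
  calc _ ≤ (C₁ i * w₁ z) * (C₂ (n - i) * w₂ z) :=
        mul_le_mul (hC₁ i θ z) (hC₂ _ θ z) (norm_nonneg _) ((norm_nonneg _).trans (hC₁ i θ z))
    _ = _ := by ring

theorem smul [NormedSpace ℂ G] {m : Θ → Z → ℂ}
    {F : Θ → Z → G} (h₁ : SymbolBound w₁ m) (h₂ : SymbolBound w₂ F) :
    SymbolBound (fun z ↦ w₁ z * w₂ z) fun θ z ↦ m θ z • F θ z :=
  h₁.bilinear (ContinuousLinearMap.lsmul ℝ ℂ : ℂ →L[ℝ] G →L[ℝ] G) h₂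

theorem fderiv_apply {F : Θ → Z → G} (h : SymbolBound w F) (e : Z) :
    SymbolBound w fun θ z ↦ fderiv ℝ (F θ) z e := by
  have hs : ∀ θ, ContDiff ℝ ∞ (fderiv ℝ (F θ)) := fun θ ↦
    (h.1 θ).fderiv_right (m := ∞) le_rfl
  refine ⟨fun θ ↦ (hs θ).clm_apply contDiff_const, fun n ↦ ?_⟩
  obtain ⟨C, hC⟩ := h.2 (n + 1)
  refine ⟨‖e‖ * C, fun θ z ↦ ?_⟩
  rw [mul_assoc]
  refine (norm_iteratedFDeriv_clm_apply_const (hs θ).contDiffAt (mod_cast le_top)).trans ?_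
  rw [norm_iteratedFDeriv_fderiv]
  exact mul_le_mul_of_nonneg_left (hC θ z) (norm_nonneg _)

/-- The chain rule costs a factor ‖T θ‖ ^ n. For the dilations by ε ∈ [0,1] this makes the
derivatives of rescaled cutoffs bounded uniformly in ε. -/
theorem comp_family {F : Z → G} (h : SymbolBound (fun _ ↦ 1) fun _ : Unit ↦ F)
    (T : Θ → Z' →L[ℝ] Z) {K : ℝ} (hT : ∀ θ, ‖T θ‖ ≤ K) :
    SymbolBound (fun _ ↦ 1) fun θ z ↦ F (T θ z) := by
  refine ⟨fun θ ↦ (h.1 ()).comp (T θ).contDiff, fun n ↦ ?_⟩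
  obtain ⟨C, hC⟩ := h.2 n
  refine ⟨C * K ^ n, fun θ z ↦ ?_⟩
  have e := (T θ).iteratedFDeriv_comp_right (h.1 ()) z (i := n) (mod_cast le_top)
  have hC0 : 0 ≤ C := by simpa using (norm_nonneg _).trans (hC () 0)
  change ‖iteratedFDeriv ℝ n (F ∘ T θ) z‖ ≤ _
  rw [e]
  refine (ContinuousMultilinearMap.norm_compContinuousLinearMap_le _ _).trans ?_
  rw [Finset.prod_const, Finset.card_univ, Fintype.card_fin, mul_one]
  exact mul_le_mul (by simpa using hC () (T θ z)) (pow_le_pow_left₀ (norm_nonneg _) (hT θ) n)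
    (by positivity) hC0

theorem comp_right {F : Z → G} (h : SymbolBound (fun _ ↦ 1) fun _ : Unit ↦ F)
    (T : Z' →L[ℝ] Z) : SymbolBound (fun _ ↦ 1) fun (_ : Unit) z ↦ F (T z) :=
  h.comp_family (fun _ ↦ T) (fun _ ↦ le_rfl)

end SymbolBound

theorem one_add_I_mul_ne_zero (t : ℝ) : (1 + Complex.I * t : ℂ) ≠ 0 := by
  intro h
  simpa using congrArg Complex.re h

theorem one_le_norm_one_add_I_mul (t : ℝ) : 1 ≤ ‖(1 + Complex.I * t : ℂ)‖ := by
  have := Complex.abs_re_le_norm (1 + Complex.I * t : ℂ)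
  simpa using this

theorem norm_inv_one_add_I_mul_le_one (t : ℝ) : ‖(1 + Complex.I * t : ℂ)⁻¹‖ ≤ 1 := by
  rw [norm_inv]
  exact inv_le_one_of_one_le₀ (one_le_norm_one_add_I_mul t)

theorem contDiff_inv_one_add_I_mul : ContDiff ℝ ∞ fun t : ℝ ↦ (1 + Complex.I * t : ℂ)⁻¹ := by
  refine ContDiff.inv ?_ one_add_I_mul_ne_zero
  exact contDiff_const.add (contDiff_const.mul Complex.ofRealCLM.contDiff)

theorem hasDerivAt_inv_one_add_I_mul (t : ℝ) :
    HasDerivAt (fun t : ℝ ↦ (1 + Complex.I * t : ℂ)⁻¹)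
      (-Complex.I * (1 + Complex.I * t : ℂ)⁻¹ ^ 2) t := by
  have h : HasDerivAt (fun t : ℝ ↦ (1 + Complex.I * t : ℂ)) (Complex.I) t := by
    simpa using ((Complex.ofRealCLM.hasDerivAt (x := t)).const_mul Complex.I).const_add 1
  have h2 := h.fun_inv (one_add_I_mul_ne_zero t)
  rwa [div_eq_mul_inv, ← inv_pow] at h2

theorem iteratedDeriv_inv_one_add_I_mul (n : ℕ) :
    iteratedDeriv n (fun t : ℝ ↦ (1 + Complex.I * t : ℂ)⁻¹) =
      fun t : ℝ ↦ (-Complex.I) ^ n * n.factorial * (1 + Complex.I * t : ℂ)⁻¹ ^ (n + 1) := by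
  induction n with
  | zero => ext t; simp
  | succ n ih =>
    ext t
    rw [iteratedDeriv_succ, ih]
    have := ((hasDerivAt_inv_one_add_I_mul t).pow (n + 1)).const_mul
      ((-Complex.I) ^ n * (n.factorial : ℂ))
    refine this.deriv.trans ?_
    push_cast [Nat.factorial_succ]
    ring

/-- Differentiating (1+it)⁻¹ only raises its power, and its modulus is at most 1. Hence the decay
gained from the factor survives differentiation. -/
theorem symbolBound_inv_one_add_I_mul (ℓ : Z →L[ℝ] ℝ) :
    SymbolBound (fun z ↦ ‖(1 + Complex.I * ℓ z : ℂ)⁻¹‖)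
      fun (_ : Θ) z ↦ (1 + Complex.I * ℓ z : ℂ)⁻¹ := by
  refine ⟨fun _ ↦ contDiff_inv_one_add_I_mul.comp ℓ.contDiff, fun n ↦
    ⟨n.factorial * ‖ℓ‖ ^ n, fun _ z ↦ ?_⟩⟩
  have e := ℓ.iteratedFDeriv_comp_right contDiff_inv_one_add_I_mul z (i := n) (mod_cast le_top)
  change ‖iteratedFDeriv ℝ n ((fun t : ℝ ↦ (1 + Complex.I * t : ℂ)⁻¹) ∘ ℓ) z‖ ≤ _
  rw [e]
  refine (ContinuousMultilinearMap.norm_compContinuousLinearMap_le _ _).trans ?_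
  rw [Finset.prod_const, Finset.card_univ, Fintype.card_fin, norm_iteratedFDeriv_eq_norm_iteratedDeriv,
    iteratedDeriv_inv_one_add_I_mul]
  have h1 := norm_inv_one_add_I_mul_le_one (ℓ z)
  have h2 : ‖(-Complex.I) ^ n * (n.factorial : ℂ) * (1 + Complex.I * ℓ z : ℂ)⁻¹ ^ (n + 1)‖ ≤
      n.factorial * ‖(1 + Complex.I * ℓ z : ℂ)⁻¹‖ := by
    rw [norm_mul, norm_mul, norm_pow, norm_pow, pow_succ]
    simp only [norm_neg, Complex.norm_I, one_pow, one_mul, Complex.norm_natCast]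
    gcongr
    exact mul_le_of_le_one_left (norm_nonneg _) (pow_le_one₀ (norm_nonneg _) h1)
  calc _ ≤ (n.factorial * ‖(1 + Complex.I * ℓ z : ℂ)⁻¹‖) * ‖ℓ‖ ^ n := by gcongr
    _ = _ := by ring

end Symbol

/-! ### Oscillatory integrals -/

section Oscillatory

open MeasureTheory Filter

variable {Z G : Type*} [NormedAddCommGroup Z] [NormedSpace ℝ Z]
  [NormedAddCommGroup G] [NormedSpace ℂ G]

/-- One integration by parts in an oscillatory integral: `f` is divided by `1 + iℓ`, and the
derivative in direction `e` is added. -/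
def oscStep (p : Z × (Z →L[ℝ] ℝ)) (f : Z → G) : Z → G := fun z ↦
  (1 + Complex.I * p.2 z : ℂ)⁻¹ • f z +
    fderiv ℝ (fun z ↦ (1 + Complex.I * p.2 z : ℂ)⁻¹ • f z) z p.1

/-- The weight gained by integrating by parts along all entries of a list. -/
def oscWeight (ps : List (Z × (Z →L[ℝ] ℝ))) (z : Z) : ℝ :=
  (ps.map fun p ↦ ‖(1 + Complex.I * p.2 z : ℂ)⁻¹‖).prod

theorem oscWeight_nil : oscWeight ([] : List (Z × (Z →L[ℝ] ℝ))) = fun _ ↦ 1 := by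
  ext z; simp [oscWeight]

theorem oscWeight_cons (p : Z × (Z →L[ℝ] ℝ)) (ps : List (Z × (Z →L[ℝ] ℝ))) :
    oscWeight (p :: ps) = fun z ↦ ‖(1 + Complex.I * p.2 z : ℂ)⁻¹‖ * oscWeight ps z := by
  ext z; simp [oscWeight]

/-- A smooth family of symbols that have compact support for nonzero values of the parameter. -/
structure OscFamily (w : Z → ℝ) (F : ℝ → Z → G) : Prop where
  contDiff : ContDiff ℝ ∞ fun x : ℝ × Z ↦ F x.1 x.2
  bound : SymbolBound w fun ε : Set.Icc (0 : ℝ) 1 ↦ F ε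
  hasCompactSupport : ∀ ε, ε ≠ 0 → HasCompactSupport (F ε)

theorem HasCompactSupport.inv_smul {f : Z → G} (hf : HasCompactSupport f) (m : Z → ℂ) :
    HasCompactSupport fun z ↦ m z • f z :=
  hf.smul_left (f := m)

theorem contDiff_fderiv_snd {F : ℝ → Z → G} (hF : ContDiff ℝ ∞ fun x : ℝ × Z ↦ F x.1 x.2)
    (e : Z) : ContDiff ℝ ∞ fun x : ℝ × Z ↦ fderiv ℝ (F x.1) x.2 e := by
  have h : (fun x : ℝ × Z ↦ fderiv ℝ (F x.1) x.2 e) =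
      fun x ↦ fderiv ℝ (fun x : ℝ × Z ↦ F x.1 x.2) x (0, e) := by
    ext x
    have h1 : HasFDerivAt (fun x : ℝ × Z ↦ F x.1 x.2)
        (fderiv ℝ (fun x : ℝ × Z ↦ F x.1 x.2) x) (x.1, x.2) :=
      (hF.differentiable (by simp) x).hasFDerivAt
    have h2 := h1.comp x.2 (hasFDerivAt_prodMk_right x.1 x.2)
    have h3 : fderiv ℝ (F x.1) x.2 = _ := h2.fderiv
    rw [h3]
    simp
  rw [h]
  exact (hF.fderiv_right (m := ∞) le_rfl).clm_apply contDiff_const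

theorem OscFamily.oscStep {w : Z → ℝ} {F : ℝ → Z → G} (hF : OscFamily w F)
    (p : Z × (Z →L[ℝ] ℝ)) :
    OscFamily (fun z ↦ ‖(1 + Complex.I * p.2 z : ℂ)⁻¹‖ * w z) fun ε ↦ oscStep p (F ε) := by
  have hs : ContDiff ℝ ∞ fun x : ℝ × Z ↦ (1 + Complex.I * p.2 x.2 : ℂ)⁻¹ • F x.1 x.2 :=
    (contDiff_inv_one_add_I_mul.comp (p.2.contDiff.comp contDiff_snd)).smul hF.contDiff
  have hb := (symbolBound_inv_one_add_I_mul (Θ := Set.Icc (0 : ℝ) 1) p.2).smul hF.bound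
  refine ⟨?_, hb.add (hb.fderiv_apply p.1), fun ε hε ↦ ?_⟩
  · refine hs.add ?_
    exact contDiff_fderiv_snd (F := fun ε z ↦ (1 + Complex.I * p.2 z : ℂ)⁻¹ • F ε z) hs p.1
  · have h := (hF.hasCompactSupport ε hε).inv_smul fun z ↦ (1 + Complex.I * p.2 z : ℂ)⁻¹
    exact h.add (h.fderiv_apply ℝ p.1)

theorem OscFamily.foldr_oscStep {F : ℝ → Z → G} (hF : OscFamily (fun _ ↦ 1) F)
    (ps : List (Z × (Z →L[ℝ] ℝ))) :
    OscFamily (oscWeight ps) fun ε ↦ ps.foldr _root_.oscStep (F ε) := by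
  induction ps with
  | nil => rwa [oscWeight_nil]
  | cons p ps ih => rw [oscWeight_cons]; exact ih.oscStep p

/-- A bounded symbol with a rescaled cutoff function. -/
theorem oscFamily_cutoff {f : Z → G} (hf : SymbolBound (fun _ ↦ 1) fun _ : Unit ↦ f)
    {χ : Z → ℂ} (hχ : ContDiff ℝ ∞ χ) (hχs : HasCompactSupport χ) :
    OscFamily (fun _ ↦ 1) fun (ε : ℝ) z ↦ χ (ε • z) • f z := by
  refine ⟨?_, ?_, fun ε hε ↦ ?_⟩
  · exact (hχ.comp (contDiff_fst.smul contDiff_snd)).smul ((hf.1 ()).comp contDiff_snd)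
  · have hχb : SymbolBound (fun _ ↦ 1) fun _ : Unit ↦ χ := by
      refine ⟨fun _ ↦ hχ, fun n ↦ ?_⟩
      obtain ⟨C, hC⟩ := (hχ.continuous_iteratedFDeriv (m := n)
        (mod_cast le_top)).bounded_above_of_compact_support (hχs.iteratedFDeriv n)
      exact ⟨C, fun _ z ↦ by simpa using hC z⟩
    have h1 := hχb.comp_family (fun ε : Set.Icc (0 : ℝ) 1 ↦ (ε : ℝ) • ContinuousLinearMap.id ℝ Z)
      (K := 1) (fun ε ↦ by
        rw [norm_smul, Real.norm_of_nonneg ε.2.1]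
        exact mul_le_one₀ ε.2.2 (norm_nonneg _) ContinuousLinearMap.norm_id_le)
    simpa using h1.smul (hf.reindex fun _ : Set.Icc (0 : ℝ) 1 ↦ ())
  · have := (hχs.comp_homeomorph (Homeomorph.smulOfNeZero ε hε)).smul_right (f' := f)
    exact this

variable [MeasurableSpace Z] [BorelSpace Z] [FiniteDimensional ℝ Z] {μ : Measure Z}
  [μ.IsAddHaarMeasure]

theorem norm_exp_neg_I_mul (t : ℝ) : ‖Complex.exp (-Complex.I * t)‖ = 1 := by
  have : -Complex.I * (t : ℂ) = ((-t : ℝ) : ℂ) * Complex.I := by push_cast; ring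
  rw [this, Complex.norm_exp_ofReal_mul_I]

theorem MeasureTheory.Integrable.phase_smul {φ : Z → ℝ} (hφ : Continuous φ) {h : Z → G}
    (hh : Integrable h μ) : Integrable (fun z ↦ Complex.exp (-Complex.I * φ z) • h z) μ := by
  refine hh.bdd_smul 1 (Continuous.aestronglyMeasurable (by fun_prop))
    (ae_of_all _ fun z ↦ (norm_exp_neg_I_mul _).le)

/-- The derivative of e^{-iφ} along e is -iℓ e^{-iφ}, so moving ∂_e onto the phase produces the
factor iℓ. Integrability is assumed instead of compact support because the identity is needed again
for merely decaying functions. -/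
theorem integral_phase_smul_add_fderiv {φ : Z → ℝ} (hφ : ContDiff ℝ ∞ φ) {e : Z}
    {ℓ : Z → ℝ} (he : ∀ z, fderiv ℝ φ z e = ℓ z) {h : Z → G} (hd : Differentiable ℝ h)
    (h1 : Integrable h μ) (h2 : Integrable (fun z ↦ fderiv ℝ h z e) μ)
    (h3 : Integrable (fun z ↦ (ℓ z : ℂ) • h z) μ) :
    ∫ z, Complex.exp (-Complex.I * φ z) • (h z + fderiv ℝ h z e) ∂μ =
      ∫ z, Complex.exp (-Complex.I * φ z) • ((1 + Complex.I * ℓ z : ℂ) • h z) ∂μ := by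
  have hfd : ∀ z, HasFDerivAt (fun z ↦ Complex.exp (-Complex.I * φ z))
      (Complex.exp (-Complex.I * φ z) • (-Complex.I • (Complex.ofRealCLM.comp (fderiv ℝ φ z)))) z := by
    intro z
    have h0 : HasFDerivAt φ (fderiv ℝ φ z) z := (hφ.differentiable (by simp) z).hasFDerivAt
    have h1 : HasFDerivAt (fun z ↦ -Complex.I * (φ z : ℂ))
        (-Complex.I • (Complex.ofRealCLM.comp (fderiv ℝ φ z))) z :=
      (Complex.ofRealCLM.hasFDerivAt.comp z h0).const_mul _
    exact h1.cexp
  have hfe : ∀ z, fderiv ℝ (fun z ↦ Complex.exp (-Complex.I * φ z)) z e =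
      Complex.exp (-Complex.I * φ z) * (-Complex.I * ℓ z) := by
    intro z
    rw [(hfd z).fderiv]
    simp [he]
  have i3 : Integrable (fun z ↦ Complex.exp (-Complex.I * φ z) • (Complex.I • (ℓ z : ℂ) • h z)) μ :=
    (h3.smul Complex.I).phase_smul hφ.continuous
  have e3 : ∀ z, fderiv ℝ (fun z ↦ Complex.exp (-Complex.I * φ z)) z e • h z =
      -(Complex.exp (-Complex.I * φ z) • (Complex.I • (ℓ z : ℂ) • h z)) := by
    intro z
    rw [hfe, smul_smul, smul_smul, ← neg_smul]
    ring_nf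
  have key := integral_smul_fderiv_eq_neg_fderiv_smul_of_integrable (μ := μ)
    (f := fun z ↦ Complex.exp (-Complex.I * φ z)) (g := h) (v := e)
    (by simp_rw [e3]; exact i3.neg) (h2.phase_smul hφ.continuous) (h1.phase_smul hφ.continuous)
    (fun z _ ↦ (hfd z).differentiableAt) (fun z _ ↦ hd z)
  simp_rw [e3, integral_neg, neg_neg] at key
  simp_rw [smul_add, add_smul, one_smul, mul_smul, smul_add]
  rw [integral_add (h1.phase_smul hφ.continuous) (h2.phase_smul hφ.continuous),
    integral_add (h1.phase_smul hφ.continuous) i3, key]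

theorem integral_phase_smul_oscStep {φ : Z → ℝ} (hφ : ContDiff ℝ ∞ φ) {p : Z × (Z →L[ℝ] ℝ)}
    (he : ∀ z, fderiv ℝ φ z p.1 = p.2 z) {f : Z → G} (hf : ContDiff ℝ ∞ f)
    (hfs : HasCompactSupport f) :
    ∫ z, Complex.exp (-Complex.I * φ z) • oscStep p f z ∂μ =
      ∫ z, Complex.exp (-Complex.I * φ z) • f z ∂μ := by
  have hs : ContDiff ℝ ∞ fun z ↦ (1 + Complex.I * p.2 z : ℂ)⁻¹ • f z :=
    (contDiff_inv_one_add_I_mul.comp p.2.contDiff).smul hf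
  have hc := hfs.inv_smul fun z ↦ (1 + Complex.I * p.2 z : ℂ)⁻¹
  have hd : Continuous fun z ↦ fderiv ℝ (fun z ↦ (1 + Complex.I * p.2 z : ℂ)⁻¹ • f z) z p.1 :=
    (hs.continuous_fderiv (by simp)).clm_apply continuous_const
  refine (integral_phase_smul_add_fderiv hφ he (hs.differentiable (by simp))
    (hs.continuous.integrable_of_hasCompactSupport hc)
    (hd.integrable_of_hasCompactSupport (hc.fderiv_apply ℝ p.1))
    (Continuous.integrable_of_hasCompactSupport ?_ (hc.inv_smul _))).trans ?_
  · exact (Complex.continuous_ofReal.comp p.2.continuous).smul hs.continuous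
  · congr 1 with z
    rw [smul_smul (1 + _ : ℂ), mul_inv_cancel₀ (one_add_I_mul_ne_zero _), one_smul]

theorem OscFamily.integral_foldr {φ : Z → ℝ} (hφ : ContDiff ℝ ∞ φ) {F : ℝ → Z → G}
    (hF : OscFamily (fun _ ↦ 1) F) (ps : List (Z × (Z →L[ℝ] ℝ)))
    (hps : ∀ p ∈ ps, ∀ z, fderiv ℝ φ z p.1 = p.2 z) {ε : ℝ} (hε : ε ≠ 0) :
    ∫ z, Complex.exp (-Complex.I * φ z) • ps.foldr _root_.oscStep (F ε) z ∂μ =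
      ∫ z, Complex.exp (-Complex.I * φ z) • F ε z ∂μ := by
  induction ps with
  | nil => rfl
  | cons p ps ih =>
    have h := hF.foldr_oscStep ps
    have hs : ContDiff ℝ ∞ (ps.foldr _root_.oscStep (F ε)) :=
      h.contDiff.comp (contDiff_prodMk_right ε)
    rw [List.foldr_cons, integral_phase_smul_oscStep hφ (hps p (by simp)) hs
      (h.hasCompactSupport ε hε)]
    exact ih fun q hq ↦ hps q (by simp [hq])

theorem foldr_oscStep_integrable (ps : List (Z × (Z →L[ℝ] ℝ))) (hint : Integrable (oscWeight ps) μ)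
    {f : Z → G} (hf : SymbolBound (fun _ ↦ 1) fun _ : Unit ↦ f) :
    Integrable (ps.foldr oscStep f) μ := by
  have : ∀ ps : List (Z × (Z →L[ℝ] ℝ)),
      SymbolBound (oscWeight ps) fun _ : Unit ↦ ps.foldr oscStep f := by
    intro ps
    induction ps with
    | nil => rwa [oscWeight_nil]
    | cons p ps ih =>
      have hb := (symbolBound_inv_one_add_I_mul (Θ := Unit) p.2).smul ih
      rw [oscWeight_cons]
      exact hb.add (hb.fderiv_apply p.1)
  obtain ⟨C, hC⟩ := (this ps).norm_le
  exact (hint.const_mul C).mono' ((this ps).1 ()).continuous.aestronglyMeasurable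
    (ae_of_all _ fun z ↦ hC () z)

/-- Convergence of oscillatory integrals of bounded symbols, to a limit that does not depend on
the cutoff function. -/
theorem tendsto_oscillatory {φ : Z → ℝ} (hφ : ContDiff ℝ ∞ φ) (ps : List (Z × (Z →L[ℝ] ℝ)))
    (hps : ∀ p ∈ ps, ∀ z, fderiv ℝ φ z p.1 = p.2 z) (hint : Integrable (oscWeight ps) μ)
    {f : Z → G} (hf : SymbolBound (fun _ ↦ 1) fun _ : Unit ↦ f)
    {χ : Z → ℂ} (hχ : ContDiff ℝ ∞ χ) (hχs : HasCompactSupport χ) (hχ0 : χ 0 = 1) :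
    Tendsto (fun ε : ℝ ↦ ∫ z, Complex.exp (-Complex.I * φ z) • χ (ε • z) • f z ∂μ) (𝓝[>] 0)
      (𝓝 (∫ z, Complex.exp (-Complex.I * φ z) • ps.foldr oscStep f z ∂μ)) := by
  have hF := oscFamily_cutoff hf hχ hχs
  have hL := hF.foldr_oscStep ps
  -- Since χ(0) = 1, the uncut integrand is the member ε = 0 of the family. The claim is then
  -- continuity in ε of the integrated-by-parts integrals, which are dominated uniformly on (0,1];
  -- for ε ≠ 0 they agree with the original ones by compact support.
  have h0 : f = fun z ↦ χ ((0 : ℝ) • z) • f z := by simp [hχ0]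
  have e : (fun ε : ℝ ↦ ∫ z, Complex.exp (-Complex.I * φ z) • χ (ε • z) • f z ∂μ) =ᶠ[𝓝[>] 0]
      fun ε ↦ ∫ z, Complex.exp (-Complex.I * φ z) •
        ps.foldr oscStep (fun z ↦ χ (ε • z) • f z) z ∂μ := by
    filter_upwards [self_mem_nhdsWithin] with ε hε
    exact (hF.integral_foldr hφ ps hps (ne_of_gt hε)).symm
  rw [tendsto_congr' e]
  conv => rhs; rw [h0]
  obtain ⟨C, hC⟩ := hL.bound.norm_le
  refine tendsto_integral_filter_of_dominated_convergence (fun z ↦ C * oscWeight ps z) ?_ ?_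
    (hint.const_mul C) (ae_of_all _ fun z ↦ ?_)
  · refine Eventually.of_forall fun ε ↦ Continuous.aestronglyMeasurable ?_
    exact (by fun_prop : Continuous fun z ↦ Complex.exp (-Complex.I * φ z)).smul
      (hL.contDiff.continuous.comp (Continuous.prodMk_right ε))
  · filter_upwards [Ioc_mem_nhdsGT (zero_lt_one' ℝ)] with ε hε
    refine ae_of_all _ fun z ↦ ?_
    rw [norm_smul, norm_exp_neg_I_mul, one_mul]
    exact hC ⟨ε, hε.1.le, hε.2⟩ z
  · refine Tendsto.const_smul ?_ _
    have := (hL.contDiff.continuous.comp (Continuous.prodMk_left z)).tendsto 0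
    exact this.mono_left nhdsWithin_le_nhds

end Oscillatory

/-! ### Plancherel's theorem for integrable square integrable functions -/

section Plancherel

open MeasureTheory SchwartzMap FourierTransform

variable {E F : Type*} [NormedAddCommGroup E] [InnerProductSpace ℝ E] [FiniteDimensional ℝ E]
  [MeasurableSpace E] [BorelSpace E]
  [NormedAddCommGroup F] [InnerProductSpace ℂ F] [CompleteSpace F]

/-- The L² transform is characterized through tempered distributions and the other one by an
integral. Tested against a smooth compactly supported g, both become the pairing of f with the
transform of g, by duality on one side and Fubini on the other. -/
theorem fourier_toLp_ae_eq {f : E → F} (hf : Integrable f) (hf2 : MemLp f 2) :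
    (𝓕 (hf2.toLp f) : Lp F 2) =ᵐ[volume] 𝓕 f := by
  have hc : Continuous (𝓕 f) :=
    VectorFourier.fourierIntegral_continuous Real.continuous_fourierChar continuous_inner hf
  refine ae_eq_of_integral_contDiff_smul_eq
    ((Lp.memLp _).locallyIntegrable (by norm_num)) hc.locallyIntegrable fun g hg hgs ↦ ?_
  set ψ : 𝓢(E, ℂ) := (hgs.comp_left (g := ((↑) : ℝ → ℂ)) rfl).toSchwartzMap
    (Complex.ofRealCLM.contDiff.comp hg) with hψ
  have hψa : ∀ x, ψ x = (g x : ℂ) := fun x ↦ rfl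
  have h1 : ∫ x, g x • (𝓕 (hf2.toLp f) : Lp (α := E) F 2 volume) x = ∫ x, ψ x • (𝓕 (hf2.toLp f) : Lp (α := E) F 2 volume) x := by
    simp [hψa]
  have h2 : ∫ x, g x • 𝓕 f x = ∫ x, ψ x • 𝓕 f x := by simp [hψa]
  rw [h1, h2, ← Lp.toTemperedDistribution_apply (μ := volume), ← Lp.fourier_toTemperedDistribution_eq,
    TemperedDistribution.fourier_apply, Lp.toTemperedDistribution_apply]
  have h3 : ∫ x, 𝓕 (ψ : E → ℂ) x • f x = ∫ x, ψ x • 𝓕 f x := by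
    simpa using! VectorFourier.integral_bilin_fourierIntegral_eq_flip
      (ContinuousLinearMap.lsmul ℂ ℂ : ℂ →L[ℂ] F →L[ℂ] F) (L := innerₗ E)
      Real.continuous_fourierChar continuous_inner ψ.integrable hf
  rw [← h3]
  refine integral_congr_ae ?_
  filter_upwards [hf2.coeFn_toLp] with x hx
  rw [hx, SchwartzMap.fourier_coe]

theorem eLpNorm_fourier_eq {f : E → F} (hf : Integrable f) (hf2 : MemLp f 2) :
    eLpNorm (𝓕 f) 2 volume = eLpNorm f 2 volume := by
  rw [← eLpNorm_congr_ae (fourier_toLp_ae_eq hf hf2), ← eLpNorm_congr_ae hf2.coeFn_toLp,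
    ← Lp.enorm_def, ← Lp.enorm_def]
  rw [← ofReal_norm, ← ofReal_norm, Lp.norm_fourier_eq]

end Plancherel

/-! ### Smooth operators and smooth vectors of a unitary representation of the plane -/

/-- The Euclidean plane. -/
abbrev Plane : Type := EuclideanSpace ℝ (Fin 2)

section Rep

open MeasureTheory Filter

variable {H : Type*} [NormedAddCommGroup H] [InnerProductSpace ℂ H] [CompleteSpace H]

/-- A strongly continuous unitary representation of the plane. -/
structure IsPlaneRep (u : Plane → H →L[ℂ] H) : Prop where
  map_zero : u 0 = 1
  map_add : ∀ s t, u (s + t) = u s * u t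
  star_eq : ∀ s, star (u s) = u (-s)
  continuous : ∀ Ψ, Continuous fun s ↦ u s Ψ

/-- The adjoint action of the plane on bounded operators. -/
def planeAd (u : Plane → H →L[ℂ] H) (s : Plane) (A : H →L[ℂ] H) : H →L[ℂ] H :=
  u s * A * u (-s)

/-- Smoothness of an operator in the operator norm. -/
def IsSmoothOp (u : Plane → H →L[ℂ] H) (A : H →L[ℂ] H) : Prop :=
  ContDiff ℝ ∞ fun s ↦ planeAd u s A

/-- Smoothness of a vector. -/
def IsSmoothVec (u : Plane → H →L[ℂ] H) (Ψ : H) : Prop :=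
  ContDiff ℝ ∞ fun s ↦ u s Ψ

variable {u : Plane → H →L[ℂ] H}

namespace IsPlaneRep

theorem mul_neg (hu : IsPlaneRep u) (s : Plane) : u s * u (-s) = 1 := by
  rw [← hu.map_add, add_neg_cancel, hu.map_zero]

theorem neg_mul (hu : IsPlaneRep u) (s : Plane) : u (-s) * u s = 1 := by
  rw [← hu.map_add, neg_add_cancel, hu.map_zero]

theorem apply_add (hu : IsPlaneRep u) (s t : Plane) (Ψ : H) : u (s + t) Ψ = u s (u t Ψ) := by
  rw [hu.map_add]; rfl

theorem neg_apply_apply (hu : IsPlaneRep u) (s : Plane) (Ψ : H) : u (-s) (u s Ψ) = Ψ := by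
  rw [← hu.apply_add, neg_add_cancel, hu.map_zero]; rfl

theorem inner_left (hu : IsPlaneRep u) (s : Plane) (Φ Ψ : H) :
    inner ℂ (u s Φ) Ψ = inner ℂ Φ (u (-s) Ψ) := by
  rw [← hu.star_eq, ContinuousLinearMap.star_eq_adjoint, ContinuousLinearMap.adjoint_inner_right]

theorem norm_apply (hu : IsPlaneRep u) (s : Plane) (Ψ : H) : ‖u s Ψ‖ = ‖Ψ‖ := by
  rw [@norm_eq_sqrt_re_inner ℂ, @norm_eq_sqrt_re_inner ℂ, hu.inner_left, hu.neg_apply_apply]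

theorem norm_le_one (hu : IsPlaneRep u) (s : Plane) : ‖u s‖ ≤ 1 :=
  (u s).opNorm_le_bound zero_le_one fun Ψ ↦ by rw [hu.norm_apply, one_mul]

/-- Only strong continuity is available. Joint continuity holds because each `u s` is isometric, so
an error in the vector is not amplified. -/
theorem continuous₂ (hu : IsPlaneRep u) {X : Type*} [TopologicalSpace X] {s : X → Plane}
    {v : X → H} (hs : Continuous s) (hv : Continuous v) : Continuous fun x ↦ u (s x) (v x) := by
  rw [continuous_iff_continuousAt]
  intro x₀
  have h1 : Tendsto (fun x ↦ u (s x) (v x₀)) (𝓝 x₀) (𝓝 (u (s x₀) (v x₀))) :=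
    ((hu.continuous (v x₀)).comp hs).tendsto x₀
  have h2 : Tendsto (fun x ↦ u (s x) (v x - v x₀)) (𝓝 x₀) (𝓝 0) := by
    rw [tendsto_zero_iff_norm_tendsto_zero]
    simp_rw [hu.norm_apply]
    simpa using ((hv.sub continuous_const).norm.tendsto x₀ :
      Tendsto (fun x ↦ ‖v x - v x₀‖) (𝓝 x₀) (𝓝 ‖v x₀ - v x₀‖))
  have := h1.add h2
  simpa [ContinuousAt, ← _root_.map_add] using this

theorem planeAd_add (hu : IsPlaneRep u) (s t : Plane) (A : H →L[ℂ] H) :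
    planeAd u (s + t) A = planeAd u s (planeAd u t A) := by
  simp only [planeAd, neg_add_rev, hu.map_add, mul_assoc]

theorem planeAd_zero (hu : IsPlaneRep u) (A : H →L[ℂ] H) : planeAd u 0 A = A := by
  simp [planeAd, hu.map_zero]

theorem planeAd_mul (hu : IsPlaneRep u) (s : Plane) (A B : H →L[ℂ] H) :
    planeAd u s (A * B) = planeAd u s A * planeAd u s B := by
  simp only [planeAd]
  rw [show u s * A * u (-s) * (u s * B * u (-s)) = u s * A * (u (-s) * u s) * B * u (-s) by
    simp only [mul_assoc], hu.neg_mul, mul_one, ← mul_assoc (u s)]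

theorem planeAd_star (hu : IsPlaneRep u) (s : Plane) (A : H →L[ℂ] H) :
    planeAd u s (star A) = star (planeAd u s A) := by
  simp only [planeAd, star_mul, hu.star_eq, neg_neg, mul_assoc]

theorem planeAd_mul_apply (hu : IsPlaneRep u) (s : Plane) (A : H →L[ℂ] H) :
    planeAd u s A * u s = u s * A := by
  rw [planeAd, mul_assoc, hu.neg_mul, mul_one]

theorem planeAd_apply_apply (hu : IsPlaneRep u) (s : Plane) (A : H →L[ℂ] H) (Ψ : H) :
    planeAd u s A (u s Ψ) = u s (A Ψ) :=
  congrArg (fun B : H →L[ℂ] H ↦ B Ψ) (hu.planeAd_mul_apply s A)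

/-- The adjoint action as a real-linear map. -/
def planeAdL (u : Plane → H →L[ℂ] H) (s : Plane) : (H →L[ℂ] H) →L[ℝ] (H →L[ℂ] H) :=
  ContinuousLinearMap.mulLeftRight ℝ (H →L[ℂ] H) (u s) (u (-s))

theorem planeAdL_apply (s : Plane) (A : H →L[ℂ] H) : planeAdL u s A = planeAd u s A := rfl

theorem norm_planeAdL_le (hu : IsPlaneRep u) (s : Plane) : ‖planeAdL u s‖ ≤ 1 :=
  (ContinuousLinearMap.opNorm_mulLeftRight_apply_apply_le ℝ (H →L[ℂ] H) _ _).trans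
    (mul_le_one₀ (hu.norm_le_one _) (norm_nonneg _) (hu.norm_le_one _))

theorem norm_planeAd_le (hu : IsPlaneRep u) (s : Plane) (A : H →L[ℂ] H) :
    ‖planeAd u s A‖ ≤ ‖A‖ := by
  have := (planeAdL u s).le_of_opNorm_le (hu.norm_planeAdL_le s) A
  rwa [one_mul, planeAdL_apply] at this

end IsPlaneRep

/-- A smooth function whose translates are images under contractions is a bounded symbol. -/
theorem symbolBound_of_translation {G : Type*} [NormedAddCommGroup G] [NormedSpace ℝ G]
    {f : Plane → G} (hf : ContDiff ℝ ∞ f) (L : Plane → G →L[ℝ] G) (hL : ∀ s, ‖L s‖ ≤ 1)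
    (h : ∀ s t, f (s + t) = L s (f t)) : SymbolBound (fun _ ↦ 1) fun _ : Unit ↦ f := by
  refine ⟨fun _ ↦ hf, fun n ↦ ⟨‖iteratedFDeriv ℝ n f 0‖, fun _ s ↦ ?_⟩⟩
  have e := iteratedFDeriv_comp_add_left (𝕜 := ℝ) (f := f) n s 0
  rw [add_zero] at e
  rw [← e, mul_one]
  have e2 : (fun t ↦ f (s + t)) = L s ∘ f := funext fun t ↦ h s t
  rw [e2]
  refine ((L s).norm_iteratedFDeriv_comp_left hf.contDiffAt (mod_cast le_top)).trans ?_
  exact mul_le_of_le_one_left (norm_nonneg _) (hL s)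

theorem IsSmoothOp.symbolBound (hu : IsPlaneRep u) {A : H →L[ℂ] H} (hA : IsSmoothOp u A) :
    SymbolBound (fun _ ↦ 1) fun (_ : Unit) s ↦ planeAd u s A :=
  symbolBound_of_translation hA (IsPlaneRep.planeAdL u) hu.norm_planeAdL_le
    fun s t ↦ hu.planeAd_add s t A

theorem IsSmoothVec.symbolBound (hu : IsPlaneRep u) {Ψ : H} (hΨ : IsSmoothVec u Ψ) :
    SymbolBound (fun _ ↦ 1) fun (_ : Unit) s ↦ u s Ψ :=
  symbolBound_of_translation hΨ (fun s ↦ (u s).restrictScalars ℝ)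
    (fun s ↦ by simpa using hu.norm_le_one s) fun s t ↦ hu.apply_add s t Ψ

theorem SymbolBound.op_apply {Θ Z : Type*} [NormedAddCommGroup Z] [NormedSpace ℝ Z]
    {A : Θ → Z → H →L[ℂ] H} {v : Θ → Z → H} (hA : SymbolBound (fun _ ↦ 1) A)
    (hv : SymbolBound (fun _ ↦ 1) v) : SymbolBound (fun _ ↦ 1) fun θ z ↦ A θ z (v θ z) := by
  simpa using hA.bilinear (ContinuousLinearMap.restrictScalarsL ℂ H H ℝ ℝ) hv

theorem IsSmoothOp.star (hu : IsPlaneRep u) {A : H →L[ℂ] H} (hA : IsSmoothOp u A) :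
    IsSmoothOp u (star A) := by
  have : (fun s ↦ planeAd u s (Star.star A)) =
      fun s ↦ (starL' ℝ : (H →L[ℂ] H) ≃L[ℝ] (H →L[ℂ] H)) (planeAd u s A) := by
    ext1 s
    rw [hu.planeAd_star]; rfl
  rw [IsSmoothOp, this]
  exact (ContinuousLinearEquiv.contDiff _).comp hA

/-- The infinitesimal adjoint action in direction `e`. -/
def opDeriv (u : Plane → H →L[ℂ] H) (e : Plane) (A : H →L[ℂ] H) : H →L[ℂ] H :=
  fderiv ℝ (fun s ↦ planeAd u s A) 0 e

/-- The infinitesimal action on vectors in direction `e`. -/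
def vecDeriv (u : Plane → H →L[ℂ] H) (e : Plane) (Ψ : H) : H :=
  fderiv ℝ (fun s ↦ u s Ψ) 0 e

theorem fderiv_of_translation {G : Type*} [NormedAddCommGroup G] [NormedSpace ℝ G]
    {f : Plane → G} (hf : ContDiff ℝ ∞ f) (L : G →L[ℝ] G) (s e : Plane)
    (h : ∀ t, f (s + t) = L (f t)) : fderiv ℝ f s e = L (fderiv ℝ f 0 e) := by
  have hd : Differentiable ℝ f := hf.differentiable (by simp)
  have h1 : fderiv ℝ (fun t ↦ f (s + t)) 0 = fderiv ℝ f s := by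
    rw [fderiv_comp_add_left, add_zero]
  have h2 : (fun t ↦ f (s + t)) = fun t ↦ L (f t) := funext h
  rw [← h1, h2]
  have := (L.hasFDerivAt.comp (0 : Plane) (hd 0).hasFDerivAt).fderiv
  exact congrArg (fun T : Plane →L[ℝ] G ↦ T e) this

theorem IsSmoothOp.fderiv_eq (hu : IsPlaneRep u) {A : H →L[ℂ] H} (hA : IsSmoothOp u A)
    (s e : Plane) : fderiv ℝ (fun s ↦ planeAd u s A) s e = planeAd u s (opDeriv u e A) :=
  fderiv_of_translation hA (IsPlaneRep.planeAdL u s) s e fun t ↦ hu.planeAd_add s t A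

theorem IsSmoothVec.fderiv_eq (hu : IsPlaneRep u) {Ψ : H} (hΨ : IsSmoothVec u Ψ)
    (s e : Plane) : fderiv ℝ (fun s ↦ u s Ψ) s e = u s (vecDeriv u e Ψ) :=
  fderiv_of_translation hΨ ((u s).restrictScalars ℝ) s e fun t ↦ hu.apply_add s t Ψ

theorem IsSmoothOp.opDeriv (hu : IsPlaneRep u) {A : H →L[ℂ] H} (hA : IsSmoothOp u A)
    (e : Plane) : IsSmoothOp u (opDeriv u e A) := by
  have : (fun s ↦ planeAd u s (_root_.opDeriv u e A)) =
      fun s ↦ fderiv ℝ (fun s ↦ planeAd u s A) s e :=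
    funext fun s ↦ (hA.fderiv_eq hu s e).symm
  rw [IsSmoothOp, this]
  exact (hA.fderiv_right (m := ∞) le_rfl).clm_apply contDiff_const

theorem IsSmoothOp.add {A B : H →L[ℂ] H} (hA : IsSmoothOp u A) (hB : IsSmoothOp u B) :
    IsSmoothOp u (A + B) := by
  have : (fun s ↦ planeAd u s (A + B)) = fun s ↦ planeAd u s A + planeAd u s B := by
    ext1 s
    simp [planeAd, mul_add, add_mul]
  rw [IsSmoothOp, this]
  exact ContDiff.add hA hB

theorem IsSmoothOp.sub {A B : H →L[ℂ] H} (hA : IsSmoothOp u A) (hB : IsSmoothOp u B) :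
    IsSmoothOp u (A - B) := by
  have : (fun s ↦ planeAd u s (A - B)) = fun s ↦ planeAd u s A - planeAd u s B := by
    ext1 s
    simp [planeAd, mul_sub, sub_mul]
  rw [IsSmoothOp, this]
  exact ContDiff.sub hA hB

/-- The smooth vectors form a subspace. -/
def smoothVectors (u : Plane → H →L[ℂ] H) : Submodule ℂ H where
  carrier := {Ψ | IsSmoothVec u Ψ}
  add_mem' {Φ Ψ} hΦ hΨ := by
    simpa [IsSmoothVec] using ContDiff.add (id hΦ : IsSmoothVec u Φ) (id hΨ : IsSmoothVec u Ψ)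
  zero_mem' := by simpa [IsSmoothVec] using contDiff_const
  smul_mem' c Ψ hΨ := by
    simpa [IsSmoothVec] using ContDiff.const_smul c (id hΨ : IsSmoothVec u Ψ)

/-- The smooth vectors are dense (Gårding). -/
theorem dense_smoothVectors (hu : IsPlaneRep u) : Dense (smoothVectors u : Set H) := by
  intro Ψ
  obtain ⟨φ, hφ⟩ : ∃ φ : ℕ → ContDiffBump (0 : Plane), Tendsto (fun n ↦ (φ n).rOut) atTop (𝓝 0) := by
    refine ⟨fun n ↦ ⟨1 / (n + 1) / 2, 1 / (n + 1), by positivity, ?_⟩, ?_⟩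
    · exact half_lt_self (by positivity)
    · exact tendsto_one_div_add_atTop_nhds_zero_nat
  -- The reflected orbit makes the convolution at 0 equal to ∫ φ_n(t) u(t)Ψ dt.
  have hc : Continuous fun s ↦ u (-s) Ψ := (hu.continuous Ψ).comp continuous_neg
  set c : ℕ → Plane → H := fun n ↦ MeasureTheory.convolution ((φ n).normed volume)
    (fun s ↦ u (-s) Ψ) (ContinuousLinearMap.lsmul ℝ ℝ) volume with hcdef
  have hlim : Tendsto (fun n ↦ c n 0) atTop (𝓝 Ψ) := by
    have := ContDiffBump.convolution_tendsto_right_of_continuous (μ := volume) (φ := φ) hφ hc 0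
    simpa [hu.map_zero] using this
  refine mem_closure_of_tendsto hlim (Eventually.of_forall fun n ↦ ?_)
  have hsm : ContDiff ℝ ∞ (c n) :=
    HasCompactSupport.contDiff_convolution_left _ (φ n).hasCompactSupport_normed
      (φ n).contDiff_normed hc.locallyIntegrable
  have hint : Integrable (fun t ↦ (φ n).normed volume t • u t Ψ) :=
    ((φ n).continuous_normed.smul (hu.continuous Ψ)).integrable_of_hasCompactSupport
      ((φ n).hasCompactSupport_normed.smul_right)
  -- The representation shifts the argument of the convolution, so the orbit of this vector inherits
  -- the smoothness of the bump function.
  have h : ∀ s, u s (c n 0) = c n (-s) := by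
    intro s
    have e0 : c n 0 = ∫ t, (φ n).normed volume t • u t Ψ := by
      simp [hcdef, MeasureTheory.convolution]
    rw [e0, ← (u s).integral_comp_comm hint]
    simp only [hcdef, MeasureTheory.convolution, ContinuousLinearMap.lsmul_apply]
    congr 1 with t
    rw [show -(-s - t) = s + t by abel, hu.apply_add, ContinuousLinearMap.map_smul_of_tower]
  change ContDiff ℝ ∞ fun s ↦ u s (c n 0)
  simp_rw [h]
  exact hsm.comp contDiff_neg

end Rep

/-! ### The phase of the warped integrals -/

section PlanePhase

open MeasureTheory Filter

instance isAddHaarMeasure_volume_prod {V W : Type*} [NormedAddCommGroup V] [InnerProductSpace ℝ V]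
    [FiniteDimensional ℝ V] [MeasurableSpace V] [BorelSpace V] [NormedAddCommGroup W]
    [InnerProductSpace ℝ W] [FiniteDimensional ℝ W] [MeasurableSpace W] [BorelSpace W] :
    (volume : Measure (V × W)).IsAddHaarMeasure :=
  Measure.prod.instIsAddHaarMeasure _ _

/-- The phase `s · s'`. -/
def planePhase (z : Plane × Plane) : ℝ := inner ℝ z.1 z.2

theorem contDiff_planePhase : ContDiff ℝ ∞ planePhase := contDiff_fst.inner ℝ contDiff_snd

/-- The unit vectors of the plane. -/
def planeE (j : Fin 2) : Plane := EuclideanSpace.single j 1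

/-- The coordinates of the plane. -/
def planeCoord (j : Fin 2) : Plane →L[ℝ] ℝ := EuclideanSpace.proj j

theorem planeCoord_apply (j : Fin 2) (x : Plane) : planeCoord j x = x j := rfl

/-- Integration by parts in the first variable. -/
def dirFst (j : Fin 2) : (Plane × Plane) × ((Plane × Plane) →L[ℝ] ℝ) :=
  ((planeE j, 0), (planeCoord j).comp (ContinuousLinearMap.snd ℝ Plane Plane))

/-- Integration by parts in the second variable. -/
def dirSnd (j : Fin 2) : (Plane × Plane) × ((Plane × Plane) →L[ℝ] ℝ) :=
  ((0, planeE j), (planeCoord j).comp (ContinuousLinearMap.fst ℝ Plane Plane))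

/-- The integrations by parts that make the warped integrals absolutely convergent. -/
def planeDirs : List ((Plane × Plane) × ((Plane × Plane) →L[ℝ] ℝ)) :=
  [dirSnd 0, dirSnd 0, dirSnd 1, dirSnd 1, dirFst 0, dirFst 0, dirFst 1, dirFst 1]

theorem fderiv_planePhase (z w : Plane × Plane) :
    fderiv ℝ planePhase z w = inner ℝ z.1 w.2 + inner ℝ w.1 z.2 := by
  have h := (hasFDerivAt_fst (𝕜 := ℝ) (p := z)).inner ℝ (hasFDerivAt_snd (𝕜 := ℝ) (p := z))
  have h' : fderiv ℝ planePhase z = _ := h.fderiv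
  rw [h']
  simp

theorem inner_planeE_right (x : Plane) (j : Fin 2) : inner ℝ x (planeE j) = x j := by
  simp [planeE, EuclideanSpace.inner_single_right]

theorem inner_planeE_left (x : Plane) (j : Fin 2) : inner ℝ (planeE j) x = x j := by
  simp [planeE, EuclideanSpace.inner_single_left]

theorem fderiv_planePhase_dirFst (j : Fin 2) (z : Plane × Plane) :
    fderiv ℝ planePhase z (dirFst j).1 = (dirFst j).2 z := by
  simp [fderiv_planePhase, dirFst, inner_planeE_left, planeCoord_apply]

theorem fderiv_planePhase_dirSnd (j : Fin 2) (z : Plane × Plane) :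
    fderiv ℝ planePhase z (dirSnd j).1 = (dirSnd j).2 z := by
  simp [fderiv_planePhase, dirSnd, inner_planeE_right, planeCoord_apply]

theorem fderiv_planePhase_planeDirs : ∀ p ∈ planeDirs, ∀ z, fderiv ℝ planePhase z p.1 = p.2 z := by
  intro p hp z
  simp only [planeDirs, List.mem_cons, List.not_mem_nil, or_false] at hp
  rcases hp with h | h | h | h | h | h | h | h <;> subst h <;>
    first | exact fderiv_planePhase_dirFst _ _ | exact fderiv_planePhase_dirSnd _ _

/-- The reciprocal `(1 + i x_j)⁻¹`. -/
def planeInv (j : Fin 2) (x : Plane) : ℂ := (1 + Complex.I * planeCoord j x : ℂ)⁻¹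

/-- The integrable function `∏ (1 + i x_j)⁻²`. -/
def planeDecay (x : Plane) : ℂ :=
  planeInv 0 x * (planeInv 0 x * (planeInv 1 x * planeInv 1 x))

theorem norm_planeInv_sq (j : Fin 2) (x : Plane) :
    ‖planeInv j x‖ * ‖planeInv j x‖ = (1 + (x j) ^ 2)⁻¹ := by
  rw [← norm_mul, planeInv, ← mul_inv, norm_inv, norm_mul, ← sq, ← Complex.normSq_eq_norm_sq]
  congr 1
  simp [Complex.normSq_apply, planeCoord_apply, sq]

theorem norm_planeDecay (x : Plane) :
    ‖planeDecay x‖ = (1 + (x 0) ^ 2)⁻¹ * (1 + (x 1) ^ 2)⁻¹ := by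
  rw [planeDecay, norm_mul, norm_mul, norm_mul, ← mul_assoc, norm_planeInv_sq, norm_planeInv_sq]

theorem integrable_plane_mul {f g : ℝ → ℝ} (hf : Integrable f) (hg : Integrable g) :
    Integrable fun x : Plane ↦ f (x 0) * g (x 1) := by
  have h1 : Integrable (fun x : Fin 2 → ℝ ↦ f (x 0) * g (x 1)) := by
    have := Integrable.fintype_prod (ι := Fin 2) (E := ℝ) (𝕜 := ℝ) (μ := fun _ ↦ volume)
      (f := ![f, g]) (fun i ↦ by fin_cases i <;> assumption)
    simpa [Fin.prod_univ_two, volume_pi] using this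
  have := (EuclideanSpace.volume_preserving_symm_measurableEquiv_toLp (Fin 2)).integrable_comp_emb
    (MeasurableEquiv.measurableEmbedding _) (g := fun x : Fin 2 → ℝ ↦ f (x 0) * g (x 1))
  exact this.2 h1

theorem integrable_norm_planeDecay : Integrable fun x : Plane ↦ ‖planeDecay x‖ := by
  simp_rw [norm_planeDecay]
  exact integrable_plane_mul integrable_inv_one_add_sq integrable_inv_one_add_sq

theorem oscWeight_planeDirs (z : Plane × Plane) :
    oscWeight planeDirs z = ‖planeDecay z.1‖ * ‖planeDecay z.2‖ := by
  simp only [oscWeight, planeDirs, List.map_cons, List.map_nil, List.prod_cons, List.prod_nil,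
    planeDecay, norm_mul, planeInv, dirFst, dirSnd, ContinuousLinearMap.comp_apply,
    ContinuousLinearMap.coe_fst', ContinuousLinearMap.coe_snd']
  ring

/-- Two integrations by parts per coordinate give the integrable factor (1+t²)⁻¹; a single one would
give only its square root. -/
theorem integrable_oscWeight_planeDirs : Integrable (oscWeight planeDirs) := by
  have : oscWeight planeDirs = fun z : Plane × Plane ↦ ‖planeDecay z.1‖ * ‖planeDecay z.2‖ :=
    funext oscWeight_planeDirs
  rw [this]
  exact integrable_norm_planeDecay.mul_prod integrable_norm_planeDecay

theorem symbolBound_planeInv {Θ : Type*} (j : Fin 2) :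
    SymbolBound (fun x ↦ ‖planeInv j x‖) fun _ : Θ ↦ planeInv j :=
  symbolBound_inv_one_add_I_mul (planeCoord j)

theorem symbolBound_planeDecay :
    SymbolBound (fun x ↦ ‖planeDecay x‖) fun _ : Unit ↦ planeDecay := by
  have h0 := symbolBound_planeInv (Θ := Unit) 0
  have h1 := symbolBound_planeInv (Θ := Unit) 1
  have := h0.smul (h0.smul (h1.smul h1))
  simpa only [planeDecay, norm_mul, smul_eq_mul] using! this

end PlanePhase

/-! ### Convergence of the warped integrals on smooth vectors -/

section WarpLimit

open MeasureTheory Filter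

variable {H : Type*} [NormedAddCommGroup H] [InnerProductSpace ℂ H] [CompleteSpace H]
  {u : Plane → H →L[ℂ] H}

/-- The linear map `s ↦ λ Q s`. -/
def planeQ (lam : ℝ) : Plane →L[ℝ] Plane := LinearMap.toContinuousLinearMap (lam • warpQ)

theorem planeQ_apply (lam : ℝ) (x : Plane) : planeQ lam x = lam • warpQ x := rfl

/-- The symbol `(s, s') ↦ τ_{λQs}(A) u(s') Ψ` of the warped integral. -/
def warpSymbol (u : Plane → H →L[ℂ] H) (lam : ℝ) (A : H →L[ℂ] H) (Ψ : H) (z : Plane × Plane) : H :=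
  planeAd u (planeQ lam z.1) A (u z.2 Ψ)

theorem symbolBound_warpSymbol (hu : IsPlaneRep u) (lam : ℝ) {A : H →L[ℂ] H} {Ψ : H}
    (hA : IsSmoothOp u A) (hΨ : IsSmoothVec u Ψ) :
    SymbolBound (fun _ ↦ 1) fun _ : Unit ↦ warpSymbol u lam A Ψ :=
  ((hA.symbolBound hu).comp_right
    ((planeQ lam).comp (ContinuousLinearMap.fst ℝ Plane Plane))).op_apply
    ((hΨ.symbolBound hu).comp_right (ContinuousLinearMap.snd ℝ Plane Plane))

/-- The limit of the warped integrals. -/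
def warpLimit (u : Plane → H →L[ℂ] H) (lam : ℝ) (A : H →L[ℂ] H) (Ψ : H) : H :=
  (1 / (4 * (Real.pi : ℂ) ^ 2)) •
    ∫ z, Complex.exp (-Complex.I * planePhase z) • planeDirs.foldr oscStep (warpSymbol u lam A Ψ) z

/-- The group law gives u(λQs) A u(s'-λQs) = τ_{λQs}(A) u(s'), which separates the dependence on s
from that on s' and exhibits a bounded symbol. -/
theorem warpedIntegral_eq (hu : IsPlaneRep u) (lam : ℝ) (A : H →L[ℂ] H)
    (χ : Plane × Plane → ℂ) (ε : ℝ) (Ψ : H) :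
    warpedIntegral u lam A χ ε Ψ = (1 / (4 * (Real.pi : ℂ) ^ 2)) •
      ∫ z, Complex.exp (-Complex.I * planePhase z) • χ (ε • z) • warpSymbol u lam A Ψ z := by
  rw [warpedIntegral]
  congr 2 with z
  rw [mul_smul, warpSymbol, planeAd, sub_eq_neg_add, hu.apply_add]
  rfl

theorem tendsto_warpedIntegral (hu : IsPlaneRep u) (lam : ℝ) {A : H →L[ℂ] H} {Ψ : H}
    (hA : IsSmoothOp u A) (hΨ : IsSmoothVec u Ψ) {χ : Plane × Plane → ℂ} (hχ : IsCutoff χ) :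
    Tendsto (fun ε : ℝ ↦ warpedIntegral u lam A χ ε Ψ) (𝓝[>] 0) (𝓝 (warpLimit u lam A Ψ)) := by
  simp_rw [warpedIntegral_eq hu]
  exact (tendsto_oscillatory contDiff_planePhase planeDirs fderiv_planePhase_planeDirs
    integrable_oscWeight_planeDirs (symbolBound_warpSymbol hu lam hA hΨ) hχ.contDiff
    hχ.hasCompactSupport hχ.map_zero).const_smul _

end WarpLimit

/-! ### The limit as a single integral of operators applied to smeared vectors -/

section WarpFormula

open MeasureTheory Filter

variable {H : Type*} [NormedAddCommGroup H] [InnerProductSpace ℂ H] [CompleteSpace H]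
  {u : Plane → H →L[ℂ] H}

theorem contDiff_planeInv (j : Fin 2) : ContDiff ℝ ∞ (planeInv j) :=
  (symbolBound_planeInv (Θ := Unit) j).1 ()

theorem contDiff_opVec {a : Plane → H →L[ℂ] H} {v : Plane → H} (ha : ContDiff ℝ ∞ a)
    (hv : ContDiff ℝ ∞ v) : ContDiff ℝ ∞ fun z : Plane × Plane ↦ a z.1 (v z.2) :=
  ((ContinuousLinearMap.restrictScalarsL ℂ H H ℝ ℝ).contDiff.comp
    (ha.comp contDiff_fst)).clm_apply (hv.comp contDiff_snd)

theorem fderiv_fst_of_differentiable {h : Plane × Plane → H} {z : Plane × Plane}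
    (hh : DifferentiableAt ℝ h z) (e : Plane) :
    fderiv ℝ h z (e, 0) = fderiv ℝ (fun x ↦ h (x, z.2)) z.1 e := by
  have h1 : HasFDerivAt h (fderiv ℝ h z) (z.1, z.2) := hh.hasFDerivAt
  have h2 := (HasFDerivAt.comp (f := fun x : Plane ↦ (x, z.2)) z.1 h1
    (hasFDerivAt_prodMk_left z.1 z.2)).fderiv
  have h3 : fderiv ℝ (fun x ↦ h (x, z.2)) z.1 = _ := h2
  rw [h3]
  simp

theorem fderiv_snd_of_differentiable {h : Plane × Plane → H} {z : Plane × Plane}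
    (hh : DifferentiableAt ℝ h z) (e : Plane) :
    fderiv ℝ h z (0, e) = fderiv ℝ (fun x ↦ h (z.1, x)) z.2 e := by
  have h1 : HasFDerivAt h (fderiv ℝ h z) (z.1, z.2) := hh.hasFDerivAt
  have h2 := (h1.comp z.2 (hasFDerivAt_prodMk_right z.1 z.2)).fderiv
  have h3 : fderiv ℝ (fun x ↦ h (z.1, x)) z.2 = _ := h2
  rw [h3]
  simp

/-- The multiplier depends on the second variable only while the derivative is taken in the first,
so a symbol of product form keeps that form. The same holds with the variables exchanged. -/
theorem oscStep_dirFst (j : Fin 2) {a : Plane → H →L[ℂ] H} {v : Plane → H}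
    (ha : ContDiff ℝ ∞ a) (hv : ContDiff ℝ ∞ v) :
    oscStep (dirFst j) (fun z : Plane × Plane ↦ a z.1 (v z.2)) =
      fun z ↦ (a z.1 + fderiv ℝ a z.1 (planeE j)) (planeInv j z.2 • v z.2) := by
  ext z
  have hd : DifferentiableAt ℝ (fun z : Plane × Plane ↦ planeInv j z.2 • a z.1 (v z.2)) z :=
    (((contDiff_planeInv j).comp contDiff_snd).smul (contDiff_opVec ha hv)).differentiable
      (by simp) z
  have h1 : HasFDerivAt (fun x ↦ planeInv j z.2 • a x (v z.2)) _ z.1 :=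
    (((ContinuousLinearMap.apply ℂ H (planeInv j z.2 • v z.2)).restrictScalars ℝ).hasFDerivAt.comp
      z.1 (ha.differentiable (by simp) z.1).hasFDerivAt).congr_of_eventuallyEq
      (Eventually.of_forall fun x ↦ by simp)
  have h2 : oscStep (dirFst j) (fun z : Plane × Plane ↦ a z.1 (v z.2)) z =
      planeInv j z.2 • a z.1 (v z.2) +
        fderiv ℝ (fun z : Plane × Plane ↦ planeInv j z.2 • a z.1 (v z.2)) z (planeE j, 0) := rfl
  rw [h2, fderiv_fst_of_differentiable hd, h1.fderiv]
  simp

theorem oscStep_dirSnd (j : Fin 2) {a : Plane → H →L[ℂ] H} {v : Plane → H}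
    (ha : ContDiff ℝ ∞ a) (hv : ContDiff ℝ ∞ v) :
    oscStep (dirSnd j) (fun z : Plane × Plane ↦ a z.1 (v z.2)) =
      fun z ↦ (planeInv j z.1 • a z.1) (v z.2 + fderiv ℝ v z.2 (planeE j)) := by
  ext z
  have hd : DifferentiableAt ℝ (fun z : Plane × Plane ↦ planeInv j z.1 • a z.1 (v z.2)) z :=
    (((contDiff_planeInv j).comp contDiff_fst).smul (contDiff_opVec ha hv)).differentiable
      (by simp) z
  have h1 : HasFDerivAt (fun y ↦ planeInv j z.1 • a z.1 (v y)) _ z.2 :=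
    (((planeInv j z.1 • a z.1).restrictScalars ℝ).hasFDerivAt.comp
      z.2 (hv.differentiable (by simp) z.2).hasFDerivAt)
  have h2 : oscStep (dirSnd j) (fun z : Plane × Plane ↦ a z.1 (v z.2)) z =
      planeInv j z.1 • a z.1 (v z.2) +
        fderiv ℝ (fun z : Plane × Plane ↦ planeInv j z.1 • a z.1 (v z.2)) z (0, planeE j) := rfl
  rw [h2, fderiv_snd_of_differentiable hd, h1.fderiv]
  simp

/-- `A` plus its infinitesimal variation along `λ Q e_j`. -/
def opStep (u : Plane → H →L[ℂ] H) (lam : ℝ) (j : Fin 2) (A : H →L[ℂ] H) : H →L[ℂ] H :=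
  A + opDeriv u (planeQ lam (planeE j)) A

theorem IsSmoothOp.opStep (hu : IsPlaneRep u) (lam : ℝ) (j : Fin 2) {A : H →L[ℂ] H}
    (hA : IsSmoothOp u A) : IsSmoothOp u (opStep u lam j A) :=
  hA.add (hA.opDeriv hu _)

/-- The operator that appears in the warped integral after integration by parts. -/
def opSteps (u : Plane → H →L[ℂ] H) (lam : ℝ) (A : H →L[ℂ] H) : H →L[ℂ] H :=
  opStep u lam 0 (opStep u lam 0 (opStep u lam 1 (opStep u lam 1 A)))

theorem IsSmoothOp.opSteps (hu : IsPlaneRep u) (lam : ℝ) {A : H →L[ℂ] H}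
    (hA : IsSmoothOp u A) : IsSmoothOp u (opSteps u lam A) :=
  (((hA.opStep hu lam 1).opStep hu lam 1).opStep hu lam 0).opStep hu lam 0

theorem contDiff_planeAd_planeQ (lam : ℝ) {A : H →L[ℂ] H} (hA : IsSmoothOp u A) :
    ContDiff ℝ ∞ fun x ↦ planeAd u (planeQ lam x) A :=
  hA.comp (planeQ lam).contDiff

theorem planeAd_opStep (hu : IsPlaneRep u) (lam : ℝ) (j : Fin 2) {A : H →L[ℂ] H}
    (hA : IsSmoothOp u A) (x : Plane) :
    planeAd u (planeQ lam x) A + fderiv ℝ (fun x ↦ planeAd u (planeQ lam x) A) x (planeE j) =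
      planeAd u (planeQ lam x) (opStep u lam j A) := by
  have h1 := ((hA.differentiable (by simp) (planeQ lam x)).hasFDerivAt.comp x
    (planeQ lam).hasFDerivAt).fderiv
  have h2 : fderiv ℝ (fun x ↦ planeAd u (planeQ lam x) A) x = _ := h1
  rw [h2, ContinuousLinearMap.comp_apply, hA.fderiv_eq hu]
  simp [planeAd, opStep, mul_add, add_mul]

theorem oscStep_warp (hu : IsPlaneRep u) (lam : ℝ) (j : Fin 2) {A : H →L[ℂ] H}
    (hA : IsSmoothOp u A) {v : Plane → H} (hv : ContDiff ℝ ∞ v) :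
    oscStep (dirFst j) (fun z : Plane × Plane ↦ planeAd u (planeQ lam z.1) A (v z.2)) =
      fun z ↦ planeAd u (planeQ lam z.1) (opStep u lam j A) (planeInv j z.2 • v z.2) := by
  rw [oscStep_dirFst j (contDiff_planeAd_planeQ lam hA) hv]
  ext z
  rw [planeAd_opStep hu lam j hA]

/-- `v` plus its derivative in direction `e_j`. -/
def vecStep (j : Fin 2) (v : Plane → H) (y : Plane) : H := v y + fderiv ℝ v y (planeE j)

theorem symbolBound_vecStep {w : Plane → ℝ} (j : Fin 2) {v : Plane → H}
    (hv : SymbolBound w fun _ : Unit ↦ v) : SymbolBound w fun _ : Unit ↦ vecStep j v :=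
  hv.add (hv.fderiv_apply (planeE j))

/-- `foldr` starts at the right end of the list. The steps in the first variable come first: they
turn A into `opSteps u lam A` and attach `planeDecay` to the orbit of Ψ. The steps in the second
variable then attach `planeDecay z.1` and differentiate the vector factor. -/
theorem foldr_planeDirs (hu : IsPlaneRep u) (lam : ℝ) {A : H →L[ℂ] H} {Ψ : H}
    (hA : IsSmoothOp u A) (hΨ : IsSmoothVec u Ψ) :
    planeDirs.foldr oscStep (warpSymbol u lam A Ψ) = fun z ↦ planeDecay z.1 •
      planeAd u (planeQ lam z.1) (opSteps u lam A)
        (vecStep 0 (vecStep 0 (vecStep 1 (vecStep 1 fun y ↦ planeDecay y • u y Ψ))) z.2) := by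
  have hv0 : ContDiff ℝ ∞ fun y ↦ u y Ψ := hΨ
  have hv1 : ContDiff ℝ ∞ fun y ↦ planeInv 1 y • u y Ψ := (contDiff_planeInv 1).smul hv0
  have hv2 : ContDiff ℝ ∞ fun y ↦ planeInv 1 y • planeInv 1 y • u y Ψ :=
    (contDiff_planeInv 1).smul hv1
  have hv3 : ContDiff ℝ ∞ fun y ↦ planeInv 0 y • planeInv 1 y • planeInv 1 y • u y Ψ :=
    (contDiff_planeInv 0).smul hv2
  have e : warpSymbol u lam A Ψ = fun z ↦ planeAd u (planeQ lam z.1) A (u z.2 Ψ) := rfl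
  simp only [planeDirs, List.foldr_cons, List.foldr_nil]
  rw [e, oscStep_warp hu lam 1 hA hv0, oscStep_warp hu lam 1 (hA.opStep hu lam 1) hv1,
    oscStep_warp hu lam 0 ((hA.opStep hu lam 1).opStep hu lam 1) hv2,
    oscStep_warp hu lam 0 (((hA.opStep hu lam 1).opStep hu lam 1).opStep hu lam 0) hv3]
  have ed : (fun y ↦ planeInv 0 y • planeInv 0 y • planeInv 1 y • planeInv 1 y • u y Ψ) =
      fun y ↦ planeDecay y • u y Ψ := by
    ext y
    simp only [planeDecay, mul_smul]
  have hw0 : ContDiff ℝ ∞ fun y ↦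
      planeInv 0 y • planeInv 0 y • planeInv 1 y • planeInv 1 y • u y Ψ := (contDiff_planeInv 0).smul hv3
  -- Regrouping the four reciprocals into `planeDecay` restores a product symbol for the remaining
  -- steps.
  change oscStep _ (oscStep _ (oscStep _ (oscStep _ fun z : Plane × Plane ↦
    planeAd u (planeQ lam z.1) (opSteps u lam A)
      ((fun y ↦ planeInv 0 y • planeInv 0 y • planeInv 1 y • planeInv 1 y • u y Ψ) z.2)))) = _
  rw [ed]
  replace hw0 : ContDiff ℝ ∞ fun y ↦ planeDecay y • u y Ψ := by rw [← ed]; exact hw0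
  have hstep : ∀ (j : Fin 2) {v : Plane → H}, ContDiff ℝ ∞ v → ContDiff ℝ ∞ (vecStep j v) :=
    fun j v hv ↦ hv.add ((hv.fderiv_right (m := ∞) le_rfl).clm_apply contDiff_const)
  have ha0 := contDiff_planeAd_planeQ lam (hA.opSteps hu lam)
  have ha1 := (contDiff_planeInv 1).smul ha0
  have ha2 := (contDiff_planeInv 1).smul ha1
  have ha3 := (contDiff_planeInv 0).smul ha2
  rw [oscStep_dirSnd 1 ha0 hw0]
  have s1 := oscStep_dirSnd 1 ha1 (hstep 1 hw0)
  have s2 := oscStep_dirSnd 0 ha2 (hstep 1 (hstep 1 hw0))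
  have s3 := oscStep_dirSnd 0 ha3 (hstep 0 (hstep 1 (hstep 1 hw0)))
  refine (congrArg (fun f ↦ oscStep (dirSnd 0) (oscStep (dirSnd 0) f)) s1).trans
    ((congrArg (oscStep (dirSnd 0)) s2).trans (s3.trans ?_))
  ext z
  simp only [smul_apply, planeDecay, mul_smul]
  rfl

/-- The operator `Ψ ↦ ∫ e^{-ix·y} k(y) u(y) Ψ dy`. -/
def planeSmear (u : Plane → H →L[ℂ] H) (k : Plane → ℂ) (x : Plane) (Ψ : H) : H :=
  ∫ y, Complex.exp (-Complex.I * (inner ℝ x y : ℝ)) • k y • u y Ψ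

theorem fderiv_inner_left (x : Plane) (y e : Plane) :
    fderiv ℝ (fun y : Plane ↦ (inner ℝ x y : ℝ)) y e = inner ℝ x e :=
  congrArg (fun L : Plane →L[ℝ] ℝ ↦ L e) (innerSL ℝ x).fderiv

/-- At fixed x, integration by parts in y against e^{-ix·y} is multiplication by 1 + i x_j. This
reverses the steps taken in the second variable. -/
theorem integral_phase_vecStep (x : Plane) (j : Fin 2) {w : Plane → ℝ} (hw : Integrable w)
    {v : Plane → H} (hv : SymbolBound w fun _ : Unit ↦ v) :
    ∫ y, Complex.exp (-Complex.I * (inner ℝ x y : ℝ)) • vecStep j v y =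
      (planeInv j x)⁻¹ • ∫ y, Complex.exp (-Complex.I * (inner ℝ x y : ℝ)) • v y := by
  have hi : ∀ {v : Plane → H}, (SymbolBound w fun _ : Unit ↦ v) → Integrable v := by
    intro v hv
    obtain ⟨C, hC⟩ := hv.norm_le
    exact (hw.const_mul C).mono' (hv.1 ()).continuous.aestronglyMeasurable
      (ae_of_all _ fun z ↦ hC () z)
  have key := integral_phase_smul_add_fderiv (μ := volume) (φ := fun y : Plane ↦ (inner ℝ x y : ℝ))
    (innerSL ℝ x).contDiff (e := planeE j) (ℓ := fun _ ↦ x j)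
    (fun y ↦ by rw [fderiv_inner_left, inner_planeE_right])
    ((hv.1 ()).differentiable (by simp)) (hi hv) (hi (hv.fderiv_apply _)) ((hi hv).smul _)
  refine key.trans ?_
  rw [planeInv, inv_inv, ← integral_smul]
  congr 1 with y
  rw [smul_comm]
  rfl

theorem symbolBound_planeDecay_smul (hu : IsPlaneRep u) {Ψ : H} (hΨ : IsSmoothVec u Ψ) :
    SymbolBound (fun y ↦ ‖planeDecay y‖) fun (_ : Unit) y ↦ planeDecay y • u y Ψ := by
  simpa using symbolBound_planeDecay.smul (hΨ.symbolBound hu)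

theorem planeDecay_ne_zero (x : Plane) : planeDecay x ≠ 0 := by
  simp only [planeDecay, planeInv]
  have := fun j : Fin 2 ↦ inv_ne_zero (one_add_I_mul_ne_zero (planeCoord j x))
  exact mul_ne_zero (this 0) (mul_ne_zero (this 0) (mul_ne_zero (this 1) (this 1)))

theorem integral_phase_vecSteps (hu : IsPlaneRep u) {Ψ : H} (hΨ : IsSmoothVec u Ψ) (x : Plane) :
    ∫ y, Complex.exp (-Complex.I * (inner ℝ x y : ℝ)) •
      vecStep 0 (vecStep 0 (vecStep 1 (vecStep 1 fun y ↦ planeDecay y • u y Ψ))) y =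
      (planeDecay x)⁻¹ • planeSmear u planeDecay x Ψ := by
  have h0 := symbolBound_planeDecay_smul hu hΨ
  have h1 := symbolBound_vecStep 1 h0
  have h2 := symbolBound_vecStep 1 h1
  have h3 := symbolBound_vecStep 0 h2
  have hi := integrable_norm_planeDecay
  rw [integral_phase_vecStep x 0 hi h3, integral_phase_vecStep x 0 hi h2,
    integral_phase_vecStep x 1 hi h1, integral_phase_vecStep x 1 hi h0, planeDecay, mul_inv,
    mul_inv, mul_inv, mul_smul, mul_smul, mul_smul]
  rfl

/-- The limit of the warped integrals as an absolutely convergent integral. -/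
theorem warpLimit_integrand (hu : IsPlaneRep u) (lam : ℝ) {A : H →L[ℂ] H} {Ψ : H}
    (hΨ : IsSmoothVec u Ψ) (x : Plane) :
    ∫ y, Complex.exp (-Complex.I * planePhase (x, y)) • planeDecay x •
      planeAd u (planeQ lam x) A
        (vecStep 0 (vecStep 0 (vecStep 1 (vecStep 1 fun y ↦ planeDecay y • u y Ψ))) y) =
      planeAd u (planeQ lam x) A (planeSmear u planeDecay x Ψ) := by
  have hv := symbolBound_vecStep 0 (symbolBound_vecStep 0 (symbolBound_vecStep 1
    (symbolBound_vecStep 1 (symbolBound_planeDecay_smul hu hΨ))))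
  obtain ⟨C, hC⟩ := hv.norm_le
  have hi : Integrable
      (vecStep 0 (vecStep 0 (vecStep 1 (vecStep 1 fun y ↦ planeDecay y • u y Ψ)))) :=
    (integrable_norm_planeDecay.const_mul C).mono' (hv.1 ()).continuous.aestronglyMeasurable
      (ae_of_all _ fun z ↦ hC () z)
  have hp := hi.phase_smul (φ := fun y : Plane ↦ (inner ℝ x y : ℝ)) (by fun_prop)
  have e := (planeDecay x • planeAd u (planeQ lam x) A).integral_comp_comm hp
  rw [integral_phase_vecSteps hu hΨ x] at e
  -- The decay in x gained from the steps in y is exactly cancelled by undoing them.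
  have e2 : (planeDecay x • planeAd u (planeQ lam x) A)
      ((planeDecay x)⁻¹ • planeSmear u planeDecay x Ψ) =
      planeAd u (planeQ lam x) A (planeSmear u planeDecay x Ψ) := by
    rw [smul_apply, ← ContinuousLinearMap.map_smul, smul_smul,
      mul_inv_cancel₀ (planeDecay_ne_zero x), one_smul]
  rw [← e2, ← e]
  congr 1 with y
  rw [ContinuousLinearMap.map_smul, smul_apply]
  rfl

/-- No decay in x is visible in this integrand. It is integrable because it is the partial integral
over y of an absolutely integrable function of (x, y), so Fubini applies. -/
theorem integrable_warp (hu : IsPlaneRep u) (lam : ℝ) {A : H →L[ℂ] H} {Ψ : H}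
    (hA : IsSmoothOp u A) (hΨ : IsSmoothVec u Ψ) :
    Integrable fun x ↦ planeAd u (planeQ lam x) (opSteps u lam A) (planeSmear u planeDecay x Ψ) := by
  have h := (foldr_oscStep_integrable planeDirs integrable_oscWeight_planeDirs
    (symbolBound_warpSymbol hu lam hA hΨ)).phase_smul contDiff_planePhase.continuous
  rw [foldr_planeDirs hu lam hA hΨ] at h
  refine h.integral_prod_left.congr (ae_of_all _ fun x ↦ ?_)
  exact warpLimit_integrand hu lam hΨ x

theorem warpLimit_eq (hu : IsPlaneRep u) (lam : ℝ) {A : H →L[ℂ] H} {Ψ : H}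
    (hA : IsSmoothOp u A) (hΨ : IsSmoothVec u Ψ) :
    warpLimit u lam A Ψ = (1 / (4 * (Real.pi : ℂ) ^ 2)) •
      ∫ x, planeAd u (planeQ lam x) (opSteps u lam A) (planeSmear u planeDecay x Ψ) := by
  have h := (foldr_oscStep_integrable planeDirs integrable_oscWeight_planeDirs
    (symbolBound_warpSymbol hu lam hA hΨ)).phase_smul contDiff_planePhase.continuous
  rw [warpLimit]
  rw [foldr_planeDirs hu lam hA hΨ] at h ⊢
  congr 1
  refine (integral_prod _ h).trans ?_
  congr 1 with x
  exact warpLimit_integrand hu lam hΨ x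

end WarpFormula

/-! ### Square integrability of smeared vectors -/

section SquareIntegrable

open MeasureTheory Filter FourierTransform

variable {H : Type*} [NormedAddCommGroup H] [InnerProductSpace ℂ H] [CompleteSpace H]
  {u : Plane → H →L[ℂ] H}

theorem IsPlaneRep.integrable_smul (hu : IsPlaneRep u) {k : Plane → ℂ} (hk : Integrable k) (Ψ : H) :
    Integrable fun y ↦ k y • u y Ψ := by
  refine (hk.norm.mul_const ‖Ψ‖).mono' (hk.aestronglyMeasurable.smul
    (hu.continuous Ψ).aestronglyMeasurable) (ae_of_all _ fun y ↦ ?_)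
  rw [norm_smul, hu.norm_apply]

theorem IsPlaneRep.integrable_phase_smul (hu : IsPlaneRep u) {k : Plane → ℂ} (hk : Integrable k)
    (x : Plane) (Ψ : H) :
    Integrable fun y ↦ Complex.exp (-Complex.I * (inner ℝ x y : ℝ)) • k y • u y Ψ :=
  (hu.integrable_smul hk Ψ).phase_smul (φ := fun y : Plane ↦ (inner ℝ x y : ℝ)) (by fun_prop)

theorem planeSmear_eq_fourier (k : Plane → ℂ) (x : Plane) (Ψ : H) :
    planeSmear u k x Ψ = 𝓕 (fun y ↦ k y • u y Ψ) ((2 * Real.pi)⁻¹ • x) := by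
  rw [Real.fourier_eq', planeSmear]
  congr 1 with y
  congr 2
  rw [real_inner_smul_right, real_inner_comm]
  push_cast
  field_simp

/-- Plancherel for the `H`-valued function y ↦ k(y) u(y)Ψ, whose pointwise norm is |k(y)| ‖Ψ‖ by
unitarity. The factor (2π)² comes from rescaling the plane to the normalization e^{-2πi x·y}. -/
theorem sq_planeSmear (hu : IsPlaneRep u) {k : Plane → ℂ} (hk : Integrable k) (hk2 : MemLp k 2)
    (Ψ : H) : Integrable (fun x ↦ ‖planeSmear u k x Ψ‖ ^ 2) ∧
      ∫ x, ‖planeSmear u k x Ψ‖ ^ 2 = ((2 * Real.pi) ^ 2 * ∫ y, ‖k y‖ ^ 2) * ‖Ψ‖ ^ 2 := by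
  have hi := hu.integrable_smul hk Ψ
  have h2 : MemLp (fun y ↦ k y • u y Ψ) 2 := by
    refine (hk2.norm.mul_const ‖Ψ‖).mono' hi.aestronglyMeasurable (ae_of_all _ fun y ↦ ?_)
    rw [norm_smul, hu.norm_apply]
  have hc : Continuous (𝓕 fun y ↦ k y • u y Ψ) :=
    VectorFourier.fourierIntegral_continuous Real.continuous_fourierChar continuous_inner hi
  have e := eLpNorm_fourier_eq hi h2
  have hF : MemLp (𝓕 fun y ↦ k y • u y Ψ) 2 := ⟨hc.aestronglyMeasurable, by rw [e]; exact h2.2⟩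
  have eF : ∫ x, ‖𝓕 (fun y ↦ k y • u y Ψ) x‖ ^ 2 = ∫ y, ‖k y • u y Ψ‖ ^ 2 := by
    have e1 := congrArg (fun t : ENNReal ↦ t.toReal ^ 2) e
    rw [hF.eLpNorm_eq_integral_rpow_norm (by norm_num) (by norm_num),
      h2.eLpNorm_eq_integral_rpow_norm (by norm_num) (by norm_num)] at e1
    have hp : ∀ a : ℝ, 0 ≤ a → (ENNReal.ofReal (a ^ ((2 : ENNReal).toReal)⁻¹)).toReal ^ 2 = a := by
      intro a ha
      rw [ENNReal.toReal_ofReal (by positivity), ENNReal.toReal_ofNat, ← Real.rpow_natCast,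
        ← Real.rpow_mul ha]
      norm_num
    rw [hp _ (by positivity), hp _ (by positivity)] at e1
    simpa using e1
  have hpi : (2 * Real.pi)⁻¹ ≠ 0 := by positivity
  have hFi : Integrable fun x ↦ ‖𝓕 (fun y ↦ k y • u y Ψ) x‖ ^ 2 :=
    (memLp_two_iff_integrable_sq_norm hF.1).1 hF
  simp_rw [planeSmear_eq_fourier]
  refine ⟨hFi.comp_smul hpi, ?_⟩
  rw [Measure.integral_comp_smul volume (fun x ↦ ‖𝓕 (fun y ↦ k y • u y Ψ) x‖ ^ 2), eF]
  simp_rw [norm_smul, hu.norm_apply, mul_pow]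
  rw [integral_mul_const, finrank_euclideanSpace, Fintype.card_fin, smul_eq_mul,
    abs_of_pos (by positivity), inv_pow, inv_inv, mul_assoc, mul_pow]

/-- The smearing operator as a bounded operator. -/
def planeSmearL (hu : IsPlaneRep u) {k : Plane → ℂ} (hk : Integrable k) (x : Plane) : H →L[ℂ] H :=
  LinearMap.mkContinuous
    { toFun := planeSmear u k x
      map_add' := fun Φ Ψ ↦ by
        simp only [planeSmear, map_add, smul_add]
        exact integral_add (hu.integrable_phase_smul hk x Φ) (hu.integrable_phase_smul hk x Ψ)
      map_smul' := fun c Ψ ↦ by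
        simp only [planeSmear, map_smul, RingHom.id_apply]
        rw [← integral_smul]
        congr 1 with y
        rw [smul_comm (k y) c, smul_comm _ c] }
    (∫ y, ‖k y‖) fun Ψ ↦ by
      refine (norm_integral_le_integral_norm _).trans ?_
      rw [← integral_mul_const]
      simp_rw [norm_smul, norm_exp_neg_I_mul, one_mul, hu.norm_apply]
      rfl

theorem planeSmearL_apply (hu : IsPlaneRep u) {k : Plane → ℂ} (hk : Integrable k) (x : Plane)
    (Ψ : H) : planeSmearL hu hk x Ψ = planeSmear u k x Ψ := rfl

/-- The plane is commutative, so smearing commutes with the representation. -/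
theorem apply_planeSmear (hu : IsPlaneRep u) {k : Plane → ℂ} (hk : Integrable k) (x s : Plane)
    (Ψ : H) : u s (planeSmear u k x Ψ) = planeSmear u k x (u s Ψ) := by
  rw [planeSmear, planeSmear, ← (u s).integral_comp_comm (hu.integrable_phase_smul hk x Ψ)]
  congr 1 with y
  rw [map_smul, map_smul, ← hu.apply_add, ← hu.apply_add, add_comm]

/-- Smooth functions that decay like `planeDecay` with all their derivatives. -/
def IsDecaying (k : Plane → ℂ) : Prop :=
  SymbolBound (fun y ↦ ‖planeDecay y‖) fun _ : Unit ↦ k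

/-- The partial derivative of a scalar function. -/
def partialDeriv (j : Fin 2) (k : Plane → ℂ) (y : Plane) : ℂ := fderiv ℝ k y (planeE j)

theorem IsDecaying.partialDeriv {k : Plane → ℂ} (hk : IsDecaying k) (j : Fin 2) :
    IsDecaying (partialDeriv j k) :=
  hk.fderiv_apply (planeE j)

theorem IsDecaying.integrable {k : Plane → ℂ} (hk : IsDecaying k) : Integrable k := by
  obtain ⟨C, hC⟩ := hk.norm_le
  exact (integrable_norm_planeDecay.const_mul C).mono' (hk.1 ()).continuous.aestronglyMeasurable
    (ae_of_all _ fun z ↦ hC () z)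

theorem norm_planeDecay_le_one (y : Plane) : ‖planeDecay y‖ ≤ 1 := by
  rw [norm_planeDecay]
  have h : ∀ t : ℝ, (1 + t ^ 2)⁻¹ ≤ 1 := fun t ↦ inv_le_one_of_one_le₀ (by nlinarith [sq_nonneg t])
  exact mul_le_one₀ (h _) (by positivity) (h _)

theorem IsDecaying.memLp_two {k : Plane → ℂ} (hk : IsDecaying k) : MemLp k 2 := by
  obtain ⟨C, hC⟩ := hk.norm_le
  have hm := (hk.1 ()).continuous.aestronglyMeasurable (μ := volume)
  refine (memLp_two_iff_integrable_sq_norm hm).2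
    ((integrable_norm_planeDecay.const_mul (C ^ 2)).mono' (hm.norm.pow 2) (ae_of_all _ fun y ↦ ?_))
  rw [Real.norm_of_nonneg (by positivity)]
  calc ‖k y‖ ^ 2 ≤ (C * ‖planeDecay y‖) ^ 2 := pow_le_pow_left₀ (norm_nonneg _) (hC () y) 2
    _ = C ^ 2 * (‖planeDecay y‖ * ‖planeDecay y‖) := by ring
    _ ≤ C ^ 2 * (‖planeDecay y‖ * 1) := by gcongr; exact norm_planeDecay_le_one y
    _ = _ := by ring

/-- Integrate the derivative of k(y) u(y)Ψ against e^{-ix·y}. The growing factor i x_j minus the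
generator acting on Ψ thereby becomes a derivative of k. -/
theorem planeSmear_partialDeriv (hu : IsPlaneRep u) {k : Plane → ℂ} (hk : IsDecaying k)
    {Ψ : H} (hΨ : IsSmoothVec u Ψ) (x : Plane) (j : Fin 2) :
    planeSmear u (partialDeriv j k) x Ψ =
      (Complex.I * x j : ℂ) • planeSmear u k x Ψ - planeSmear u k x (vecDeriv u (planeE j) Ψ) := by
  have hb : SymbolBound (fun y ↦ ‖planeDecay y‖) fun (_ : Unit) y ↦ k y • u y Ψ := by
    simpa using SymbolBound.smul hk (hΨ.symbolBound hu)
  have key := integral_phase_vecStep x j integrable_norm_planeDecay hb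
  have hd : ∀ y, vecStep j (fun y ↦ k y • u y Ψ) y = k y • u y Ψ +
      (partialDeriv j k y • u y Ψ + k y • u y (vecDeriv u (planeE j) Ψ)) := by
    intro y
    have h1 : HasFDerivAt k (fderiv ℝ k y) y :=
      ((hk.1 ()).differentiable (by simp) y).hasFDerivAt
    have h2 : HasFDerivAt (fun y ↦ u y Ψ) (fderiv ℝ (fun y ↦ u y Ψ) y) y :=
      (ContDiff.differentiable hΨ (by simp) y).hasFDerivAt
    rw [vecStep, (h1.fun_smul h2).fderiv]
    simp [partialDeriv, hΨ.fderiv_eq hu, add_comm]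
  simp_rw [hd, smul_add] at key
  have i1 := hu.integrable_phase_smul hk.integrable x Ψ
  have i2 := hu.integrable_phase_smul (hk.partialDeriv j).integrable x Ψ
  have i3 := hu.integrable_phase_smul hk.integrable x (vecDeriv u (planeE j) Ψ)
  have i23 : Integrable fun y ↦ Complex.exp (-Complex.I * (inner ℝ x y : ℝ)) •
      partialDeriv j k y • u y Ψ + Complex.exp (-Complex.I * (inner ℝ x y : ℝ)) • k y •
        u y (vecDeriv u (planeE j) Ψ) := i2.add i3
  rw [integral_add i1 i23, integral_add i2 i3, planeInv, inv_inv, add_smul, one_smul] at key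
  have key2 := add_left_cancel key
  exact eq_sub_of_add_eq key2

end SquareIntegrable

/-! ### Boundedness of the warped convolution -/

section Bounded

open MeasureTheory Filter

variable {H : Type*} [NormedAddCommGroup H] [InnerProductSpace ℂ H] [CompleteSpace H]
  {u : Plane → H →L[ℂ] H}

/-- The resolvent-type operator `∫_0^∞ e^{-r} e^{icr} u(-r e) dr`. -/
def damp (u : Plane → H →L[ℂ] H) (e : Plane) (c : ℝ) (Φ : H) : H :=
  ∫ r in Set.Ioi (0 : ℝ), Complex.exp ((-1 + Complex.I * c) * r) • u (-(r • e)) Φ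

theorem norm_cexp_damp (c r : ℝ) : ‖Complex.exp ((-1 + Complex.I * c) * r)‖ = Real.exp (-r) := by
  rw [Complex.norm_exp]
  simp

theorem IsPlaneRep.integrableOn_damp (hu : IsPlaneRep u) (e : Plane) (c : ℝ) (Φ : H) :
    IntegrableOn (fun r : ℝ ↦ Complex.exp ((-1 + Complex.I * c) * r) • u (r • e) Φ)
      (Set.Ioi (0 : ℝ)) := by
  refine ((integrableOn_exp_neg_Ioi 0).mul_const ‖Φ‖).mono' ?_ (ae_of_all _ fun r ↦ ?_)
  · refine Continuous.aestronglyMeasurable (Continuous.smul (by fun_prop) ?_)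
    exact hu.continuous₂ (by fun_prop) continuous_const
  · rw [norm_smul, norm_cexp_damp, hu.norm_apply]

/-- This is the resolvent identity: r ↦ -e^{-(1+ic)r} u(re)X is a primitive of the integrand, equals
-X at r = 0 and tends to 0 at infinity. Here X' plays the role of the generator applied to X. -/
theorem eq_integral_damp (hu : IsPlaneRep u) (e : Plane) (c : ℝ) {X X' : H}
    (hX : ∀ r : ℝ, HasDerivAt (fun r : ℝ ↦ u (r • e) X) (u (r • e) X') r) :
    X = ∫ r in Set.Ioi (0 : ℝ), Complex.exp ((-1 + Complex.I * (-c : ℝ)) * r) •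
      u (r • e) (X + (Complex.I * c : ℂ) • X - X') := by
  set d : ℂ := -1 + Complex.I * (-c : ℝ) with hd
  have hder : ∀ r : ℝ, HasDerivAt (fun r : ℝ ↦ -(Complex.exp (d * r) • u (r • e) X))
      (Complex.exp (d * r) • u (r • e) (X + (Complex.I * c : ℂ) • X - X')) r := by
    intro r
    have h1 : HasDerivAt (fun r : ℝ ↦ Complex.exp (d * r)) (Complex.exp (d * r) * d) r := by
      simpa using ((Complex.ofRealCLM.hasDerivAt (x := r)).const_mul d).cexp
    refine (h1.smul (hX r)).neg.congr_deriv ?_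
    simp only [map_add, map_sub, map_smul, smul_add, smul_sub, hd, smul_smul]
    push_cast
    module
  have key := integral_Ioi_of_hasDerivAt_of_tendsto (a := (0 : ℝ)) (m := (0 : H))
    (hder 0).continuousAt.continuousWithinAt (fun r _ ↦ hder r)
    (hu.integrableOn_damp e (-c) _) ?_
  · rw [key]
    simp [hu.map_zero]
  · rw [tendsto_zero_iff_norm_tendsto_zero]
    have : (fun r : ℝ ↦ ‖-(Complex.exp (d * r) • u (r • e) X)‖) = fun r ↦ Real.exp (-r) * ‖X‖ := by
      ext r
      rw [norm_neg, norm_smul, hd, norm_cexp_damp, hu.norm_apply]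
    rw [this]
    simpa using (Real.tendsto_exp_neg_atTop_nhds_zero.mul_const ‖X‖)

theorem inner_damp (hu : IsPlaneRep u) (e : Plane) (c : ℝ) (Φ Y : H) :
    inner ℂ Φ (∫ r in Set.Ioi (0 : ℝ), Complex.exp ((-1 + Complex.I * (-c : ℝ)) * r) •
      u (r • e) Y) = inner ℂ (damp u e c Φ) Y := by
  have h1 : IntegrableOn (fun r : ℝ ↦ Complex.exp ((-1 + Complex.I * c) * r) • u (-(r • e)) Φ)
      (Set.Ioi (0 : ℝ)) := by
    simpa using hu.integrableOn_damp (-e) c Φ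
  rw [← integral_inner (hu.integrableOn_damp e (-c) Y), ← inner_conj_symm, damp, ← integral_inner h1,
    ← integral_conj]
  congr 1 with r
  rw [inner_conj_symm, inner_smul_left, inner_smul_right, hu.inner_left, neg_neg,
    ← Complex.exp_conj]
  congr 2
  simp

/-- A function of the plane that is supported in a quadrant. -/
def quadrantExp (y : Plane) : ℂ :=
  ((Set.indicator (Set.Ioi 0) (fun t ↦ Real.exp (-t)) (y 0) *
    Set.indicator (Set.Ioi 0) (fun t ↦ Real.exp (-t)) (y 1) : ℝ) : ℂ)

theorem integrable_indicator_exp_neg :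
    Integrable (Set.indicator (Set.Ioi (0 : ℝ)) fun t ↦ Real.exp (-t)) :=
  (integrable_indicator_iff measurableSet_Ioi).2 (integrableOn_exp_neg_Ioi 0)

theorem integrable_quadrantExp : Integrable quadrantExp :=
  (integrable_plane_mul integrable_indicator_exp_neg integrable_indicator_exp_neg).ofReal

theorem memLp_quadrantExp : MemLp quadrantExp 2 := by
  have hi : ∀ t : ℝ, |Set.indicator (Set.Ioi (0 : ℝ)) (fun t ↦ Real.exp (-t)) t| ≤ 1 := by
    intro t
    by_cases ht : 0 < t
    · rw [Set.indicator_of_mem (Set.mem_Ioi.2 ht), abs_of_pos (Real.exp_pos _)]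
      exact Real.exp_le_one_iff.2 (by linarith)
    · rw [Set.indicator_of_notMem (by simpa using ht)]; simp
  have hle : ∀ y, ‖quadrantExp y‖ ≤ 1 := by
    intro y
    rw [quadrantExp, Complex.norm_real, norm_mul]
    exact mul_le_one₀ (hi _) (norm_nonneg _) (hi _)
  have hm := integrable_quadrantExp.aestronglyMeasurable
  refine (memLp_two_iff_integrable_sq_norm hm).2
    (integrable_quadrantExp.norm.mono' (hm.norm.pow 2) (ae_of_all _ fun y ↦ ?_))
  rw [Real.norm_of_nonneg (by positivity), sq]
  exact mul_le_of_le_one_left (norm_nonneg _) (hle y)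

theorem integral_plane {G : Type*} [NormedAddCommGroup G] [NormedSpace ℝ G] (f : Plane → G)
    (hf : Integrable f) :
    ∫ y, f y = ∫ t : ℝ, ∫ s : ℝ, f (s • planeE 0 + t • planeE 1) := by
  have h1 := (EuclideanSpace.volume_preserving_symm_measurableEquiv_toLp (Fin 2)).symm
  have h2 := (volume_preserving_finTwoArrow ℝ).symm
  have h3 := h1.comp h2
  have hemb : MeasurableEmbedding ((MeasurableEquiv.toLp 2 (Fin 2 → ℝ)).symm.symm ∘
      (MeasurableEquiv.finTwoArrow (α := ℝ)).symm) :=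
    (MeasurableEquiv.measurableEmbedding _).comp (MeasurableEquiv.measurableEmbedding _)
  have hpt : ∀ p : ℝ × ℝ, ((MeasurableEquiv.toLp 2 (Fin 2 → ℝ)).symm.symm ∘
      (MeasurableEquiv.finTwoArrow (α := ℝ)).symm) p = p.1 • planeE 0 + p.2 • planeE 1 := by
    intro p
    ext i
    fin_cases i
    · change p.1 = _
      simp [planeE]
    · change p.2 = _
      simp [planeE]
  have e1 := h3.integral_comp hemb f
  have i1 := (h3.integrable_comp_emb hemb (g := f)).2 hf
  rw [← e1]
  simp_rw [hpt]
  have i2 : Integrable (fun p : ℝ × ℝ ↦ f (p.1 • planeE 0 + p.2 • planeE 1)) := by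
    refine i1.congr (ae_of_all _ fun p ↦ ?_)
    exact congrArg f (hpt p)
  exact integral_prod_symm _ i2

theorem IsPlaneRep.comp_neg (hu : IsPlaneRep u) : IsPlaneRep fun s ↦ u (-s) where
  map_zero := by simp [hu.map_zero]
  map_add s t := by rw [← hu.map_add, neg_add]
  star_eq s := hu.star_eq _
  continuous Ψ := (hu.continuous Ψ).comp continuous_neg

/-- Two half-line integrals in the coordinate directions combine into one integral over the
quadrant, which is a smearing with the reflected representation. Plancherel then gives square
integrability in both coordinates of x together. The argument is -x because the phases of `damp`
carry the opposite sign. -/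
theorem damp_damp (hu : IsPlaneRep u) (x : Plane) (Φ : H) :
    damp u (planeE 1) (x 1) (damp u (planeE 0) (x 0) Φ) =
      planeSmear (fun s ↦ u (-s)) quadrantExp (-x) Φ := by
  have hi := hu.comp_neg.integrable_phase_smul integrable_quadrantExp (-x) Φ
  rw [planeSmear, integral_plane _ hi, damp, ← integral_indicator measurableSet_Ioi]
  congr 1 with t
  by_cases ht : 0 < t
  · have ht' : t ∈ Set.Ioi (0 : ℝ) := ht
    have h1 : IntegrableOn (fun r : ℝ ↦ Complex.exp ((-1 + Complex.I * x 0) * r) •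
        u (-(r • planeE 0)) Φ) (Set.Ioi (0 : ℝ)) := by
      simpa using hu.integrableOn_damp (-planeE 0) (x 0) Φ
    rw [Set.indicator_of_mem ht', damp, ← (u (-(t • planeE 1))).integral_comp_comm h1,
      ← integral_smul, ← integral_indicator measurableSet_Ioi]
    congr 1 with s
    by_cases hs : 0 < s
    · have hs' : s ∈ Set.Ioi (0 : ℝ) := hs
      have e0 : (s • planeE 0 + t • planeE 1 : Plane) 0 = s := by simp [planeE]
      have e1 : (s • planeE 0 + t • planeE 1 : Plane) 1 = t := by simp [planeE]
      rw [Set.indicator_of_mem hs', quadrantExp, e0, e1, Set.indicator_of_mem hs',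
        Set.indicator_of_mem ht', map_smul, ← hu.apply_add, smul_smul, smul_smul, neg_add_rev]
      congr 1
      rw [inner_neg_left, inner_add_right, real_inner_smul_right, real_inner_smul_right,
        inner_planeE_right, inner_planeE_right]
      push_cast
      simp only [← Complex.exp_add]
      congr 1
      ring
    · have hs' : s ∉ Set.Ioi (0 : ℝ) := hs
      have e0 : (s • planeE 0 + t • planeE 1 : Plane) 0 = s := by simp [planeE]
      rw [Set.indicator_of_notMem hs', quadrantExp, e0, Set.indicator_of_notMem hs']
      simp
  · have ht' : t ∉ Set.Ioi (0 : ℝ) := ht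
    rw [Set.indicator_of_notMem ht']
    symm
    have : ∀ s : ℝ, quadrantExp (s • planeE 0 + t • planeE 1) = 0 := by
      intro s
      have e1 : (s • planeE 0 + t • planeE 1 : Plane) 1 = t := by simp [planeE]
      rw [quadrantExp, e1, Set.indicator_of_notMem ht']
      simp
    simp [this]

/-- A resolvent in direction e_j is inserted and moved onto Φ. By Leibniz, its inverse produces i
x_j and the generator on Ψ. Together these form the smearing with ∂_j k, so the right-hand side
contains Ψ only through smearings and no derivative of it. -/
theorem planeAd_planeSmear_eq (hu : IsPlaneRep u) {A : H →L[ℂ] H} (hA : IsSmoothOp u A)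
    {k : Plane → ℂ} (hk : IsDecaying k) {Ψ : H} (hΨ : IsSmoothVec u Ψ) (s x : Plane) (j : Fin 2)
    (Φ : H) :
    inner ℂ Φ (planeAd u s A (planeSmear u k x Ψ)) =
      inner ℂ (damp u (planeE j) (x j) Φ)
        (planeAd u s (A - opDeriv u (planeE j) A) (planeSmear u k x Ψ) +
          planeAd u s A (planeSmear u (partialDeriv j k) x Ψ)) := by
  set X := planeAd u s A (planeSmear u k x Ψ) with hXdef
  set X' := planeAd u s (opDeriv u (planeE j) A) (planeSmear u k x Ψ) +
    planeAd u s A (planeSmear u k x (vecDeriv u (planeE j) Ψ)) with hX'def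
  have hline : ∀ r : ℝ, HasDerivAt (fun r : ℝ ↦ r • planeE j) (planeE j) r := fun r ↦ by
    simpa using (hasDerivAt_id r).smul_const (planeE j)
  have hX : ∀ r : ℝ, HasDerivAt (fun r : ℝ ↦ u (r • planeE j) X) (u (r • planeE j) X') r := by
    intro r
    -- Since u(re_j) commutes with smearing, it can be distributed over the operator and the vector;
    -- the product rule then applies to norm-differentiable factors.
    have e : (fun r : ℝ ↦ u (r • planeE j) X) = fun r : ℝ ↦
        planeAd u (r • planeE j + s) A (planeSmearL hu hk.integrable x (u (r • planeE j) Ψ)) := by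
      ext1 r
      rw [planeSmearL_apply, ← apply_planeSmear hu hk.integrable, hu.planeAd_add,
        hu.planeAd_apply_apply]
    have h1 : HasDerivAt (fun r : ℝ ↦ u (r • planeE j) Ψ)
        (u (r • planeE j) (vecDeriv u (planeE j) Ψ)) r := by
      have := (ContDiff.differentiable hΨ (by simp) (r • planeE j)).hasFDerivAt.comp_hasDerivAt r
        (hline r)
      rwa [hΨ.fderiv_eq hu] at this
    have h2 : HasDerivAt (fun r : ℝ ↦ planeAd u (r • planeE j + s) A)
        (planeAd u (r • planeE j + s) (opDeriv u (planeE j) A)) r := by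
      have := (ContDiff.differentiable hA (by simp) (r • planeE j + s)).hasFDerivAt.comp_hasDerivAt r
        ((hline r).add_const s)
      rwa [hA.fderiv_eq hu] at this
    have h3 : HasDerivAt (fun r : ℝ ↦ planeSmearL hu hk.integrable x (u (r • planeE j) Ψ))
        (planeSmearL hu hk.integrable x (u (r • planeE j) (vecDeriv u (planeE j) Ψ))) r :=
      ((planeSmearL hu hk.integrable x).restrictScalars ℝ).hasFDerivAt.comp_hasDerivAt r h1
    have h4 : HasDerivAt (fun r : ℝ ↦ (ContinuousLinearMap.restrictScalarsL ℂ H H ℝ ℝ)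
        (planeAd u (r • planeE j + s) A)) ((ContinuousLinearMap.restrictScalarsL ℂ H H ℝ ℝ)
        (planeAd u (r • planeE j + s) (opDeriv u (planeE j) A))) r :=
      (ContinuousLinearMap.restrictScalarsL ℂ H H ℝ ℝ).hasFDerivAt.comp_hasDerivAt r h2
    rw [e]
    refine (h4.clm_apply h3).congr_deriv ?_
    change planeAd u (r • planeE j + s) (opDeriv u (planeE j) A)
        (planeSmearL hu hk.integrable x (u (r • planeE j) Ψ)) +
      planeAd u (r • planeE j + s) A
        (planeSmearL hu hk.integrable x (u (r • planeE j) (vecDeriv u (planeE j) Ψ))) = _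
    rw [planeSmearL_apply, planeSmearL_apply, ← apply_planeSmear hu hk.integrable,
      ← apply_planeSmear hu hk.integrable, hu.planeAd_add, hu.planeAd_add,
      hu.planeAd_apply_apply, hu.planeAd_apply_apply, hX'def, map_add]
  have key := eq_integral_damp hu (planeE j) (x j) hX
  -- The term with the generator on Ψ cancels against the one hidden in i x_j X.
  have e2 : X + (Complex.I * x j : ℂ) • X - X' =
      planeAd u s (A - opDeriv u (planeE j) A) (planeSmear u k x Ψ) +
          planeAd u s A (planeSmear u (partialDeriv j k) x Ψ) := by
    rw [planeSmear_partialDeriv hu hk hΨ, map_sub, map_smul, ← hXdef, hX'def]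
    have : planeAd u s (A - opDeriv u (planeE j) A) =
        planeAd u s A - planeAd u s (opDeriv u (planeE j) A) := by
      simp [planeAd, mul_sub, sub_mul]
    rw [this, sub_apply, ← hXdef]
    abel
  rw [e2] at key
  conv_lhs => rw [key]
  exact inner_damp hu _ _ _ _

end Bounded

/-! ### Boundedness, existence and uniqueness of the warped convolution -/

section WarpOp

open MeasureTheory Filter

variable {H : Type*} [NormedAddCommGroup H] [InnerProductSpace ℂ H] [CompleteSpace H]
  {u : Plane → H →L[ℂ] H}

theorem sq_damp_damp (hu : IsPlaneRep u) : ∃ P : ℝ, 0 ≤ P ∧ ∀ Φ : H,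
    Integrable (fun x : Plane ↦ ‖damp u (planeE 1) (x 1) (damp u (planeE 0) (x 0) Φ)‖ ^ 2) ∧
    ∫ x : Plane, ‖damp u (planeE 1) (x 1) (damp u (planeE 0) (x 0) Φ)‖ ^ 2 = P * ‖Φ‖ ^ 2 := by
  refine ⟨(2 * Real.pi) ^ 2 * ∫ y, ‖quadrantExp y‖ ^ 2, by positivity, fun Φ ↦ ?_⟩
  simp_rw [damp_damp hu]
  obtain ⟨h1, h2⟩ := sq_planeSmear hu.comp_neg integrable_quadrantExp memLp_quadrantExp Φ
  refine ⟨h1.comp_neg, ?_⟩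
  rw [← h2]
  exact integral_neg_eq_self (fun x ↦ ‖planeSmear (fun s ↦ u (-s)) quadrantExp x Φ‖ ^ 2) volume

/-- Cauchy–Schwarz and ‖p‖‖q‖ ≤ ‖p‖² + ‖q‖²; the constant 4 is the number of summands in (a+b+c+d)²
≤ 4(a²+b²+c²+d²). -/
theorem norm_inner_le_of_sum {p q : H} {a b c d : ℝ}
    (hq : ‖q‖ ≤ a + b + (c + d)) :
    ‖inner ℂ p q‖ ≤ ‖p‖ ^ 2 + (4 * a ^ 2 + 4 * b ^ 2 + (4 * c ^ 2 + 4 * d ^ 2)) := by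
  have h1 := norm_inner_le_norm (𝕜 := ℂ) p q
  have h2 : ‖q‖ ^ 2 ≤ (a + b + (c + d)) ^ 2 := pow_le_pow_left₀ (norm_nonneg _) hq 2
  nlinarith [sq_nonneg (‖p‖ - ‖q‖), sq_nonneg (‖p‖), sq_nonneg ‖q‖, sq_nonneg (a - b),
    sq_nonneg (a - c), sq_nonneg (a - d), sq_nonneg (b - c), sq_nonneg (b - d), sq_nonneg (c - d)]

theorem isDecaying_planeDecay : IsDecaying planeDecay := symbolBound_planeDecay

/-- The sesquilinear form of the warped convolution is bounded by a sum of squares. -/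
theorem norm_inner_warp_le (hu : IsPlaneRep u) (lam : ℝ) {A : H →L[ℂ] H} (hA : IsSmoothOp u A) :
    ∃ P : ℝ, 0 ≤ P ∧ ∃ C : ℝ, ∀ Φ Ψ : H, IsSmoothVec u Ψ →
      ‖inner ℂ Φ (∫ x, planeAd u (planeQ lam x) (opSteps u lam A) (planeSmear u planeDecay x Ψ))‖ ≤
        P * ‖Φ‖ ^ 2 + C * ‖Ψ‖ ^ 2 := by
  obtain ⟨P, hP0, hP⟩ := sq_damp_damp hu
  set A₀ := opSteps u lam A with hA₀
  have sA₀ : IsSmoothOp u A₀ := hA.opSteps hu lam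
  set A₁ := A₀ - opDeriv u (planeE 0) A₀ with hA₁
  have sA₁ : IsSmoothOp u A₁ := sA₀.sub (sA₀.opDeriv hu _)
  set B₁ := A₁ - opDeriv u (planeE 1) A₁ with hB₁
  set B₂ := A₀ - opDeriv u (planeE 1) A₀ with hB₂
  have k0 := isDecaying_planeDecay
  set k := planeDecay
  set k₁ := partialDeriv 1 k
  set k₂ := partialDeriv 0 k
  set k₃ := partialDeriv 1 k₂
  have dk₁ : IsDecaying k₁ := k0.partialDeriv 1
  have dk₂ : IsDecaying k₂ := k0.partialDeriv 0
  have dk₃ : IsDecaying k₃ := dk₂.partialDeriv 1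
  have hS : ∀ {k : Plane → ℂ}, IsDecaying k → ∀ (b : ℝ) (Ψ : H),
      Integrable (fun x ↦ 4 * (b * ‖planeSmear u k x Ψ‖) ^ 2) ∧
      ∫ x, 4 * (b * ‖planeSmear u k x Ψ‖) ^ 2 =
        (4 * b ^ 2 * ((2 * Real.pi) ^ 2 * ∫ y, ‖k y‖ ^ 2)) * ‖Ψ‖ ^ 2 := by
    intro k hk b Ψ
    obtain ⟨h1, h2⟩ := sq_planeSmear hu hk.integrable hk.memLp_two Ψ
    have e : (fun x ↦ 4 * (b * ‖planeSmear u k x Ψ‖) ^ 2) =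
        fun x ↦ (4 * b ^ 2) * ‖planeSmear u k x Ψ‖ ^ 2 := by ext x; ring
    rw [e]
    refine ⟨h1.const_mul _, ?_⟩
    rw [integral_const_mul, h2]
    ring
  refine ⟨P, hP0, (4 * ‖B₁‖ ^ 2 * ((2 * Real.pi) ^ 2 * ∫ y, ‖k y‖ ^ 2)) +
    (4 * ‖A₁‖ ^ 2 * ((2 * Real.pi) ^ 2 * ∫ y, ‖k₁ y‖ ^ 2)) +
    ((4 * ‖B₂‖ ^ 2 * ((2 * Real.pi) ^ 2 * ∫ y, ‖k₂ y‖ ^ 2)) +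
    (4 * ‖A₀‖ ^ 2 * ((2 * Real.pi) ^ 2 * ∫ y, ‖k₃ y‖ ^ 2))), fun Φ Ψ hΨ ↦ ?_⟩
  obtain ⟨p1, p2⟩ := hP Φ
  obtain ⟨s1, t1⟩ := hS k0 ‖B₁‖ Ψ
  obtain ⟨s2, t2⟩ := hS dk₁ ‖A₁‖ Ψ
  obtain ⟨s3, t3⟩ := hS dk₂ ‖B₂‖ Ψ
  obtain ⟨s4, t4⟩ := hS dk₃ ‖A₀‖ Ψ
  rw [← integral_inner (integrable_warp hu lam hA hΨ)]
  have s12 : Integrable fun x ↦ 4 * (‖B₁‖ * ‖planeSmear u k x Ψ‖) ^ 2 +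
    4 * (‖A₁‖ * ‖planeSmear u k₁ x Ψ‖) ^ 2 := s1.add s2
  have s34 : Integrable fun x ↦ 4 * (‖B₂‖ * ‖planeSmear u k₂ x Ψ‖) ^ 2 +
    4 * (‖A₀‖ * ‖planeSmear u k₃ x Ψ‖) ^ 2 := s3.add s4
  have s1234 : Integrable fun x ↦ (4 * (‖B₁‖ * ‖planeSmear u k x Ψ‖) ^ 2 +
    4 * (‖A₁‖ * ‖planeSmear u k₁ x Ψ‖) ^ 2) + (4 * (‖B₂‖ * ‖planeSmear u k₂ x Ψ‖) ^ 2 +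
    4 * (‖A₀‖ * ‖planeSmear u k₃ x Ψ‖) ^ 2) := s12.add s34
  refine (norm_integral_le_of_norm_le (p1.add s1234) (ae_of_all _ fun x ↦ ?_)).trans ?_
  -- The resolvent identity is used in direction 0 and then, for each of the two resulting terms, in
  -- direction 1. This gives four terms with bounded operators and decaying kernels.
  · have e : inner ℂ Φ (planeAd u (planeQ lam x) A₀ (planeSmear u k x Ψ)) =
        inner ℂ (damp u (planeE 1) (x 1) (damp u (planeE 0) (x 0) Φ))
          ((planeAd u (planeQ lam x) B₁ (planeSmear u k x Ψ) +
            planeAd u (planeQ lam x) A₁ (planeSmear u k₁ x Ψ)) +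
          (planeAd u (planeQ lam x) B₂ (planeSmear u k₂ x Ψ) +
            planeAd u (planeQ lam x) A₀ (planeSmear u k₃ x Ψ))) := by
      rw [planeAd_planeSmear_eq hu sA₀ k0 hΨ (planeQ lam x) x 0 Φ, inner_add_right,
        planeAd_planeSmear_eq hu sA₁ k0 hΨ (planeQ lam x) x 1,
        planeAd_planeSmear_eq hu sA₀ dk₂ hΨ (planeQ lam x) x 1, ← inner_add_right]
    rw [e]
    have hn : ∀ (B : H →L[ℂ] H) (v : H), ‖planeAd u (planeQ lam x) B v‖ ≤ ‖B‖ * ‖v‖ := fun B v ↦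
      (ContinuousLinearMap.le_opNorm _ _).trans
        (mul_le_mul_of_nonneg_right (hu.norm_planeAd_le _ _) (norm_nonneg _))
    exact norm_inner_le_of_sum ((norm_add_le _ _).trans (add_le_add
        ((norm_add_le _ _).trans (add_le_add (hn _ _) (hn _ _)))
        ((norm_add_le _ _).trans (add_le_add (hn _ _) (hn _ _)))))
  · refine (integral_add p1 s1234).le.trans ?_
    rw [integral_add s12 s34, integral_add s1 s2, integral_add s3 s4, p2, t1, t2, t3, t4]
    apply le_of_eq
    ring

/-- The form estimate is tested with Φ a small multiple of the vector R to be bounded: the left side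
is linear in that multiple and the term in ‖Φ‖² quadratic, so the latter can be absorbed. -/
theorem warpLimit_bound (hu : IsPlaneRep u) (lam : ℝ) {A : H →L[ℂ] H} (hA : IsSmoothOp u A) :
    ∃ C : ℝ, ∀ Ψ : H, IsSmoothVec u Ψ → ‖warpLimit u lam A Ψ‖ ≤ C * ‖Ψ‖ := by
  obtain ⟨P, hP, C, hC⟩ := norm_inner_warp_le hu lam hA
  have key : ∀ Ψ : H, IsSmoothVec u Ψ →
      ‖∫ x, planeAd u (planeQ lam x) (opSteps u lam A) (planeSmear u planeDecay x Ψ)‖ ≤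
        √(4 * (P + 1) * C) * ‖Ψ‖ := by
    intro Ψ hΨ
    set R := ∫ x, planeAd u (planeQ lam x) (opSteps u lam A) (planeSmear u planeDecay x Ψ)
    -- With t = 1/(2(P+1)) one has P t² ≤ t/2, so half of t‖R‖² remains on the left. Using P+1 keeps
    -- t finite when P = 0.
    have h := hC (((1 / (2 * (P + 1)) : ℝ) : ℂ) • R) Ψ hΨ
    have hp : (0 : ℝ) < P + 1 := by linarith
    rw [inner_smul_left, norm_mul, inner_self_eq_norm_sq_to_K, norm_smul, Complex.norm_real,
      RCLike.norm_conj, Complex.norm_real, Real.norm_of_nonneg (by positivity)] at h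
    have e : ‖((‖R‖ : ℂ)) ^ 2‖ = ‖R‖ ^ 2 := by simp
    have h' : 1 / (2 * (P + 1)) * ‖R‖ ^ 2 ≤
        P * (1 / (2 * (P + 1)) * ‖R‖) ^ 2 + C * ‖Ψ‖ ^ 2 := by
      rw [← e]; exact h
    have h2 : P * (1 / (2 * (P + 1)) * ‖R‖) ^ 2 ≤ 1 / (4 * (P + 1)) * ‖R‖ ^ 2 := by
      have : P * (1 / (2 * (P + 1)) * ‖R‖) ^ 2 =
        (P / (P + 1)) * (1 / (4 * (P + 1)) * ‖R‖ ^ 2) := by field_simp; ring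
      rw [this]
      exact mul_le_of_le_one_left (by positivity) ((div_le_one hp).2 (by linarith))
    have h3 : 1 / (2 * (P + 1)) * ‖R‖ ^ 2 = 2 * (1 / (4 * (P + 1)) * ‖R‖ ^ 2) := by
      field_simp; ring
    have h4 : 1 / (4 * (P + 1)) * ‖R‖ ^ 2 ≤ C * ‖Ψ‖ ^ 2 := by linarith
    have h5 : ‖R‖ ^ 2 ≤ 4 * (P + 1) * C * ‖Ψ‖ ^ 2 := by
      have := mul_le_mul_of_nonneg_left h4 (by positivity : 0 ≤ 4 * (P + 1))
      calc ‖R‖ ^ 2 = 4 * (P + 1) * (1 / (4 * (P + 1)) * ‖R‖ ^ 2) := by field_simp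
        _ ≤ _ := this
        _ = _ := by ring
    calc ‖R‖ = √(‖R‖ ^ 2) := (Real.sqrt_sq (norm_nonneg _)).symm
      _ ≤ √(4 * (P + 1) * C * ‖Ψ‖ ^ 2) := Real.sqrt_le_sqrt h5
      _ = √(4 * (P + 1) * C) * ‖Ψ‖ := by
        rw [Real.sqrt_mul' _ (sq_nonneg _), Real.sqrt_sq (norm_nonneg _)]
  refine ⟨‖(1 / (4 * (Real.pi : ℂ) ^ 2))‖ * √(4 * (P + 1) * C), fun Ψ hΨ ↦ ?_⟩
  rw [warpLimit_eq hu lam hA hΨ, norm_smul, mul_assoc]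
  exact mul_le_mul_of_nonneg_left (key Ψ hΨ) (norm_nonneg _)

/-- The warped convolution exists as a bounded operator. -/
theorem exists_warpLimit (hu : IsPlaneRep u) (lam : ℝ) {A : H →L[ℂ] H} (hA : IsSmoothOp u A) :
    ∃ R : H →L[ℂ] H, ∀ Ψ, IsSmoothVec u Ψ → R Ψ = warpLimit u lam A Ψ := by
  obtain ⟨C, hC⟩ := warpLimit_bound hu lam hA
  have hsm : ∀ (x : Plane) (Ψ : H), planeSmear u planeDecay x Ψ =
    planeSmearL hu isDecaying_planeDecay.integrable x Ψ := fun _ _ ↦ rfl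
  -- Linearity in Ψ is read off the absolutely convergent formula; boundedness and density then
  -- allow extension to `H`.
  let f : smoothVectors u →ₗ[ℂ] H :=
    { toFun := fun Ψ ↦ warpLimit u lam A Ψ
      map_add' := fun Φ Ψ ↦ by
        rw [warpLimit_eq hu lam hA (Φ + Ψ).2, warpLimit_eq hu lam hA Φ.2,
          warpLimit_eq hu lam hA Ψ.2, ← smul_add, ← integral_add (integrable_warp hu lam hA Φ.2)
          (integrable_warp hu lam hA Ψ.2)]
        simp_rw [hsm, Submodule.coe_add, map_add]
      map_smul' := fun c Ψ ↦ by
        rw [RingHom.id_apply, warpLimit_eq hu lam hA (c • Ψ).2, warpLimit_eq hu lam hA Ψ.2,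
          smul_comm c]
        congr 1
        rw [← integral_smul]
        simp_rw [hsm, Submodule.coe_smul, map_smul] }
  let F : smoothVectors u →L[ℂ] H := f.mkContinuous C fun Ψ ↦ hC Ψ Ψ.2
  have hd : DenseRange (smoothVectors u).subtypeL := by
    have := dense_smoothVectors hu
    simpa [DenseRange] using this
  refine ⟨F.extend (smoothVectors u).subtypeL, fun Ψ hΨ ↦ ?_⟩
  exact F.extend_eq hd (smoothVectors u).subtypeₗᵢ.isometry.isUniformInducing ⟨Ψ, hΨ⟩

theorem exists_isCutoff : ∃ χ, IsCutoff χ := by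
  let b : ContDiffBump (0 : Plane × Plane) := default
  refine ⟨fun z ↦ (b z : ℂ), Complex.ofRealCLM.contDiff.comp b.contDiff, ?_, ?_⟩
  · exact b.hasCompactSupport.comp_left (g := ((↑) : ℝ → ℂ)) rfl
  · have := b.one_of_mem_closedBall (x := 0) (by simp [b.rIn_pos.le])
    exact_mod_cast congrArg ((↑) : ℝ → ℂ) this

/-- The regularized integrals converge for every cutoff to the same vector, so the condition on R
only prescribes its values on smooth vectors. -/
theorem isWarpedConvolution_iff (hu : IsPlaneRep u) (lam : ℝ) {A R : H →L[ℂ] H}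
    (hA : IsSmoothOp u A) :
    IsWarpedConvolution u lam A R ↔ ∀ Ψ, IsSmoothVec u Ψ → R Ψ = warpLimit u lam A Ψ := by
  constructor
  · intro h Ψ hΨ
    obtain ⟨χ, hχ⟩ := exists_isCutoff
    exact tendsto_nhds_unique (h Ψ hΨ χ hχ) (tendsto_warpedIntegral hu lam hA hΨ hχ)
  · intro h Ψ hΨ χ hχ
    rw [h Ψ hΨ]
    exact tendsto_warpedIntegral hu lam hA hΨ hχ

theorem eq_of_eq_on_smooth (hu : IsPlaneRep u) {R S : H →L[ℂ] H}
    (h : ∀ Ψ, IsSmoothVec u Ψ → R Ψ = S Ψ) : R = S := by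
  have := Continuous.ext_on (dense_smoothVectors hu) R.continuous S.continuous fun Ψ hΨ ↦ h Ψ hΨ
  exact DFunLike.coe_injective this

theorem ext_on_inner_smooth (hu : IsPlaneRep u) {v w : H}
    (h : ∀ Φ, IsSmoothVec u Φ → inner ℂ Φ v = inner ℂ Φ w) : v = w := by
  have := Continuous.ext_on (dense_smoothVectors hu) (by fun_prop : Continuous fun Φ ↦ inner ℂ Φ v)
    (by fun_prop : Continuous fun Φ ↦ inner ℂ Φ w) fun Φ hΦ ↦ h Φ hΦ
  exact ext_inner_left ℂ fun Φ ↦ congrFun this Φ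

/-- Existence and uniqueness of the warped convolution of a smooth operator. -/
theorem existsUnique_isWarpedConvolution (hu : IsPlaneRep u) (lam : ℝ) {A : H →L[ℂ] H}
    (hA : IsSmoothOp u A) : ∃! R : H →L[ℂ] H, IsWarpedConvolution u lam A R := by
  obtain ⟨R, hR⟩ := exists_warpLimit hu lam hA
  refine ⟨R, (isWarpedConvolution_iff hu lam hA).2 hR, fun S hS ↦ ?_⟩
  refine eq_of_eq_on_smooth hu fun Ψ hΨ ↦ ?_
  rw [hR Ψ hΨ, (isWarpedConvolution_iff hu lam hA).1 hS Ψ hΨ]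

end WarpOp

/-! ### Warping with parameter zero is trivial -/

section ZeroParameter

open MeasureTheory Filter FourierTransform

variable {H : Type*} [NormedAddCommGroup H] [InnerProductSpace ℂ H] [CompleteSpace H]
  {u : Plane → H →L[ℂ] H}

theorem isSmoothOp_one (hu : IsPlaneRep u) : IsSmoothOp u (1 : H →L[ℂ] H) := by
  have : (fun s ↦ planeAd u s (1 : H →L[ℂ] H)) = fun _ ↦ 1 := by
    ext1 s
    rw [planeAd, mul_one, hu.mul_neg]
  rw [IsSmoothOp, this]
  exact contDiff_const

theorem planeQ_zero (x : Plane) : planeQ 0 x = 0 := by simp [planeQ_apply]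

theorem opSteps_zero (A : H →L[ℂ] H) : opSteps u 0 A = A := by
  simp [opSteps, opStep, opDeriv, planeQ_zero]

theorem planeDecay_zero : planeDecay 0 = 1 := by
  simp [planeDecay, planeInv]

theorem integrable_planeSmear (hu : IsPlaneRep u) {Ψ : H} (hΨ : IsSmoothVec u Ψ) :
    Integrable fun x ↦ planeSmear u planeDecay x Ψ := by
  -- For λ = 0 and the identity operator the warped integrand is the smeared vector itself.
  have := integrable_warp hu 0 (isSmoothOp_one hu) hΨ
  simpa only [planeQ_zero, hu.planeAd_zero, opSteps_zero, one_apply_eq_self] using this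

/-- Fourier inversion at the origin, where k(0) u(0)Ψ = Ψ; rescaling the plane by 2π gives the
constant. -/
theorem integral_planeSmear (hu : IsPlaneRep u) {Ψ : H} (hΨ : IsSmoothVec u Ψ) :
    ∫ x, planeSmear u planeDecay x Ψ = (4 * (Real.pi : ℂ) ^ 2) • Ψ := by
  have hi := integrable_planeSmear hu hΨ
  have hpi : (2 * Real.pi)⁻¹ ≠ 0 := by positivity
  simp_rw [planeSmear_eq_fourier] at hi ⊢
  set h := fun y ↦ planeDecay y • u y Ψ with hh
  have hi2 : Integrable (𝓕 h) := (integrable_comp_smul_iff volume (𝓕 h) hpi).1 hi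
  have hc : Continuous h := ((isDecaying_planeDecay.1 ()).continuous).smul (hu.continuous Ψ)
  have inv := congrFun (hc.fourierInv_fourier_eq
    (hu.integrable_smul isDecaying_planeDecay.integrable Ψ) hi2) 0
  have e0 : 𝓕⁻ (𝓕 h) 0 = ∫ x, 𝓕 h x := by
    rw [Real.fourierInv_eq']
    simp
  rw [Measure.integral_comp_smul volume (𝓕 h), ← e0, inv, hh]
  simp only [planeDecay_zero, hu.map_zero, one_smul, one_apply_eq_self]
  rw [finrank_euclideanSpace, Fintype.card_fin, abs_of_pos (by positivity), inv_pow, inv_inv]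
  rw [← Complex.coe_smul]
  congr 1
  push_cast
  ring

theorem warpLimit_zero (hu : IsPlaneRep u) {A : H →L[ℂ] H} {Ψ : H}
    (hA : IsSmoothOp u A) (hΨ : IsSmoothVec u Ψ) : warpLimit u 0 A Ψ = A Ψ := by
  rw [warpLimit_eq hu 0 hA hΨ]
  simp_rw [planeQ_zero, hu.planeAd_zero, opSteps_zero]
  rw [A.integral_comp_comm (integrable_planeSmear hu hΨ), integral_planeSmear hu hΨ, map_smul,
    smul_smul, one_div, inv_mul_cancel₀ (by simp [Real.pi_ne_zero]), one_smul]

end ZeroParameter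

/-! ### Adjoint integrals and matrix elements of products -/

section Adjoint

open MeasureTheory Filter

variable {H : Type*} [NormedAddCommGroup H] [InnerProductSpace ℂ H] [CompleteSpace H]
  {u : Plane → H →L[ℂ] H}

theorem continuous_warpSymbol (hu : IsPlaneRep u) (lam : ℝ) (A : H →L[ℂ] H) (Ψ : H) :
    Continuous (warpSymbol u lam A Ψ) := by
  refine hu.continuous₂ (by fun_prop) (A.continuous.comp (hu.continuous₂ (by fun_prop) ?_))
  exact hu.continuous₂ (by fun_prop) continuous_const

theorem IsCutoff.hasCompactSupport_smul {χ : Plane × Plane → ℂ} (hχ : IsCutoff χ) {ε : ℝ}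
    (hε : ε ≠ 0) : HasCompactSupport fun z ↦ χ (ε • z) :=
  hχ.hasCompactSupport.comp_homeomorph (Homeomorph.smulOfNeZero ε hε)

theorem integrable_warpedIntegral (hu : IsPlaneRep u) (lam : ℝ) (A : H →L[ℂ] H)
    {χ : Plane × Plane → ℂ} (hχ : IsCutoff χ) {ε : ℝ} (hε : ε ≠ 0) (Ψ : H) :
    Integrable fun z ↦ Complex.exp (-Complex.I * planePhase z) • χ (ε • z) •
      warpSymbol u lam A Ψ z := by
  have hc := (hχ.hasCompactSupport_smul hε).smul_right (f' := warpSymbol u lam A Ψ)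
  have : Continuous fun z ↦ χ (ε • z) • warpSymbol u lam A Ψ z :=
    (hχ.contDiff.continuous.comp (continuous_const_smul ε)).smul (continuous_warpSymbol hu lam A Ψ)
  exact (this.integrable_of_hasCompactSupport hc).phase_smul contDiff_planePhase.continuous

/-- The symbol of the adjoint of a warped integral. -/
def warpAdjSymbol (u : Plane → H →L[ℂ] H) (lam : ℝ) (A : H →L[ℂ] H) (Φ : H) (z : Plane × Plane) :
    H :=
  planeAd u (planeQ lam z.1 + z.2) (star A) (u z.2 Φ)

theorem symbolBound_warpAdjSymbol (hu : IsPlaneRep u) (lam : ℝ) {A : H →L[ℂ] H} {Φ : H}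
    (hA : IsSmoothOp u A) (hΦ : IsSmoothVec u Φ) :
    SymbolBound (fun _ ↦ 1) fun _ : Unit ↦ warpAdjSymbol u lam A Φ :=
  (((hA.star hu).symbolBound hu).comp_right
    ((planeQ lam).comp (ContinuousLinearMap.fst ℝ Plane Plane) +
      ContinuousLinearMap.snd ℝ Plane Plane)).op_apply
    ((hΦ.symbolBound hu).comp_right (ContinuousLinearMap.snd ℝ Plane Plane))

/-- Reflection of the second variable. -/
def reflSnd : (Plane × Plane) ≃ₗᵢ[ℝ] (Plane × Plane) where
  toFun z := (z.1, -z.2)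
  invFun z := (z.1, -z.2)
  map_add' z w := by ext <;> simp [add_comm]
  map_smul' c z := by ext <;> simp
  left_inv z := by simp
  right_inv z := by simp
  norm_map' z := by simp [Prod.norm_def]

theorem reflSnd_apply (z : Plane × Plane) : reflSnd z = (z.1, -z.2) := rfl

theorem measurePreserving_reflSnd : MeasurePreserving (reflSnd : Plane × Plane → Plane × Plane) :=
  (MeasurePreserving.id (volume : Measure Plane)).prod (Measure.measurePreserving_neg _)

/-- The warped integral that is adjoint to the warped integral of `A`. -/
def adjWarpedIntegral (u : Plane → H →L[ℂ] H) (lam : ℝ) (A : H →L[ℂ] H)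
    (χ : Plane × Plane → ℂ) (ε : ℝ) (Φ : H) : H :=
  (1 / (4 * (Real.pi : ℂ) ^ 2)) • ∫ z, Complex.exp (-Complex.I * planePhase z) •
    (starRingEnd ℂ (χ (reflSnd (ε • z)))) • warpAdjSymbol u lam A Φ z

/-- Conjugation reverses the phase, and s' ↦ -s' restores it. The symbols match because u(-s')
τ_{λQs}(A*)Φ = τ_{λQs-s'}(A*) u(-s')Φ. -/
theorem inner_adjWarpedIntegral (hu : IsPlaneRep u) (lam : ℝ) (A : H →L[ℂ] H)
    {χ : Plane × Plane → ℂ} (hχ : IsCutoff χ) {ε : ℝ} (hε : ε ≠ 0) (Φ Ψ : H) :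
    inner ℂ (adjWarpedIntegral u lam A χ ε Φ) Ψ = inner ℂ Φ (warpedIntegral u lam A χ ε Ψ) := by
  have hi1 := integrable_warpedIntegral hu lam A hχ hε Ψ
  have hc1 : Continuous (warpAdjSymbol u lam A Φ) := by
    refine hu.continuous₂ (by fun_prop) ((star A).continuous.comp (hu.continuous₂ (by fun_prop) ?_))
    exact hu.continuous₂ (by fun_prop) continuous_const
  have hi2 : Integrable fun z ↦ Complex.exp (-Complex.I * planePhase z) •
      (starRingEnd ℂ (χ (reflSnd (ε • z)))) • warpAdjSymbol u lam A Φ z := by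
    have hs : HasCompactSupport fun z ↦ starRingEnd ℂ (χ (reflSnd (ε • z))) :=
      ((hχ.hasCompactSupport.comp_homeomorph reflSnd.toHomeomorph).comp_homeomorph
        (Homeomorph.smulOfNeZero ε hε)).comp_left (g := starRingEnd ℂ) (map_zero _)
    have hcs : Continuous fun z ↦ starRingEnd ℂ (χ (reflSnd (ε • z))) :=
      Complex.continuous_conj.comp (hχ.contDiff.continuous.comp
        (reflSnd.continuous.comp (continuous_const_smul ε)))
    exact ((hcs.smul hc1).integrable_of_hasCompactSupport hs.smul_right).phase_smul
      contDiff_planePhase.continuous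
  rw [warpedIntegral_eq hu, adjWarpedIntegral, inner_smul_left, inner_smul_right,
    ← integral_inner hi1, ← inner_conj_symm, ← integral_inner hi2, ← integral_conj]
  congr 1
  · simp [Complex.conj_ofNat]
  rw [← measurePreserving_reflSnd.integral_comp reflSnd.toHomeomorph.measurableEmbedding]
  congr 1 with z
  rw [inner_conj_symm, inner_smul_left, inner_smul_left, inner_smul_right, inner_smul_right]
  have e1 : planePhase (reflSnd z) = -planePhase z := by
    simp [planePhase, reflSnd_apply, inner_neg_right]
  have e2 : reflSnd (ε • reflSnd z) = ε • z := by
    ext1 <;> simp [reflSnd_apply]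
  have e3 : inner ℂ (warpAdjSymbol u lam A Φ (reflSnd z)) Ψ =
      inner ℂ Φ (warpSymbol u lam A Ψ z) := by
    have : warpAdjSymbol u lam A Φ (reflSnd z) =
        u (-z.2) (planeAd u (planeQ lam z.1) (star A) Φ) := by
      rw [warpAdjSymbol, reflSnd_apply, add_comm, hu.planeAd_add, hu.planeAd_apply_apply]
    rw [this, hu.inner_left, neg_neg, hu.planeAd_star, ContinuousLinearMap.star_eq_adjoint,
      ContinuousLinearMap.adjoint_inner_left]
    rfl
  rw [e1, e2, e3, RCLike.conj_conj, ← Complex.exp_conj]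
  congr 2
  simp

/-- The adjoint integrals are themselves oscillatory with a bounded symbol, so they converge in
norm. Pairing with the dense set of smooth vectors identifies the limit. -/
theorem tendsto_adjWarpedIntegral (hu : IsPlaneRep u) (lam : ℝ) {A R : H →L[ℂ] H}
    (hA : IsSmoothOp u A) (hR : IsWarpedConvolution u lam A R) {χ : Plane × Plane → ℂ}
    (hχ : IsCutoff χ) {Φ : H} (hΦ : IsSmoothVec u Φ) :
    Tendsto (fun ε : ℝ ↦ adjWarpedIntegral u lam A χ ε Φ) (𝓝[>] 0) (𝓝 (star R Φ)) := by
  have h1 := (tendsto_oscillatory (μ := volume) contDiff_planePhase planeDirs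
    fderiv_planePhase_planeDirs
    integrable_oscWeight_planeDirs (symbolBound_warpAdjSymbol hu lam hA hΦ)
    (χ := fun z ↦ starRingEnd ℂ (χ (reflSnd z)))
    (Complex.conjCLE.contDiff.comp (hχ.contDiff.comp reflSnd.contDiff))
    ((hχ.hasCompactSupport.comp_homeomorph reflSnd.toHomeomorph).comp_left
      (g := starRingEnd ℂ) (map_zero _))
    (by simp [reflSnd_apply, hχ.map_zero])).const_smul (1 / (4 * (Real.pi : ℂ) ^ 2))
  change Tendsto (fun ε : ℝ ↦ adjWarpedIntegral u lam A χ ε Φ) _ _ at h1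
  set J := (1 / (4 * (Real.pi : ℂ) ^ 2)) • ∫ z, Complex.exp (-Complex.I * planePhase z) •
    planeDirs.foldr oscStep (warpAdjSymbol u lam A Φ) z
  have h2 : ∀ Ψ ∈ (smoothVectors u : Set H), inner ℂ J Ψ = inner ℂ (star R Φ) Ψ := by
    intro Ψ hΨ
    have t1 : Tendsto (fun ε : ℝ ↦ inner ℂ (adjWarpedIntegral u lam A χ ε Φ) Ψ) (𝓝[>] 0)
        (𝓝 (inner ℂ J Ψ)) := h1.inner tendsto_const_nhds
    have t2 : Tendsto (fun ε : ℝ ↦ inner ℂ Φ (warpedIntegral u lam A χ ε Ψ)) (𝓝[>] 0)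
        (𝓝 (inner ℂ Φ (R Ψ))) := tendsto_const_nhds.inner (hR Ψ hΨ χ hχ)
    rw [ContinuousLinearMap.star_eq_adjoint, ContinuousLinearMap.adjoint_inner_left]
    refine tendsto_nhds_unique t1 (t2.congr' ?_)
    filter_upwards [self_mem_nhdsWithin] with ε hε
    exact (inner_adjWarpedIntegral hu lam A hχ (ne_of_gt hε) Φ Ψ).symm
  have h3 := Continuous.ext_on (dense_smoothVectors hu)
    (by fun_prop : Continuous fun Ψ ↦ inner ℂ J Ψ)
    (by fun_prop : Continuous fun Ψ ↦ inner ℂ (star R Φ) Ψ) h2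
  have h4 : J = star R Φ := ext_inner_right ℂ fun Ψ ↦ congrFun h3 Ψ
  rwa [← h4]

/-- Matrix elements of a product of two warped convolutions. -/
theorem tendsto_inner_warpedIntegral (hu : IsPlaneRep u) (lam mu : ℝ) {A B R S : H →L[ℂ] H}
    (hA : IsSmoothOp u A) (hR : IsWarpedConvolution u lam A R)
    (hS : IsWarpedConvolution u mu B S) {χ : Plane × Plane → ℂ}
    (hχ : IsCutoff χ) {Φ Ψ : H} (hΦ : IsSmoothVec u Φ) (hΨ : IsSmoothVec u Ψ) :
    Tendsto (fun ε : ℝ ↦ inner ℂ Φ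
      (warpedIntegral u lam A χ ε (warpedIntegral u mu B χ ε Ψ))) (𝓝[>] 0)
      (𝓝 (inner ℂ Φ (R (S Ψ)))) := by
  -- With the first factor moved to Φ, both entries of the inner product converge in norm. Neither a
  -- uniform bound on the regularized operators nor smoothness of SΨ is required.
  have h := (tendsto_adjWarpedIntegral hu lam hA hR hχ hΦ).inner (𝕜 := ℂ) (hS Ψ hΨ χ hχ)
  rw [ContinuousLinearMap.star_eq_adjoint, ContinuousLinearMap.adjoint_inner_left] at h
  refine h.congr' ?_
  filter_upwards [self_mem_nhdsWithin] with ε hε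
  exact inner_adjWarpedIntegral hu lam A hχ (ne_of_gt hε) Φ _

end Adjoint

/-! ### Products of warped convolutions -/

section Product

open MeasureTheory Filter

variable {H : Type*} [NormedAddCommGroup H] [InnerProductSpace ℂ H] [CompleteSpace H]
  {u : Plane → H →L[ℂ] H}

/-- The domain of integration for a product of two warped integrals. -/
abbrev DoublePlane : Type := (Plane × Plane) × (Plane × Plane)

instance isAddHaarMeasure_volume_doublePlane : (volume : Measure DoublePlane).IsAddHaarMeasure :=
  Measure.prod.instIsAddHaarMeasure _ _

/-- The phase of a product of two warped integrals. -/
def doublePhase (p : DoublePlane) : ℝ := planePhase p.1 + planePhase p.2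

theorem contDiff_doublePhase : ContDiff ℝ ∞ doublePhase :=
  (contDiff_planePhase.comp contDiff_fst).add (contDiff_planePhase.comp contDiff_snd)

/-- A direction of integration by parts in the first factor. -/
def dirInl (p : (Plane × Plane) × ((Plane × Plane) →L[ℝ] ℝ)) :
    DoublePlane × (DoublePlane →L[ℝ] ℝ) :=
  ((p.1, 0), p.2.comp (ContinuousLinearMap.fst ℝ (Plane × Plane) (Plane × Plane)))

/-- A direction of integration by parts in the second factor. -/
def dirInr (p : (Plane × Plane) × ((Plane × Plane) →L[ℝ] ℝ)) :
    DoublePlane × (DoublePlane →L[ℝ] ℝ) :=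
  ((0, p.1), p.2.comp (ContinuousLinearMap.snd ℝ (Plane × Plane) (Plane × Plane)))

/-- The integrations by parts for a product of two warped integrals. -/
def doubleDirs : List (DoublePlane × (DoublePlane →L[ℝ] ℝ)) :=
  planeDirs.map dirInl ++ planeDirs.map dirInr

theorem fderiv_doublePhase (p q : DoublePlane) :
    fderiv ℝ doublePhase p q = fderiv ℝ planePhase p.1 q.1 + fderiv ℝ planePhase p.2 q.2 := by
  have hd : Differentiable ℝ planePhase := contDiff_planePhase.differentiable (by simp)
  have h := (((hd p.1).hasFDerivAt.comp p hasFDerivAt_fst).add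
    ((hd p.2).hasFDerivAt.comp p hasFDerivAt_snd)).fderiv
  have h' : fderiv ℝ doublePhase p = _ := h
  rw [h']
  simp

theorem fderiv_doublePhase_doubleDirs :
    ∀ q ∈ doubleDirs, ∀ p, fderiv ℝ doublePhase p q.1 = q.2 p := by
  intro q hq p
  rw [fderiv_doublePhase]
  rcases List.mem_append.1 hq with h | h <;> obtain ⟨r, hr, rfl⟩ := List.mem_map.1 h
  · have := fderiv_planePhase_planeDirs r hr p.1
    simp [dirInl, this]
  · have := fderiv_planePhase_planeDirs r hr p.2
    simp [dirInr, this]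

theorem oscWeight_doubleDirs (p : DoublePlane) :
    oscWeight doubleDirs p = oscWeight planeDirs p.1 * oscWeight planeDirs p.2 := by
  simp only [oscWeight, doubleDirs, List.map_append, List.map_map, List.prod_append]
  rfl

theorem integrable_oscWeight_doubleDirs : Integrable (oscWeight doubleDirs) := by
  have : oscWeight doubleDirs =
      fun p : DoublePlane ↦ oscWeight planeDirs p.1 * oscWeight planeDirs p.2 :=
    funext oscWeight_doubleDirs
  rw [this]
  exact integrable_oscWeight_planeDirs.mul_prod integrable_oscWeight_planeDirs

/-- The symbol of the product of two warped integrals. -/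
def doubleSymbol (u : Plane → H →L[ℂ] H) (lam mu : ℝ) (A B : H →L[ℂ] H) (Ψ : H)
    (p : DoublePlane) : H :=
  planeAd u (planeQ lam p.1.1) A (planeAd u (p.1.2 + planeQ mu p.2.1) B (u (p.1.2 + p.2.2) Ψ))

theorem symbolBound_doubleSymbol (hu : IsPlaneRep u) (lam mu : ℝ) {A B : H →L[ℂ] H} {Ψ : H}
    (hA : IsSmoothOp u A) (hB : IsSmoothOp u B) (hΨ : IsSmoothVec u Ψ) :
    SymbolBound (fun _ ↦ 1) fun _ : Unit ↦ doubleSymbol u lam mu A B Ψ := by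
  let p1 := ContinuousLinearMap.fst ℝ (Plane × Plane) (Plane × Plane)
  let p2 := ContinuousLinearMap.snd ℝ (Plane × Plane) (Plane × Plane)
  let q1 := ContinuousLinearMap.fst ℝ Plane Plane
  let q2 := ContinuousLinearMap.snd ℝ Plane Plane
  exact ((hA.symbolBound hu).comp_right ((planeQ lam).comp (q1.comp p1))).op_apply
    (((hB.symbolBound hu).comp_right (q2.comp p1 + (planeQ mu).comp (q1.comp p2))).op_apply
      ((hΨ.symbolBound hu).comp_right (q2.comp p1 + q2.comp p2)))

theorem warpSymbol_warpSymbol (hu : IsPlaneRep u) (lam mu : ℝ) (A B : H →L[ℂ] H) (Ψ : H)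
    (p : DoublePlane) :
    warpSymbol u lam A (warpSymbol u mu B Ψ p.2) p.1 = doubleSymbol u lam mu A B Ψ p := by
  rw [warpSymbol, warpSymbol, doubleSymbol, hu.planeAd_add, hu.apply_add, hu.planeAd_apply_apply]

/-- The cutoff function of a product of two warped integrals. -/
def doubleCutoff (χ : Plane × Plane → ℂ) (p : DoublePlane) : ℂ := χ p.1 * χ p.2

theorem contDiff_doubleCutoff {χ : Plane × Plane → ℂ} (hχ : IsCutoff χ) :
    ContDiff ℝ ∞ (doubleCutoff χ) :=
  (hχ.contDiff.comp contDiff_fst).mul (hχ.contDiff.comp contDiff_snd)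

theorem hasCompactSupport_doubleCutoff {χ : Plane × Plane → ℂ} (hχ : IsCutoff χ) :
    HasCompactSupport (doubleCutoff χ) := by
  refine HasCompactSupport.intro (hχ.hasCompactSupport.isCompact.prod
    hχ.hasCompactSupport.isCompact) fun p hp ↦ ?_
  rw [Set.mem_prod, not_and_or] at hp
  rcases hp with h | h <;> simp [doubleCutoff, image_eq_zero_of_notMem_tsupport h]

theorem doubleCutoff_zero {χ : Plane × Plane → ℂ} (hχ : IsCutoff χ) : doubleCutoff χ 0 = 1 := by
  have : χ 0 = 1 := hχ.map_zero
  simp [doubleCutoff, this]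

theorem warpSymbol_apply (u : Plane → H →L[ℂ] H) (lam : ℝ) (A : H →L[ℂ] H) (Ψ : H)
    (z : Plane × Plane) :
    warpSymbol u lam A Ψ z = (planeAd u (planeQ lam z.1) A * u z.2) Ψ := rfl

theorem warpedIntegral_warpedIntegral (hu : IsPlaneRep u) (lam mu : ℝ) {A B : H →L[ℂ] H}
    (hA : IsSmoothOp u A) (hB : IsSmoothOp u B) {Ψ : H} (hΨ : IsSmoothVec u Ψ)
    {χ : Plane × Plane → ℂ} (hχ : IsCutoff χ) {ε : ℝ} (hε : ε ≠ 0) :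
    warpedIntegral u lam A χ ε (warpedIntegral u mu B χ ε Ψ) =
      ((1 / (4 * (Real.pi : ℂ) ^ 2)) * (1 / (4 * (Real.pi : ℂ) ^ 2))) •
        ∫ p, Complex.exp (-Complex.I * doublePhase p) • doubleCutoff χ (ε • p) •
          doubleSymbol u lam mu A B Ψ p := by
  have hi : Integrable fun p ↦ Complex.exp (-Complex.I * doublePhase p) •
      doubleCutoff χ (ε • p) • doubleSymbol u lam mu A B Ψ p := by
    refine Integrable.phase_smul contDiff_doublePhase.continuous ?_
    refine Continuous.integrable_of_hasCompactSupport ?_ ?_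
    · exact ((contDiff_doubleCutoff hχ).continuous.comp (continuous_const_smul ε)).smul
        ((symbolBound_doubleSymbol hu lam mu hA hB hΨ).1 ()).continuous
    · exact ((hasCompactSupport_doubleCutoff hχ).comp_homeomorph
        (Homeomorph.smulOfNeZero ε hε)).smul_right
  rw [warpedIntegral_eq hu lam, warpedIntegral_eq hu mu, mul_smul]
  congr 1
  have e : ∫ p, Complex.exp (-Complex.I * doublePhase p) • doubleCutoff χ (ε • p) •
      doubleSymbol u lam mu A B Ψ p = ∫ z, ∫ z', Complex.exp (-Complex.I * doublePhase (z, z')) •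
        doubleCutoff χ (ε • (z, z')) • doubleSymbol u lam mu A B Ψ (z, z') := integral_prod _ hi
  rw [e]
  refine Eq.trans ?_ (integral_smul (1 / (4 * (Real.pi : ℂ) ^ 2)) _)
  refine integral_congr_ae (ae_of_all _ fun z ↦ ?_)
  beta_reduce
  -- For fixed z the outer integrand is a bounded operator applied to the inner integral, so it may
  -- be taken under the integral sign.
  set D := Complex.exp (-Complex.I * planePhase z) • χ (ε • z) •
    (planeAd u (planeQ lam z.1) A * u z.2) with hD
  have hB' := integrable_warpedIntegral hu mu B hχ hε Ψ
  have e1 : Complex.exp (-Complex.I * planePhase z) • χ (ε • z) • warpSymbol u lam A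
      ((1 / (4 * (Real.pi : ℂ) ^ 2)) • ∫ z, Complex.exp (-Complex.I * planePhase z) •
        χ (ε • z) • warpSymbol u mu B Ψ z) z = D ((1 / (4 * (Real.pi : ℂ) ^ 2)) •
        ∫ z, Complex.exp (-Complex.I * planePhase z) • χ (ε • z) • warpSymbol u mu B Ψ z) := rfl
  rw [e1, map_smul, ← D.integral_comp_comm hB']
  congr 2 with z'
  rw [map_smul, map_smul, hD, smul_apply, smul_apply, ← warpSymbol_apply]
  have e2 := warpSymbol_warpSymbol hu lam mu A B Ψ (z, z')
  rw [← e2, doubleCutoff, doublePhase]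
  simp only [smul_smul]
  congr 1
  have e3 : Complex.exp (-Complex.I * ((planePhase z + planePhase z' : ℝ) : ℂ)) =
      Complex.exp (-Complex.I * planePhase z) * Complex.exp (-Complex.I * planePhase z') := by
    rw [← Complex.exp_add]
    push_cast
    ring_nf
  change _ = Complex.exp (-Complex.I * ((planePhase z + planePhase z' : ℝ) : ℂ)) *
    (χ (ε • z) * χ (ε • z'))
  rw [e3]
  ring

/-- The exchange of the two factors followed by a shear. -/
def shearSwap (c : ℝ) : DoublePlane →L[ℝ] DoublePlane :=
  let p1 := ContinuousLinearMap.fst ℝ (Plane × Plane) (Plane × Plane)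
  let p2 := ContinuousLinearMap.snd ℝ (Plane × Plane) (Plane × Plane)
  let q1 := ContinuousLinearMap.fst ℝ Plane Plane
  let q2 := ContinuousLinearMap.snd ℝ Plane Plane
  ((q1.comp p2 + (planeQ c).comp (q2.comp p1)).prod (q2.comp p2)).prod
    ((q1.comp p1 + (planeQ c).comp (q2.comp p2)).prod (q2.comp p1))

theorem shearSwap_apply (c : ℝ) (p : DoublePlane) :
    shearSwap c p = ((p.2.1 + planeQ c p.1.2, p.2.2), (p.1.1 + planeQ c p.2.2, p.1.2)) := rfl

theorem planeQ_neg (c : ℝ) (x : Plane) : planeQ (-c) x = -planeQ c x := by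
  simp [planeQ_apply]

theorem shearSwap_neg_apply (c : ℝ) (p : DoublePlane) : shearSwap (-c) (shearSwap c p) = p := by
  simp [shearSwap_apply, planeQ_neg]

/-- The exchange of the two factors followed by a shear, as an equivalence. -/
def shearSwapEquiv (c : ℝ) : DoublePlane ≃L[ℝ] DoublePlane :=
  ContinuousLinearEquiv.equivOfInverse (shearSwap c) (shearSwap (-c)) (shearSwap_neg_apply c)
    fun p ↦ by simpa using shearSwap_neg_apply (-c) p

/-- The map is a composition of exchanges and of shears that translate one factor by an amount
depending on the other. -/
theorem measurePreserving_shearSwap (c : ℝ) : MeasurePreserving (shearSwap c) := by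
  have h1 : MeasurePreserving (fun p : DoublePlane ↦ (p.1, p.2 + (planeQ c p.1.2, 0))) := by
    refine (MeasurePreserving.id (volume : Measure (Plane × Plane))).skew_product
      (g := fun z w ↦ w + (planeQ c z.2, 0)) ?_ (ae_of_all _ fun z ↦ ?_)
    · exact Continuous.measurable (by fun_prop)
    · exact (measurePreserving_add_right volume ((planeQ c z.2, 0) : Plane × Plane)).map_eq
  have h2 : MeasurePreserving (Prod.swap : DoublePlane → DoublePlane) :=
    Measure.measurePreserving_swap
  have h3 := h2.comp ((h2.comp h1).comp (h2.comp h1))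
  have e : (shearSwap c : DoublePlane → DoublePlane) = Prod.swap ∘
      ((Prod.swap ∘ fun p : DoublePlane ↦ (p.1, p.2 + (planeQ c p.1.2, 0))) ∘
        (Prod.swap ∘ fun p : DoublePlane ↦ (p.1, p.2 + (planeQ c p.1.2, 0)))) := by
    ext1 p
    simp [shearSwap_apply, Prod.ext_iff]
  rw [e]
  exact h3

theorem inner_planeQ (c : ℝ) (x y : Plane) : inner ℝ (planeQ c x) y = c * (x 1 * y 0 - x 0 * y 1) := by
  simp [planeQ_apply, warpQ, PiLp.inner_apply, Fin.sum_univ_two, Matrix.toEuclideanLin,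
    dotProduct, Matrix.toLpLin]
  ring

/-- The two cross terms contributed by the shears cancel by antisymmetry of Q. -/
theorem doublePhase_shearSwap (c : ℝ) (p : DoublePlane) :
    doublePhase (shearSwap c p) = doublePhase p := by
  simp only [doublePhase, planePhase, shearSwap_apply, inner_add_left, inner_planeQ]
  ring

theorem planeQ_planeQ (a b : ℝ) (x : Plane) : planeQ a (planeQ b x) = -((a * b) • x) := by
  ext i
  fin_cases i <;>
  simp [planeQ_apply, warpQ, Fin.sum_univ_two, Matrix.toEuclideanLin,
    dotProduct, Matrix.toLpLin] <;> ring

/-- Because Q² = -1, the shear by -λ⁻¹Q adds to λQs exactly the s' of the other factor, and with -λ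
it cancels the one already present. Thus A and B sit at the orbit points they have in the opposite
product, and it remains to commute them. -/
theorem doubleSymbol_shearSwap (hu : IsPlaneRep u) {lam : ℝ} (hlam : lam ≠ 0) {A B : H →L[ℂ] H}
    (hAB : ∀ s, planeAd u s A * B = B * planeAd u s A) (Ψ : H) (p : DoublePlane) :
    doubleSymbol u lam (-lam) A B Ψ (shearSwap (-lam⁻¹) p) = doubleSymbol u (-lam) lam B A Ψ p := by
  -- Commutation along one orbit suffices: conjugating by the flow moves both operators
  -- simultaneously.
  have hcomm : ∀ s t, planeAd u s A * planeAd u t B = planeAd u t B * planeAd u s A := by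
    intro s t
    have e : planeAd u s A = planeAd u t (planeAd u (s - t) A) := by
      rw [← hu.planeAd_add]; congr 1; abel
    rw [e, ← hu.planeAd_mul, ← hu.planeAd_mul, hAB]
  have e1 : planeQ lam (p.2.1 + planeQ (-lam⁻¹) p.1.2) = p.1.2 + planeQ lam p.2.1 := by
    rw [map_add, planeQ_planeQ, mul_neg, mul_inv_cancel₀ hlam]
    simp [add_comm]
  have e2 : p.2.2 + planeQ (-lam) (p.1.1 + planeQ (-lam⁻¹) p.2.2) = planeQ (-lam) p.1.1 := by
    rw [map_add, planeQ_planeQ, neg_mul_neg, mul_inv_cancel₀ hlam]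
    simp
  have e3 := congrArg (fun T : H →L[ℂ] H ↦ T (u (p.1.2 + p.2.2) Ψ))
    (hcomm (p.1.2 + planeQ lam p.2.1) (planeQ (-lam) p.1.1))
  simp only [doubleSymbol, shearSwap_apply, e1, e2]
  rw [add_comm p.2.2]
  exact e3

/-- Warped convolutions with opposite parameters of operators that commute along the orbits
commute. -/
theorem IsWarpedConvolution.commute (hu : IsPlaneRep u) {lam : ℝ} {A B R S : H →L[ℂ] H}
    (hA : IsSmoothOp u A) (hB : IsSmoothOp u B)
    (hAB : ∀ s, planeAd u s A * B = B * planeAd u s A)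
    (hR : IsWarpedConvolution u lam A R) (hS : IsWarpedConvolution u (-lam) B S) :
    R * S = S * R := by
  -- The shear involves λ⁻¹, so λ = 0 is treated separately.
  by_cases hlam : lam = 0
  · subst hlam
    rw [neg_zero] at hS
    have eR : R = A := eq_of_eq_on_smooth hu fun Ψ hΨ ↦ by
      rw [(isWarpedConvolution_iff hu 0 hA).1 hR Ψ hΨ, warpLimit_zero hu hA hΨ]
    have eS : S = B := eq_of_eq_on_smooth hu fun Ψ hΨ ↦ by
      rw [(isWarpedConvolution_iff hu 0 hB).1 hS Ψ hΨ, warpLimit_zero hu hB hΨ]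
    rw [eR, eS]
    simpa [hu.planeAd_zero] using hAB 0
  refine eq_of_eq_on_smooth hu fun Ψ hΨ ↦ ?_
  obtain ⟨χ, hχ⟩ := exists_isCutoff
  set cst : ℂ := (1 / (4 * (Real.pi : ℂ) ^ 2)) * (1 / (4 * (Real.pi : ℂ) ^ 2)) with hcst
  have hsym := symbolBound_doubleSymbol hu lam (-lam) hA hB hΨ
  have t1 := (tendsto_oscillatory (μ := volume) contDiff_doublePhase doubleDirs
    fderiv_doublePhase_doubleDirs integrable_oscWeight_doubleDirs hsym
    (contDiff_doubleCutoff hχ) (hasCompactSupport_doubleCutoff hχ) (doubleCutoff_zero hχ)).const_smul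
    cst
  -- The same symbol is integrated with a second cutoff, the sheared one, with the same limit L. The
  -- sign is +λ⁻¹ because this map inverts the substitution with -λ⁻¹, after which the cutoff is χ ⊗
  -- χ again.
  have t2 := (tendsto_oscillatory (μ := volume) contDiff_doublePhase doubleDirs
    fderiv_doublePhase_doubleDirs integrable_oscWeight_doubleDirs hsym
    (χ := fun p ↦ doubleCutoff χ (shearSwapEquiv lam⁻¹ p))
    ((contDiff_doubleCutoff hχ).comp (shearSwapEquiv lam⁻¹).contDiff)
    ((hasCompactSupport_doubleCutoff hχ).comp_homeomorph (shearSwapEquiv lam⁻¹).toHomeomorph)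
    (by simpa using doubleCutoff_zero hχ)).const_smul cst
  set L := ∫ p, Complex.exp (-Complex.I * doublePhase p) •
    doubleDirs.foldr oscStep (doubleSymbol u lam (-lam) A B Ψ) p
  have hsub : ∀ ε : ℝ, ∫ p, Complex.exp (-Complex.I * doublePhase p) •
      doubleCutoff χ (shearSwapEquiv lam⁻¹ (ε • p)) • doubleSymbol u lam (-lam) A B Ψ p =
      ∫ p, Complex.exp (-Complex.I * doublePhase p) • doubleCutoff χ (ε • p) •
        doubleSymbol u (-lam) lam B A Ψ p := by
    intro ε
    rw [← (measurePreserving_shearSwap (-lam⁻¹)).integral_comp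
      (shearSwapEquiv (-lam⁻¹)).toHomeomorph.measurableEmbedding]
    congr 1 with p
    rw [doublePhase_shearSwap, doubleSymbol_shearSwap hu hlam hAB]
    congr 3
    have := shearSwap_neg_apply (-lam⁻¹) p
    rw [neg_neg] at this
    rw [map_smul]
    exact congrArg (ε • ·) this
  simp_rw [hsub] at t2
  refine ext_on_inner_smooth hu fun Φ hΦ ↦ ?_
  have r1 := tendsto_inner_warpedIntegral hu lam (-lam) hA hR hS hχ hΦ hΨ
  have r2 := tendsto_inner_warpedIntegral hu (-lam) lam hB hS hR hχ hΦ hΨ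
  have l1 : Tendsto (fun ε : ℝ ↦ inner ℂ Φ
      (warpedIntegral u lam A χ ε (warpedIntegral u (-lam) B χ ε Ψ))) (𝓝[>] 0)
      (𝓝 (inner ℂ Φ (cst • L))) := by
    refine (tendsto_const_nhds.inner t1).congr' ?_
    filter_upwards [self_mem_nhdsWithin] with ε hε
    rw [warpedIntegral_warpedIntegral hu lam (-lam) hA hB hΨ hχ (ne_of_gt hε)]
  have l2 : Tendsto (fun ε : ℝ ↦ inner ℂ Φ
      (warpedIntegral u (-lam) B χ ε (warpedIntegral u lam A χ ε Ψ))) (𝓝[>] 0)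
      (𝓝 (inner ℂ Φ (cst • L))) := by
    refine (tendsto_const_nhds.inner t2).congr' ?_
    filter_upwards [self_mem_nhdsWithin] with ε hε
    rw [warpedIntegral_warpedIntegral hu (-lam) lam hB hA hΨ hχ (ne_of_gt hε)]
  exact (tendsto_nhds_unique r1 l1).trans (tendsto_nhds_unique r2 l2).symm

end Product

/-! ### Unitaries that commute with the representation -/

section Conjugation

open MeasureTheory Filter

variable {H : Type*} [NormedAddCommGroup H] [InnerProductSpace ℂ H] [CompleteSpace H]
  {u : Plane → H →L[ℂ] H} {W : H →L[ℂ] H}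

theorem planeAd_conj (hW : ∀ s, Commute W (u s)) (s : Plane) (A W' : H →L[ℂ] H)
    (hW' : ∀ s, Commute W' (u s)) :
    planeAd u s (W * A * W') = W * planeAd u s A * W' := by
  simp only [planeAd, mul_assoc]
  rw [(hW' (-s)).eq, ← mul_assoc (u s), ← (hW s).eq, mul_assoc]

theorem IsPlaneRep.commute_star (hu : IsPlaneRep u) (hW : ∀ s, Commute W (u s)) (s : Plane) :
    Commute (star W) (u s) := by
  have := (hW (-s)).star_star
  rwa [hu.star_eq, neg_neg] at this

theorem IsSmoothOp.conj (hu : IsPlaneRep u) {A : H →L[ℂ] H} (hA : IsSmoothOp u A)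
    (hW : ∀ s, Commute W (u s)) : IsSmoothOp u (W * A * Star.star W) := by
  have : (fun s ↦ planeAd u s (W * A * Star.star W)) =
      fun s ↦ W * planeAd u s A * Star.star W :=
    funext fun s ↦ planeAd_conj hW s A _ (hu.commute_star hW)
  rw [IsSmoothOp, this]
  exact (contDiff_const.mul hA).mul contDiff_const

theorem IsSmoothVec.apply {Ψ : H} (hΨ : IsSmoothVec u Ψ) (hW : ∀ s, Commute W (u s)) :
    IsSmoothVec u (W Ψ) := by
  have : (fun s ↦ u s (W Ψ)) = fun s ↦ W.restrictScalars ℝ (u s Ψ) :=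
    funext fun s ↦ (congrArg (fun T : H →L[ℂ] H ↦ T Ψ) (hW s).eq).symm
  rw [IsSmoothVec, this]
  exact (ContinuousLinearMap.contDiff _).comp hΨ

/-- W passes through the integral, and star W past u(s'), since both commute with the
representation; only this commutation enters. -/
theorem IsWarpedConvolution.conj (hu : IsPlaneRep u) {lam : ℝ} {A R : H →L[ℂ] H}
    (hR : IsWarpedConvolution u lam A R) (hW : ∀ s, Commute W (u s)) :
    IsWarpedConvolution u lam (W * A * star W) (W * R * star W) := by
  intro Ψ hΨ χ hχ
  have h := ((W.continuous.tendsto _).comp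
    (hR (star W Ψ) (IsSmoothVec.apply hΨ (hu.commute_star hW)) χ hχ))
  refine h.congr' ?_
  filter_upwards [self_mem_nhdsWithin] with ε hε
  rw [Function.comp_apply, warpedIntegral_eq hu, warpedIntegral_eq hu, map_smul,
    ← W.integral_comp_comm (integrable_warpedIntegral hu lam A hχ (ne_of_gt hε) (star W Ψ))]
  congr 2 with z
  rw [map_smul, map_smul, warpSymbol_apply, warpSymbol_apply,
    planeAd_conj hW _ A _ (hu.commute_star hW)]
  have := (hu.commute_star hW z.2).eq
  have e : W * (planeAd u (planeQ lam z.1) A * u z.2) * star W =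
      W * planeAd u (planeQ lam z.1) A * star W * u z.2 := by
    simp only [mul_assoc, this]
  rw [← e]
  rfl

end Conjugation

/-- If conjugation by an involution commutes with conjugation by `u`, then it fixes `u * u`. -/
theorem commute_mul_self_of_conj {R : Type*} [Monoid R] {v u u' : R} (hv : v * v = 1)
    (hu : u * u' = 1) (hu' : u' * u = 1)
    (h : ∀ a, v * (u * a * u') * v = u * (v * a * v) * u') : Commute v (u * u) := by
  set x := v * u * v with hx
  -- Two test elements suffice: a = u shows that x = v u v commutes with u, and a = v gives x u⁻¹ x
  -- = u. Together they yield x² = u².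
  have h1 : x * u = u * x := by
    have := congrArg (· * u) (h u)
    simpa only [hx, mul_assoc, hu, hu', mul_one] using this
  have h2 : x * u' * x = u := by
    have := congrArg (· * (u * v)) (h v)
    have hv' : ∀ y, v * (v * y) = y := fun y ↦ by rw [← mul_assoc, hv, one_mul]
    have hc : ∀ y, u' * (u * y) = y := fun y ↦ by rw [← mul_assoc, hu', one_mul]
    simpa only [hx, mul_assoc, hv', hc, hv, mul_one] using this
  have h3 : x * x = u * u := by
    have h4 : u' * x = x * u' := by
      calc u' * x = u' * (x * u) * u' := by rw [mul_assoc, mul_assoc, hu, mul_one]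
        _ = x * u' := by rw [h1, ← mul_assoc, hu', one_mul]
    rw [← h4, mul_assoc] at h2
    calc x * x = u * u' * (x * x) := by rw [hu, one_mul]
      _ = u * u := by rw [mul_assoc, h2]
  have h5 : x * x = v * (u * u) * v := by
    simp only [hx, mul_assoc]
    rw [← mul_assoc v v, hv, one_mul]
  have h6 : v * (u * u) * v = u * u := h5 ▸ h3
  calc v * (u * u) = v * (u * u) * v * v := by rw [mul_assoc _ v v, hv, mul_one]
    _ = u * u * v := by rw [h6]

/-! ### The flow of a Killing pair -/

section Flow

variable {M : Type*} [TopologicalSpace M]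
  [ChartedSpace (EuclideanSpace ℝ (Fin 4)) M] [IsManifold (𝓡 4) ∞ M] {g : LorentzianMetric M}

theorem KillingPair.flow_zero (ξ : KillingPair g) : ξ.flow 0 = 1 := by
  simp [KillingPair.flow, CompleteKillingField.flow_zero]

theorem KillingPair.flow_add (ξ : KillingPair g) (s t : Plane) :
    ξ.flow (s + t) = ξ.flow s * ξ.flow t := by
  simp only [KillingPair.flow, PiLp.add_apply, CompleteKillingField.flow_add, mul_assoc]
  rw [← mul_assoc (ξ.snd.flow (s 1)), ← ξ.comm, mul_assoc]

theorem KillingPair.flow_neg (ξ : KillingPair g) (s : Plane) : ξ.flow (-s) = (ξ.flow s)⁻¹ := by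
  rw [eq_inv_iff_mul_eq_one, ← ξ.flow_add, neg_add_cancel, ξ.flow_zero]

/-- For the compact-open topology, joint continuity of the flow on plane times manifold is enough.
-/
theorem KillingPair.continuous_flow (ξ : KillingPair g) : Continuous ξ.flow := by
  refine continuous_induced_rng.2 (ContinuousMap.continuous_of_continuous_uncurry _ ?_)
  have h1 := ξ.fst.flow_smooth.continuous
  have h2 := ξ.snd.flow_smooth.continuous
  have h0 : ∀ i, Continuous fun x : Plane × M ↦ x.1 i := fun i ↦ by fun_prop
  have h3 : Continuous fun x : Plane × M ↦ (ξ.snd.flow (x.1 1) : M ≃ₜ M) x.2 :=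
    h2.comp ((h0 1).prodMk continuous_snd)
  exact h1.comp ((h0 0).prodMk h3)

end Flow

/-! ### The representation of the plane in a field theory and its commutation with the twist -/

namespace QuantumFieldTheory

variable {M : Type*} [TopologicalSpace M]
  [ChartedSpace (EuclideanSpace ℝ (Fin 4)) M] [IsManifold (𝓡 4) ∞ M] {g : LorentzianMetric M}
  {H : Type*} [NormedAddCommGroup H] [InnerProductSpace ℂ H] [CompleteSpace H]
  (T : QuantumFieldTheory g H) (ξ : KillingPair g)

theorem star_Uξ (s : Plane) : star (T.Uξ ξ s) = T.Uξ ξ (-s) := by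
  rw [Uξ, Uξ, ξ.flow_neg, map_inv]
  rfl

theorem isPlaneRep_Uξ : IsPlaneRep (T.Uξ ξ) where
  map_zero := by simp [Uξ, ξ.flow_zero]
  map_add s t := by simp [Uξ, ξ.flow_add]
  star_eq := T.star_Uξ ξ
  continuous Ψ := (T.continuous_U Ψ).comp ξ.continuous_flow

theorem τ_eq_planeAd (s : Plane) (F : H →L[ℂ] H) : T.τ ξ s F = planeAd (T.Uξ ξ) s F := by
  rw [planeAd, ← T.star_Uξ ξ]
  rfl

theorem IsSmooth.isSmoothOp {T : QuantumFieldTheory g H} {ξ : KillingPair g} {F : H →L[ℂ] H}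
    (hF : T.IsSmooth ξ F) : IsSmoothOp (T.Uξ ξ) F := by
  have : (fun s ↦ planeAd (T.Uξ ξ) s F) = fun s ↦ T.τ ξ s F :=
    funext fun s ↦ (T.τ_eq_planeAd ξ s F).symm
  rw [IsSmoothOp, this]
  exact hF

/-- Commutation of γ with α on all bounded operators forces V to commute with each U(h) only up to a
sign, hence exactly with squares. In the plane every s is twice s/2, so U_ξ(s) is a square. -/
theorem commute_V_Uξ (s : Plane) : Commute T.V (T.Uξ ξ s) := by
  have hu := T.isPlaneRep_Uξ ξ
  have e : T.Uξ ξ s = T.Uξ ξ ((1 / 2 : ℝ) • s) * T.Uξ ξ ((1 / 2 : ℝ) • s) := by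
    rw [← hu.map_add, ← add_smul]
    norm_num
  rw [e]
  refine commute_mul_self_of_conj T.V_mul_V (hu.mul_neg _) (hu.neg_mul _) fun A ↦ ?_
  rw [← T.star_Uξ ξ]
  exact T.γ_comm_α _ A

theorem commute_Z_Uξ (s : Plane) : Commute T.Z (T.Uξ ξ s) :=
  ((Commute.one_left _).sub_left ((T.commute_V_Uξ ξ s).smul_left _)).smul_left _

theorem isWarpedConvolution_deformed (lam : ℝ) {F : H →L[ℂ] H} (hF : T.IsSmooth ξ F) :
    IsWarpedConvolution (T.Uξ ξ) lam F (T.deformed ξ lam F) := by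
  have h := (existsUnique_isWarpedConvolution (T.isPlaneRep_Uξ ξ) lam hF.isSmoothOp).exists
  rw [deformed, warpedConvolution, dif_pos h]
  exact h.choose_spec

end QuantumFieldTheory

end

theorem lemma3p2 {M : Type*} [TopologicalSpace M] [T2Space M] [ConnectedSpace M]
    [ChartedSpace (EuclideanSpace ℝ (Fin 4)) M] [IsManifold (𝓡 4) ∞ M] (g : LorentzianMetric M)
    {H : Type*} [NormedAddCommGroup H] [InnerProductSpace ℂ H] [CompleteSpace H]
    (T : QuantumFieldTheory g H) (ξ : KillingPair g) (lam : ℝ) (F G : H →L[ℂ] H)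
    (hF : F ∈ T.algebra) (hG : G ∈ T.algebra) (sF : T.IsSmooth ξ F) (sG : T.IsSmooth ξ G)
    (hFG : ∀ s : EuclideanSpace ℝ (Fin 2), ⁅T.Z * T.τ ξ s F * star T.Z, G⁆ = 0) :
    (∃! A : H →L[ℂ] H, IsWarpedConvolution (T.Uξ ξ) lam F A) ∧
    (∃! B : H →L[ℂ] H, IsWarpedConvolution (T.Uξ ξ) (-lam) G B) ∧
    ⁅T.Z * T.deformed ξ lam F * star T.Z, T.deformed ξ (-lam) G⁆ = 0 := by
  have hu := T.isPlaneRep_Uξ ξ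
  have hZ := T.commute_Z_Uξ ξ
  refine ⟨existsUnique_isWarpedConvolution hu lam sF.isSmoothOp,
    existsUnique_isWarpedConvolution hu (-lam) sG.isSmoothOp, ?_⟩
  rw [Ring.lie_def, sub_eq_zero]
  -- Since Z commutes with U_ξ, conjugating the deformed F by Z gives the warped convolution of
  -- ZFZ*, and τ_s(ZFZ*) = Z τ_s(F) Z* commutes with G by assumption.
  refine IsWarpedConvolution.commute hu (sF.isSmoothOp.conj hu hZ) sG.isSmoothOp (fun s ↦ ?_)
    ((T.isWarpedConvolution_deformed ξ lam sF).conj hu hZ)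
    (T.isWarpedConvolution_deformed ξ (-lam) sG)
  rw [planeAd_conj hZ s F _ (hu.commute_star hZ), ← T.τ_eq_planeAd, ← sub_eq_zero, ← Ring.lie_def]
  exact hFG s
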